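/- **Setting.** Let $\mathcal C$ be a category with finite colimits, $A$ an object of $\mathcal C$, $A^{(n)}$ the $n$-fold coproduct of copies of $A$, and $i_1,i_2:A\to A\amalg A$ the canonical maps. For $\sigma:A\amalg A\to A\amalg A$ let $\sigma_{k,k+1}=\mathrm{id}^{(k-1)}\amalg\sigma\amalg\mathrm{id}^{(n-k-1)}:A^{(n)}\to A^{(n)}$. The map $\sigma$ is called * *Yang–Baxter* if it is invertible and $\sigma_{23}\sigma_{12}\sigma_{23}=\sigma_{12}\sigma_{23}\sigma_{12}$ on $A^{(3)}$; then $\sigma_k\mapsto\sigma_{k,k+1}$ defines a left action $B_n\to\mathrm{Aut}(A^{(n)})$ of the Artin braid group, and the image of $\beta\in B_n$ is again written $\beta$; * *dualizable* if $\sigma$, $(\sigma i_2,i_2)$ and $(\sigma i_1,i_1):A\amalg A\to A\amalg A$ are invertible; * *Wada* if, with $p:A\amalg A\to E$ the coequalizer of $\sigma i_2$ and $i_2$, the map $j'=p\,i_1:A\to E$ is an isomorphism; its *torsion* is then $\chi=(j')^{-1}\,p\,\sigma\,i_1:A\to A$; * *Reidemeister* if it is Yang–Baxter, dualizable, and Wada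 with invertible torsion $\chi$. For a Reidemeister operator $\sigma$ and a braid $\beta\in B_n$ ($n\ge 1$) whose closure is a knot, the *writhe-adjusted categorical closure* $\mathcal L^{\mathrm{wa}}(A,\sigma)[\beta]$ is the coequalizer of $\mathrm{id}$ and $\Psi_0=\beta\circ(\chi^{-w}\amalg\mathrm{id}^{(n-1)}):A^{(n)}\to A^{(n)}$, where $w=w(\beta)\in\mathbb Z$ is the writhe (the exponent sum, the generators $\sigma_k$ being positive crossings). **Theorem.** Let $\sigma:A\amalg A\to A\amalg A$ be a Reidemeister operator. 1. (Markov invariance.) Let $\beta\in B_n$ be a braid that closes to a knot, and let $\gamma\in B_m$ be obtained from $\beta$ by a finite sequence of Markov moves (conjugation in a braid group, and stabilization $\beta\leftrightarrow\beta\sigma_n^{\pm1}$ between $B_n$ and $B_{n+1}$) and their inverses. Then $\gamma$ closes to a knot and $\mathcal L^{\mathrm{wa}}(A,\sigma)[\beta]\cong\mathcal L^{\mathrm{wa}}(A,\sigma)[\gamma]$ in $\mathcal C$. 2. (Knot invariant.) If two braids $\beta\in B_n$, $\gamma\in B_m$ close to the same oriented knot, then $\mathcal L^{\mathrm{wa}}(A,\sigma)[\beta]\cong\mathcal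 L^{\mathrm{wa}}(A,\sigma)[\gamma]$. Here two knots are the same if the signed Gauss codes of their diagrams are related by oriented Reidemeister moves, change of base point and renaming of crossings, where the intermediate codes need not be planar (so this holds in particular whenever the two closed braids are isotopic as oriented knots). -/

import Mathlib

open CategoryTheory CategoryTheory.Limits

/-! ## Braid groups, Markov moves -/

/-- The Artin relations on the generators `σ_i`, `i + 1 < n` (strands are numbered `0, …, n - 1`;
`σ_i` crosses the strands in positions `i` and `i + 1`). -/
inductive BraidRel (n : ℕ) : FreeGroup {i : ℕ // i + 1 < n} → Prop
  | far (i j : {i : ℕ // i + 1 < n}) (h : i.1 + 1 < j.1) :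
      BraidRel n (FreeGroup.of i * FreeGroup.of j * (FreeGroup.of j * FreeGroup.of i)⁻¹)
  | adj (i j : {i : ℕ // i + 1 < n}) (h : i.1 + 1 = j.1) :
      BraidRel n (FreeGroup.of j * FreeGroup.of i * FreeGroup.of j *
        (FreeGroup.of i * FreeGroup.of j * FreeGroup.of i)⁻¹)

/-- The Artin braid group `B_n`. -/
abbrev BraidGroup (n : ℕ) : Type := PresentedGroup {r | BraidRel n r}

namespace BraidGroup

/-- The generator crossing the strands in positions `i` and `i + 1`. -/
def gen (n : ℕ) (i : {i : ℕ // i + 1 < n}) : BraidGroup n := PresentedGroup.of i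

/-- Homomorphisms out of `B_n`: it suffices to verify the Artin relations. -/
def lift {n : ℕ} {G : Type*} [Group G] (f : {i : ℕ // i + 1 < n} → G)
    (far : ∀ i j : {i : ℕ // i + 1 < n}, i.1 + 1 < j.1 → f i * f j = f j * f i)
    (adj : ∀ i j : {i : ℕ // i + 1 < n}, i.1 + 1 = j.1 → f j * f i * f j = f i * f j * f i) :
    BraidGroup n →* G :=
  PresentedGroup.toGroup (f := f) (by
    rintro r (⟨i, j, h⟩ | ⟨i, j, h⟩)
    · simp only [map_mul, map_inv, FreeGroup.lift_apply_of, mul_inv_eq_one]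
      exact far i j h
    · simp only [map_mul, map_inv, FreeGroup.lift_apply_of, mul_inv_eq_one]
      exact adj i j h)

theorem gen_far {n : ℕ} (i j : {i : ℕ // i + 1 < n}) (h : i.1 + 1 < j.1) :
    gen n i * gen n j = gen n j * gen n i := by
  have := PresentedGroup.one_of_mem (rels := {r | BraidRel n r}) (BraidRel.far i j h)
  simp only [map_mul, map_inv, mul_inv_eq_one] at this
  exact this

theorem gen_adj {n : ℕ} (i j : {i : ℕ // i + 1 < n}) (h : i.1 + 1 = j.1) :
    gen n j * gen n i * gen n j = gen n i * gen n j * gen n i := by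
  have := PresentedGroup.one_of_mem (rels := {r | BraidRel n r}) (BraidRel.adj i j h)
  simp only [map_mul, map_inv, mul_inv_eq_one] at this
  exact this

/-- The writhe of a braid: the exponent sum, each generator being a positive crossing. -/
def writhe {n : ℕ} (β : BraidGroup n) : ℤ :=
  Multiplicative.toAdd
    (lift (fun _ => Multiplicative.ofAdd (1 : ℤ)) (fun _ _ _ => rfl) (fun _ _ _ => rfl) β)

/-- The permutation underlying a braid. -/
def perm (n : ℕ) : BraidGroup n →* Equiv.Perm (Fin n) :=
  lift (fun i => Equiv.swap ⟨i.1, by omega⟩ ⟨i.1 + 1, i.2⟩)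
    (by
      rintro ⟨i, hi⟩ ⟨j, hj⟩ h
      dsimp only at h
      refine (Equiv.Perm.disjoint_swap_swap ?_).commute.eq
      simp [Fin.ext_iff]
      omega)
    (by
      rintro ⟨i, hi⟩ ⟨j, hj⟩ h
      obtain rfl : i + 1 = j := h
      have h₁ := Equiv.swap_mul_swap_mul_swap (x := (⟨i, by omega⟩ : Fin n))
        (y := ⟨i + 1, by omega⟩) (z := ⟨i + 1 + 1, hj⟩) (by simp [Fin.ext_iff])
        (by simp only [ne_eq, Fin.ext_iff]; omega)
      have h₂ := Equiv.swap_mul_swap_mul_swap (x := (⟨i + 1 + 1, hj⟩ : Fin n))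
        (y := ⟨i + 1, by omega⟩) (z := ⟨i, by omega⟩) (by simp [Fin.ext_iff])
        (by simp only [ne_eq, Fin.ext_iff]; omega)
      rw [Equiv.swap_comm (⟨i + 1, by omega⟩ : Fin n) ⟨i, by omega⟩,
        Equiv.swap_comm (⟨i + 1 + 1, hj⟩ : Fin n) ⟨i + 1, by omega⟩,
        Equiv.swap_comm (⟨i, by omega⟩ : Fin n) ⟨i + 1 + 1, hj⟩] at h₂
      exact h₁.trans h₂.symm)

/-- The closure of `β` has exactly one component: its permutation is a single cycle on the
(nonempty) set of strands. -/
def ClosesToKnot {n : ℕ} (β : BraidGroup n) : Prop :=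
  0 < n ∧ ∀ i j : Fin n, (perm n β).SameCycle i j

/-- The inclusion `B_n → B_{n+1}` adding a trivial strand at the right. -/
def addStrand (n : ℕ) : BraidGroup n →* BraidGroup (n + 1) :=
  lift (fun i => gen (n + 1) ⟨i.1, by omega⟩)
    (fun _ _ h => gen_far _ _ h) (fun _ _ h => gen_adj _ _ h)

end BraidGroup

/-- The Markov moves on braids with any number of strands: conjugation, and stabilization
`β ↦ β σ_n^{±1}` from `B_n` to `B_{n+1}`, `n ≥ 1`. -/
inductive MarkovMove : (Σ n, BraidGroup n) → (Σ n, BraidGroup n) → Prop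
  | conj (n : ℕ) (β γ : BraidGroup n) : MarkovMove ⟨n, β⟩ ⟨n, γ * β * γ⁻¹⟩
  | stabPos (n : ℕ) (β : BraidGroup (n + 1)) :
      MarkovMove ⟨n + 1, β⟩
        ⟨n + 2, BraidGroup.addStrand (n + 1) β * BraidGroup.gen (n + 2) ⟨n, by omega⟩⟩
  | stabNeg (n : ℕ) (β : BraidGroup (n + 1)) :
      MarkovMove ⟨n + 1, β⟩
        ⟨n + 2, BraidGroup.addStrand (n + 1) β * (BraidGroup.gen (n + 2) ⟨n, by omega⟩)⁻¹⟩

/-- The equivalence relation generated by the Markov moves. -/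
def MarkovEquiv : (Σ n, BraidGroup n) → (Σ n, BraidGroup n) → Prop :=
  Relation.EqvGen MarkovMove

/-! ## Oriented knot diagrams and Reidemeister moves -/

/-- One passage through a crossing: the name of the crossing, whether the passage is the
overpass, and whether the crossing is positive. -/
@[ext] structure Passage where
  crossing : ℕ
  isOver : Bool
  isPositive : Bool

/-- The signed Gauss code of an oriented knot diagram: the passages through crossings met while
travelling once around the knot. -/
abbrev GaussCode : Type := List Passage

/-- The crossing `c` does not occur in the code. -/
def GaussCode.Fresh (c : ℕ) (w : GaussCode) : Prop := ∀ l ∈ w, l.crossing ≠ c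

/-- Elementary moves on signed Gauss codes: change of base point, renaming of crossings, the four
oriented first Reidemeister moves, the four oriented second Reidemeister moves (parallel and
antiparallel strands), and the third Reidemeister move on three parallel strands with positive
crossings, which is the braid relation (strand 1 passes over 2 and 3, strand 2 passes over 3;
`a`, `b`, `c` are the crossings of strands 1 and 2, 1 and 3, 2 and 3). Together with the first two
kinds of moves it generates all oriented third Reidemeister moves. The three strands may be met
in either cyclic order. Planarity is not required of the codes, so codes of isotopic knots
are always related by such moves. -/
inductive GaussMove : GaussCode → GaussCode → Prop
  | rotate (u v : GaussCode) : GaussMove (u ++ v) (v ++ u)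
  | rename (f : Equiv.Perm ℕ) (w : GaussCode) :
      GaussMove w (w.map fun l => ⟨f l.crossing, l.isOver, l.isPositive⟩)
  | reidemeister1 (w : GaussCode) (c : ℕ) (o s : Bool) (hc : w.Fresh c) :
      GaussMove w (⟨c, o, s⟩ :: ⟨c, !o, s⟩ :: w)
  | reidemeister2_parallel (u v : GaussCode) (c d : ℕ) (s : Bool) (hcd : c ≠ d)
      (hc : (u ++ v).Fresh c) (hd : (u ++ v).Fresh d) :
      GaussMove (u ++ v)
        (⟨c, true, s⟩ :: ⟨d, true, !s⟩ :: u ++ ⟨c, false, s⟩ :: ⟨d, false, !s⟩ :: v)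
  | reidemeister2_antiparallel (u v : GaussCode) (c d : ℕ) (s : Bool) (hcd : c ≠ d)
      (hc : (u ++ v).Fresh c) (hd : (u ++ v).Fresh d) :
      GaussMove (u ++ v)
        (⟨c, true, s⟩ :: ⟨d, true, !s⟩ :: u ++ ⟨d, false, !s⟩ :: ⟨c, false, s⟩ :: v)
  | reidemeister3_order123 (u v t : GaussCode) (a b c : ℕ) (hab : a ≠ b) (hac : a ≠ c)
      (hbc : b ≠ c) (ha : (u ++ v ++ t).Fresh a) (hb : (u ++ v ++ t).Fresh b)
      (hc : (u ++ v ++ t).Fresh c) :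
      GaussMove
        (⟨a, true, true⟩ :: ⟨b, true, true⟩ :: u ++ ⟨a, false, true⟩ :: ⟨c, true, true⟩ :: v ++
          ⟨b, false, true⟩ :: ⟨c, false, true⟩ :: t)
        (⟨b, true, true⟩ :: ⟨a, true, true⟩ :: u ++ ⟨c, true, true⟩ :: ⟨a, false, true⟩ :: v ++
          ⟨c, false, true⟩ :: ⟨b, false, true⟩ :: t)
  | reidemeister3_order132 (u v t : GaussCode) (a b c : ℕ) (hab : a ≠ b) (hac : a ≠ c)
      (hbc : b ≠ c) (ha : (u ++ v ++ t).Fresh a) (hb : (u ++ v ++ t).Fresh b)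
      (hc : (u ++ v ++ t).Fresh c) :
      GaussMove
        (⟨a, true, true⟩ :: ⟨b, true, true⟩ :: u ++ ⟨b, false, true⟩ :: ⟨c, false, true⟩ :: v ++
          ⟨a, false, true⟩ :: ⟨c, true, true⟩ :: t)
        (⟨b, true, true⟩ :: ⟨a, true, true⟩ :: u ++ ⟨c, false, true⟩ :: ⟨b, false, true⟩ :: v ++
          ⟨c, true, true⟩ :: ⟨a, false, true⟩ :: t)

/-- Two Gauss codes represent the same oriented knot. -/
def SameKnot : GaussCode → GaussCode → Prop := Relation.EqvGen GaussMove

/-- Braid words on `n` strands; `(i, true)` is the letter `σ_i`, `(i, false)` is `σ_i⁻¹`. -/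
abbrev BraidWord (n : ℕ) : Type := List ({i : ℕ // i + 1 < n} × Bool)

namespace BraidWord

/-- The braid represented by a word. -/
def toBraid {n : ℕ} (w : BraidWord n) : BraidGroup n :=
  PresentedGroup.mk {r | BraidRel n r} (FreeGroup.mk w)

/-- Follow the strand that enters the word `w` at position `p`: the list of its passages and its
final position. The crossings are numbered `k, k + 1, …` in the order of the letters of `w`.
At a letter `σ_i` the strand moving from position `i` to position `i + 1` is the overpass and the
crossing is positive; at a letter `σ_i⁻¹` it is the underpass and the crossing is negative. -/
def follow {n : ℕ} : BraidWord n → ℕ → ℕ → GaussCode × ℕ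
  | [], _, p => ([], p)
  | (i, s) :: w, k, p =>
    if p = i.1 then
      (⟨k, s, s⟩ :: (follow w (k + 1) (i.1 + 1)).1, (follow w (k + 1) (i.1 + 1)).2)
    else if p = i.1 + 1 then
      (⟨k, !s, s⟩ :: (follow w (k + 1) i.1).1, (follow w (k + 1) i.1).2)
    else follow w (k + 1) p

/-- Travel through the closure of `w` from position `p` along `m` consecutive strands. -/
def travel {n : ℕ} (w : BraidWord n) : ℕ → ℕ → GaussCode
  | 0, _ => []
  | m + 1, p => (w.follow 0 p).1 ++ travel w m (w.follow 0 p).2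

/-- The Gauss code of the closure of the braid word `w`, provided that it closes to a knot. -/
def closureCode {n : ℕ} (w : BraidWord n) : GaussCode := w.travel n 0

end BraidWord

/-! ## Cocartesian Yang–Baxter operators -/

universe v u

noncomputable section

namespace Cocartesian

variable {C : Type u} [Category.{v} C] [HasFiniteColimits C] {A : C}

/-- The `n`-fold coproduct `A^{(n)}` of copies of `A`. -/
abbrev copower (A : C) (n : ℕ) : C := ∐ (fun _ : Fin n => A)

/-- The inclusion `A ⨿ A ⟶ A^{(n)}` of the summands `i` and `i + 1`. -/
def pair (A : C) (n i : ℕ) (hi : i + 1 < n) : A ⨿ A ⟶ copower A n :=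
  coprod.desc (Sigma.ι (fun _ : Fin n => A) ⟨i, by omega⟩)
    (Sigma.ι (fun _ : Fin n => A) ⟨i + 1, hi⟩)

/-- The map `id ⨿ f ⨿ id : A^{(n)} ⟶ A^{(n)}`, where `f` acts on the summands `i` and `i + 1`. -/
def twist (f : A ⨿ A ⟶ A ⨿ A) (n i : ℕ) (hi : i + 1 < n) : copower A n ⟶ copower A n :=
  Sigma.desc fun k =>
    if k.1 = i then coprod.inl ≫ f ≫ pair A n i hi
    else if k.1 = i + 1 then coprod.inr ≫ f ≫ pair A n i hi
    else Sigma.ι (fun _ : Fin n => A) k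

/-- A cocartesian Yang–Baxter operator: an invertible `σ` with `σ₂₃σ₁₂σ₂₃ = σ₁₂σ₂₃σ₁₂`. -/
structure IsYangBaxter (σ : A ⨿ A ⟶ A ⨿ A) : Prop where
  isIso : IsIso σ
  yangBaxter :
    twist σ 3 1 (by omega) ≫ twist σ 3 0 (by omega) ≫ twist σ 3 1 (by omega) =
      twist σ 3 0 (by omega) ≫ twist σ 3 1 (by omega) ≫ twist σ 3 0 (by omega)

/-- Dualizable maps: `σ`, `(σ ∘ i₂, i₂)` and `(σ ∘ i₁, i₁)` are invertible. -/
structure IsDualizable (σ : A ⨿ A ⟶ A ⨿ A) : Prop where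
  isIso : IsIso σ
  right : IsIso (coprod.desc (coprod.inr ≫ σ) coprod.inr : A ⨿ A ⟶ A ⨿ A)
  left : IsIso (coprod.desc (coprod.inl ≫ σ) coprod.inl : A ⨿ A ⟶ A ⨿ A)

/-- The coequalizer `E` of `σ ∘ i₂` and `i₂`. -/
abbrev partialClosure (σ : A ⨿ A ⟶ A ⨿ A) : C :=
  coequalizer ((coprod.inr : A ⟶ A ⨿ A) ≫ σ) (coprod.inr : A ⟶ A ⨿ A)

/-- The universal map `p : A ⨿ A ⟶ E`. -/
abbrev partialClosureπ (σ : A ⨿ A ⟶ A ⨿ A) : A ⨿ A ⟶ partialClosure σ :=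
  coequalizer.π ((coprod.inr : A ⟶ A ⨿ A) ≫ σ) (coprod.inr : A ⟶ A ⨿ A)

/-- `σ` is Wada if `j' = p ∘ i₁ : A ⟶ E` is an isomorphism. -/
def IsWada (σ : A ⨿ A ⟶ A ⨿ A) : Prop :=
  IsIso ((coprod.inl : A ⟶ A ⨿ A) ≫ partialClosureπ σ)

/-- The torsion `χ(σ) = j'⁻¹ ∘ j` of a Wada map, where `j = p ∘ σ ∘ i₁`. -/
def torsion (σ : A ⨿ A ⟶ A ⨿ A) (h : IsWada σ) : A ⟶ A :=
  haveI : IsIso ((coprod.inl : A ⟶ A ⨿ A) ≫ partialClosureπ σ) := h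
  (coprod.inl ≫ σ ≫ partialClosureπ σ) ≫ inv ((coprod.inl : A ⟶ A ⨿ A) ≫ partialClosureπ σ)

/-- Reidemeister operators: Yang–Baxter, dualizable, and Wada with invertible torsion. -/
structure IsReidemeister (σ : A ⨿ A ⟶ A ⨿ A) : Prop where
  isYangBaxter : IsYangBaxter σ
  isDualizable : IsDualizable σ
  isWada : IsWada σ
  isIso_torsion : IsIso (torsion σ isWada)

theorem ι_twist_left (f : A ⨿ A ⟶ A ⨿ A) {n i : ℕ} (hi : i + 1 < n) (k : Fin n) (hk : k.1 = i) :
    Sigma.ι (fun _ : Fin n => A) k ≫ twist f n i hi = coprod.inl ≫ f ≫ pair A n i hi := by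
  simp [twist, hk]

theorem ι_twist_right (f : A ⨿ A ⟶ A ⨿ A) {n i : ℕ} (hi : i + 1 < n) (k : Fin n)
    (hk : k.1 = i + 1) :
    Sigma.ι (fun _ : Fin n => A) k ≫ twist f n i hi = coprod.inr ≫ f ≫ pair A n i hi := by
  simp [twist, hk]

theorem ι_twist_of_ne (f : A ⨿ A ⟶ A ⨿ A) {n i : ℕ} (hi : i + 1 < n) (k : Fin n)
    (h₁ : k.1 ≠ i) (h₂ : k.1 ≠ i + 1) :
    Sigma.ι (fun _ : Fin n => A) k ≫ twist f n i hi = Sigma.ι (fun _ : Fin n => A) k := by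
  simp [twist, h₁, h₂]

theorem pair_twist (f : A ⨿ A ⟶ A ⨿ A) {n i : ℕ} (hi : i + 1 < n) :
    pair A n i hi ≫ twist f n i hi = f ≫ pair A n i hi := by
  apply coprod.hom_ext
  · rw [pair, coprod.inl_desc_assoc, ι_twist_left f hi _ rfl, pair]
  · rw [pair, coprod.inr_desc_assoc, ι_twist_right f hi _ rfl, pair]

theorem pair_twist_of_far (f : A ⨿ A ⟶ A ⨿ A) {n i j : ℕ} (hi : i + 1 < n) (hj : j + 1 < n)
    (h : i + 1 < j ∨ j + 1 < i) :
    pair A n j hj ≫ twist f n i hi = pair A n j hj := by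
  apply coprod.hom_ext
  · rw [pair, coprod.inl_desc_assoc, coprod.inl_desc, ι_twist_of_ne] <;> dsimp only <;> omega
  · rw [pair, coprod.inr_desc_assoc, coprod.inr_desc, ι_twist_of_ne] <;> dsimp only <;> omega

theorem twist_comp (f g : A ⨿ A ⟶ A ⨿ A) {n i : ℕ} (hi : i + 1 < n) :
    twist f n i hi ≫ twist g n i hi = twist (f ≫ g) n i hi := by
  apply Sigma.hom_ext
  intro k
  by_cases h₁ : k.1 = i
  · simp only [reassoc_of% (ι_twist_left f hi k h₁), ι_twist_left _ hi k h₁, Category.assoc,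
      pair_twist]
  by_cases h₂ : k.1 = i + 1
  · simp only [reassoc_of% (ι_twist_right f hi k h₂), ι_twist_right _ hi k h₂, Category.assoc,
      pair_twist]
  · rw [reassoc_of% (ι_twist_of_ne f hi k h₁ h₂), ι_twist_of_ne _ hi k h₁ h₂, ι_twist_of_ne _ hi k h₁ h₂]

theorem twist_id {n i : ℕ} (hi : i + 1 < n) : twist (𝟙 (A ⨿ A)) n i hi = 𝟙 (copower A n) := by
  apply Sigma.hom_ext
  intro k
  rw [Category.comp_id]
  by_cases h₁ : k.1 = i
  · rw [ι_twist_left _ hi k h₁, Category.id_comp, pair, coprod.inl_desc]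
    congr 1
    exact Fin.ext h₁.symm
  by_cases h₂ : k.1 = i + 1
  · rw [ι_twist_right _ hi k h₂, Category.id_comp, pair, coprod.inr_desc]
    congr 1
    exact Fin.ext h₂.symm
  · rw [ι_twist_of_ne _ hi k h₁ h₂]

theorem twist_far (f : A ⨿ A ⟶ A ⨿ A) {n i j : ℕ} (hi : i + 1 < n) (hj : j + 1 < n)
    (h : i + 1 < j) :
    twist f n i hi ≫ twist f n j hj = twist f n j hj ≫ twist f n i hi := by
  apply Sigma.hom_ext
  intro k
  by_cases h₁ : k.1 = i
  · simp only [reassoc_of% (ι_twist_left f hi k h₁), reassoc_of% (ι_twist_of_ne f hj k (by omega) (by omega)),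
      ι_twist_left f hi k h₁,
      pair_twist_of_far f hj hi (.inr h)]
  by_cases h₂ : k.1 = i + 1
  · simp only [reassoc_of% (ι_twist_right f hi k h₂), reassoc_of% (ι_twist_of_ne f hj k (by omega) (by omega)),
      ι_twist_right f hi k h₂,
      pair_twist_of_far f hj hi (.inr h)]
  rw [reassoc_of% (ι_twist_of_ne f hi k h₁ h₂)]
  by_cases h₃ : k.1 = j
  · simp only [ι_twist_left f hj k h₃, reassoc_of% (ι_twist_left f hj k h₃),
      pair_twist_of_far f hi hj (.inl h)]
  by_cases h₄ : k.1 = j + 1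
  · simp only [ι_twist_right f hj k h₄, reassoc_of% (ι_twist_right f hj k h₄),
      pair_twist_of_far f hi hj (.inl h)]
  · rw [ι_twist_of_ne f hj k h₃ h₄, reassoc_of% (ι_twist_of_ne f hj k h₃ h₄), ι_twist_of_ne f hi k h₁ h₂]

/-- The inclusion `A^{(3)} ⟶ A^{(n)}` of the summands `i`, `i + 1`, `i + 2`. -/
def triple (A : C) (n i : ℕ) (hi : i + 2 < n) : copower A 3 ⟶ copower A n :=
  Sigma.desc fun k => Sigma.ι (fun _ : Fin n => A) ⟨i + k.1, by omega⟩

theorem ι_triple {n i : ℕ} (hi : i + 2 < n) (k : Fin 3) :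
    Sigma.ι (fun _ : Fin 3 => A) k ≫ triple A n i hi =
      Sigma.ι (fun _ : Fin n => A) ⟨i + k.1, by omega⟩ := by
  simp [triple]

theorem pair_triple {n i : ℕ} (hi : i + 2 < n) (e : ℕ) (he : e + 1 < 3) :
    pair A 3 e he ≫ triple A n i hi = pair A n (i + e) (by omega) := by
  apply coprod.hom_ext
  · rw [pair, coprod.inl_desc_assoc, ι_triple, pair, coprod.inl_desc]
  · rw [pair, coprod.inr_desc_assoc, ι_triple, pair, coprod.inr_desc]
    rfl

theorem triple_twist (f : A ⨿ A ⟶ A ⨿ A) {n i : ℕ} (hi : i + 2 < n) (e : ℕ) (he : e + 1 < 3) :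
    triple A n i hi ≫ twist f n (i + e) (by omega) = twist f 3 e he ≫ triple A n i hi := by
  apply Sigma.hom_ext
  intro k
  rw [reassoc_of% (ι_triple hi k)]
  by_cases h₁ : k.1 = e
  · rw [reassoc_of% (ι_twist_left f he k h₁), ι_twist_left _ _ _ (by dsimp only; omega),
      pair_triple]
  by_cases h₂ : k.1 = e + 1
  · rw [reassoc_of% (ι_twist_right f he k h₂), ι_twist_right _ _ _ (by dsimp only; omega),
      pair_triple]
  · rw [reassoc_of% (ι_twist_of_ne f he k h₁ h₂), ι_triple,
      ι_twist_of_ne _ _ _ (by dsimp only; omega) (by dsimp only; omega)]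

theorem IsYangBaxter.twist_adj {σ : A ⨿ A ⟶ A ⨿ A} (h : IsYangBaxter σ) {n i : ℕ}
    (hi : i + 1 + 1 < n) :
    twist σ n (i + 1) hi ≫ twist σ n i (by omega) ≫ twist σ n (i + 1) hi =
      twist σ n i (by omega) ≫ twist σ n (i + 1) hi ≫ twist σ n i (by omega) := by
  have h0 : triple A n i hi ≫ twist σ n i (by omega) = twist σ 3 0 (by omega) ≫ triple A n i hi :=
    triple_twist σ hi 0 (by omega)
  have h1 : triple A n i hi ≫ twist σ n (i + 1) hi = twist σ 3 1 (by omega) ≫ triple A n i hi :=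
    triple_twist σ hi 1 (by omega)
  have key : triple A n i hi ≫ twist σ n (i + 1) hi ≫ twist σ n i (by omega) ≫
        twist σ n (i + 1) hi =
      triple A n i hi ≫ twist σ n i (by omega) ≫ twist σ n (i + 1) hi ≫
        twist σ n i (by omega) := by
    rw [reassoc_of% h1, reassoc_of% h0, h1, reassoc_of% h0, reassoc_of% h1, h0]
    simpa only [Category.assoc] using congrArg (· ≫ triple A n i hi) h.yangBaxter
  apply Sigma.hom_ext
  intro k
  by_cases hk : i ≤ k.1 ∧ k.1 ≤ i + 2
  · have hk' : Sigma.ι (fun _ : Fin n => A) k =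
        Sigma.ι (fun _ : Fin 3 => A) ⟨k.1 - i, by omega⟩ ≫ triple A n i hi := by
      rw [ι_triple]
      congr 1
      apply Fin.ext
      dsimp only
      omega
    simp only [hk', Category.assoc, key]
  · have e0 := ι_twist_of_ne σ (n := n) (i := i) (by omega) k (by omega) (by omega)
    have e1 := ι_twist_of_ne σ hi k (by omega) (by omega)
    rw [reassoc_of% e1, reassoc_of% e0, e1, reassoc_of% e0, reassoc_of% e1, e0]

/-- The automorphism `σ_{i,i+1} = id ⨿ σ ⨿ id` of `A^{(n)}`. -/
def twistAut (σ : A ⨿ A ⟶ A ⨿ A) (hσ : IsIso σ) (n i : ℕ) (hi : i + 1 < n) :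
    Aut (copower A n) where
  hom := twist σ n i hi
  inv := twist (inv σ) n i hi
  hom_inv_id := by rw [twist_comp, IsIso.hom_inv_id, twist_id]
  inv_hom_id := by rw [twist_comp, IsIso.inv_hom_id, twist_id]

/-- The left action `B_n → Aut A^{(n)}` generated by a cocartesian Yang–Baxter operator
(the product of `Aut` is composition of maps: `f * g` means first `g`, then `f`). -/
def braidAction {σ : A ⨿ A ⟶ A ⨿ A} (hσ : IsYangBaxter σ) (n : ℕ) :
    BraidGroup n →* Aut (copower A n) :=
  BraidGroup.lift (fun i => twistAut σ hσ.isIso n i.1 i.2)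
    (fun i j h => by
      apply Aut.ext
      exact (twist_far σ i.2 j.2 h).symm)
    (by
      rintro ⟨i, hi⟩ ⟨j, hj⟩ h
      obtain rfl : i + 1 = j := h
      apply Aut.ext
      exact hσ.twist_adj hj)

/-- The invertible torsion of a Reidemeister operator, as an automorphism of `A`. -/
def torsionAut {σ : A ⨿ A ⟶ A ⨿ A} (hσ : IsReidemeister σ) : Aut A :=
  haveI := hσ.isIso_torsion
  asIso (torsion σ hσ.isWada)

/-- The map `f ⨿ id^{(n-1)} : A^{(n)} ⟶ A^{(n)}`. -/
def onFirst (f : A ⟶ A) (n : ℕ) : copower A n ⟶ copower A n :=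
  Limits.Sigma.map fun k : Fin n => if k.1 = 0 then f else 𝟙 A

/-- The map `Ψ₀ = β ∘ (χ^{-w} ⨿ id^{(n-1)})`, where `w` is the writhe of `β`. -/
def psi {σ : A ⨿ A ⟶ A ⨿ A} (hσ : IsReidemeister σ) {n : ℕ} (β : BraidGroup n) :
    copower A n ⟶ copower A n :=
  onFirst ((torsionAut hσ) ^ (-β.writhe)).hom n ≫ (braidAction hσ.isYangBaxter n β).hom

/-- The writhe-adjusted categorical closure of `β`: the coequalizer of `id` and `Ψ₀`. -/
def writheAdjustedClosure {σ : A ⨿ A ⟶ A ⨿ A} (hσ : IsReidemeister σ) {n : ℕ}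
    (β : BraidGroup n) : C :=
  coequalizer (𝟙 (copower A n)) (psi hσ β)

end Cocartesian

end

/-! By Yoneda, it suffices to compare, naturally in `X`, the `Ψ₀`-invariant morphisms `A^{(n)} ⟶ X`.
Such a morphism is an `n`-tuple of elements of `S = (A ⟶ X)`, and precomposition with `σ` is an
operation on `S × S`. It makes `S` a birack (`homBirack`): the Yang–Baxter equation becomes its
set-theoretic form, dualizability lets one solve for labels sideways across a crossing, and the Wada
condition says that a strand labelled `a` carries exactly one kink of the given shape, after which
its label is `χ a`. Hence an invariant tuple is a labeling of the arcs of the closed braid which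
satisfies one relation at each crossing and jumps by `χ^w` at a base point.

The central fact is that the torsion travels along its own strand and is not seen by the strands it
crosses (`op_torsion_right`, `op_torsion_left`); it follows from the Yang–Baxter equation by sliding
a strand across a kink. Therefore the overpass and the underpass of a crossing may be shifted by
independent powers of `χ` (`crossingRel_shift`), the place of the jump is immaterial, and all four
types of kinks multiply a label by `χ` to the sign of the crossing (`KinkRel.eq_shift`).

For the knot invariant, labelings are defined on Gauss codes, with no reference to a plane. Every
Gauss move gives a natural bijection of labelings (`LabelEquiv.of_gaussMove`): a kink changes the
label and the writhe by matching powers of `χ`, the second move is invertibility of `σ` or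
dualizability, the third is the Yang–Baxter equation, and a change of base point is absorbed by
`χ^w`. Labelings of the code of a closed braid word are the invariant tuples (`IsClosed.isLabeling`,
`IsClosed.eq`, `IsLabeling.exists_isClosed`), and `nonempty_iso_of_rel` turns the bijections into
isomorphisms.

Markov invariance is proved on the braids themselves. Since the closure is a knot, a power of `χ`
can be conjugated from any strand to any other (`isConj_torsionPow`). This settles conjugation; for
a stabilization, the new factor `χ^{∓1}` is moved next to the new crossing, where it cancels the
torsion of the kink (`run_stabilize_iff`). -/

/-! ### Biracks, kinks and the torsion. -/

/-- A birack with invertible torsion: the structure which a Reidemeister operator induces on the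
sets `A ⟶ X`. The operation sends the labels `(a, b)` of two strands to `(left a b, right a b)`. -/
structure Birack (S : Type*) where
  left : S → S → S
  right : S → S → S
  torsion : Equiv.Perm S
  op_injective : ∀ {a b a' b'}, left a b = left a' b' → right a b = right a' b' → a = a' ∧ b = b'
  op_surjective : ∀ c d, ∃ a b, left a b = c ∧ right a b = d
  left_injective : ∀ {a b b'}, left a b = left a b' → b = b'
  left_surjective : ∀ a c, ∃ b, left a b = c
  right_injective : ∀ {a a' b}, right a b = right a' b → a = a'
  right_surjective : ∀ b c, ∃ a, right a b = c
  yangBaxter_left : ∀ p q s, left (left p q) (left (right p q) s) = left p (left q s)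
  yangBaxter_middle : ∀ p q s, right (left p q) (left (right p q) s) =
    left (right p (left q s)) (right q s)
  yangBaxter_right : ∀ p q s, right (right p q) s = right (right p (left q s)) (right q s)
  kink_exists : ∀ a, ∃ b, right a b = b ∧ left a b = torsion a
  kink_unique : ∀ {a b b'}, right a b = b → right a b' = b' → b = b'

namespace Birack

variable {S T : Type*} (B : Birack S)

theorem left_eq_torsion {a b : S} (h : B.right a b = b) : B.left a b = B.torsion a := by
  obtain ⟨b', h₁, h₂⟩ := B.kink_exists a
  rwa [B.kink_unique h h₁]

/-- The torsion passes from the right entry to the left one. -/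
theorem op_torsion_right (s t : S) :
    B.left s (B.torsion t) = B.torsion (B.left s t) ∧ B.right s (B.torsion t) = B.right s t := by
  -- Put a kink with loop `z` on the strand `t` and slide it across the strand `s` by the
  -- Yang–Baxter equation. Cancelling `z` on the right shows that the result is a kink on `left s
  -- t`.
  obtain ⟨z, hz, hz'⟩ := B.kink_exists t
  have h₁ := B.yangBaxter_left s t z
  have h₂ := B.yangBaxter_middle s t z
  have h₃ := B.yangBaxter_right s t z
  rw [hz'] at h₁ h₂ h₃
  rw [hz] at h₂ h₃
  have h₄ := B.right_injective h₃
  rw [← h₄] at h₂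
  exact ⟨by rw [← h₁, B.left_eq_torsion h₂], h₄.symm⟩

/-- The torsion passes from the left entry to the right one. -/
theorem op_torsion_left (x q : S) :
    B.left (B.torsion x) q = B.left x q ∧ B.right (B.torsion x) q = B.torsion (B.right x q) := by
  obtain ⟨z, hz, hz'⟩ := B.kink_exists (B.right x q)
  -- The kink sits on `x` after its crossing with `q`; the pair `(m, w)` is what must enter to slide
  -- it back. Yang–Baxter and cancellation of `w` then force `right x m = m`, a kink on `x` itself.
  obtain ⟨m, w, hm, hw⟩ := B.op_surjective q z
  have h₁ := B.yangBaxter_left x m w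
  have h₂ := B.yangBaxter_middle x m w
  have h₃ := B.yangBaxter_right x m w
  rw [hm] at h₁ h₂ h₃
  rw [hw, hz'] at h₂
  rw [hw, hz, ← hw] at h₃
  have h₄ := B.right_injective h₃
  rw [h₄, hm, B.left_eq_torsion h₄] at h₁ h₂
  exact ⟨h₁, h₂⟩

/-- The closure of a crossing along its left strand. -/
theorem leftKink_exists (x : S) : ∃ b, B.left b x = b ∧ B.right b x = B.torsion x := by
  -- The roles of strand and loop are exchanged: `x` is the loop of a right kink on `z`, and
  -- `torsion z` is the loop of the left kink on `x`.
  obtain ⟨z, hz⟩ := B.right_surjective x x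
  refine ⟨B.torsion z, ?_, ?_⟩
  · rw [(B.op_torsion_left _ _).1, B.left_eq_torsion hz]
  · rw [(B.op_torsion_left _ _).2, hz]

/-- Write `b = torsion z`. The torsion is invisible to `left`, so `left z x = torsion z`; the loop
of the right kink on `z` satisfies the same equation and equals `x` by left cancellation. Left kinks
thus inherit uniqueness from right cancellation. -/
theorem right_symm_torsion_of_leftKink {x b : S} (h : B.left b x = b) :
    B.right (B.torsion.symm b) x = x := by
  obtain ⟨z, rfl⟩ := B.torsion.surjective b
  rw [(B.op_torsion_left _ _).1] at h
  obtain ⟨w, hw, hw'⟩ := B.kink_exists z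
  obtain rfl := B.left_injective (hw'.trans h.symm)
  rwa [Equiv.symm_apply_apply]

theorem leftKink_unique {x b b' : S} (h : B.left b x = b) (h' : B.left b' x = b') : b = b' :=
  B.torsion.symm.injective (B.right_injective
    ((B.right_symm_torsion_of_leftKink h).trans (B.right_symm_torsion_of_leftKink h').symm))

theorem right_leftKink {x b : S} (h : B.left b x = b) : B.right b x = B.torsion x := by
  obtain ⟨b', h₁, h₂⟩ := B.leftKink_exists x
  rwa [B.leftKink_unique h h₁]

/-- Applying a power of the torsion. -/
def shift (k : ℤ) : S ≃ S := B.torsion ^ k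

theorem shift_zero (x : S) : B.shift 0 x = x := by simp [shift]

theorem shift_one (x : S) : B.shift 1 x = B.torsion x := by simp [shift]

theorem shift_add (j k : ℤ) (x : S) : B.shift (j + k) x = B.shift j (B.shift k x) := by
  simp [shift, zpow_add]

theorem shift_neg_shift (k : ℤ) (x : S) : B.shift (-k) (B.shift k x) = x := by
  rw [← shift_add, neg_add_cancel, shift_zero]

theorem shift_shift_neg (k : ℤ) (x : S) : B.shift k (B.shift (-k) x) = x := by
  rw [← shift_add, add_neg_cancel, shift_zero]

/-- Commutation with the torsion extends to negative powers because the torsions are invertible on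
both sides. -/
theorem semiconj_shift {f : S → T} {B' : Birack T} (h : ∀ a, f (B.torsion a) = B'.torsion (f a))
    (k : ℤ) (a : S) : f (B.shift k a) = B'.shift k (f a) := by
  have hn : ∀ (n : ℕ) (a : S), f (B.shift n a) = B'.shift n (f a) := by
    intro n
    induction n with
    | zero => simp [shift_zero]
    | succ n ih =>
      intro a
      push_cast
      rw [shift_add, shift_add, ih, shift_one, shift_one, h]
  obtain ⟨n, rfl | rfl⟩ := k.eq_nat_or_neg
  · exact hn n a
  · rw [← B'.shift_neg_shift n (f (B.shift (-n) a)), ← hn, shift_shift_neg]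

theorem left_shift_left (k : ℤ) (a b : S) : B.left (B.shift k a) b = B.left a b := by
  have hn : ∀ (n : ℕ) (a : S), B.left (B.shift n a) b = B.left a b := by
    intro n
    induction n with
    | zero => simp [shift_zero]
    | succ n ih =>
      intro a
      push_cast
      rw [shift_add, shift_one, ih, (B.op_torsion_left _ _).1]
  obtain ⟨n, rfl | rfl⟩ := k.eq_nat_or_neg
  · exact hn n a
  · rw [← hn n, shift_shift_neg]

theorem right_shift_left (k : ℤ) (a b : S) :
    B.right (B.shift k a) b = B.shift k (B.right a b) :=
  B.semiconj_shift (f := (B.right · b)) (fun a => (B.op_torsion_left a b).2) k a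

theorem left_shift_right (k : ℤ) (a b : S) :
    B.left a (B.shift k b) = B.shift k (B.left a b) :=
  B.semiconj_shift (f := B.left a) (fun b => (B.op_torsion_right a b).1) k b

theorem right_shift_right (k : ℤ) (a b : S) : B.right a (B.shift k b) = B.right a b := by
  have hn : ∀ (n : ℕ) (b : S), B.right a (B.shift n b) = B.right a b := by
    intro n
    induction n with
    | zero => simp [shift_zero]
    | succ n ih =>
      intro b
      push_cast
      rw [shift_add, shift_one, ih, (B.op_torsion_right _ _).2]
  obtain ⟨n, rfl | rfl⟩ := k.eq_nat_or_neg
  · exact hn n b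
  · rw [← hn n, shift_shift_neg]

/-- Homomorphisms of biracks. -/
structure IsHom (B : Birack S) (B' : Birack T) (f : S → T) : Prop where
  left : ∀ a b, f (B.left a b) = B'.left (f a) (f b)
  right : ∀ a b, f (B.right a b) = B'.right (f a) (f b)
  torsion : ∀ a, f (B.torsion a) = B'.torsion (f a)

theorem IsHom.shift {B : Birack S} {B' : Birack T} {f : S → T} (h : IsHom B B' f) (k : ℤ) (a : S) :
    f (B.shift k a) = B'.shift k (f a) :=
  B.semiconj_shift h.torsion k a

/-- The relation between the incoming labels `a`, `b` and the outgoing labels `a'`, `b'` of the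
overpass and the underpass of a crossing of sign `s`. -/
def CrossingRel (s : Bool) (a a' b b' : S) : Prop :=
  bif s then B.left a b = b' ∧ B.right a b = a' else B.left a' b' = b ∧ B.right a' b' = a

theorem crossingRel_true {a a' b b' : S} :
    B.CrossingRel true a a' b b' ↔ B.left a b = b' ∧ B.right a b = a' := Iff.rfl

theorem crossingRel_false {a a' b b' : S} :
    B.CrossingRel false a a' b b' ↔ B.left a' b' = b ∧ B.right a' b' = a := Iff.rfl

theorem IsHom.crossingRel {B : Birack S} {B' : Birack T} {f : S → T} (h : IsHom B B' f)
    {s : Bool} {a a' b b' : S} (H : B.CrossingRel s a a' b b') :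
    B'.CrossingRel s (f a) (f a') (f b) (f b') := by
  cases s
  · rw [crossingRel_false] at H ⊢
    rw [← h.left, ← h.right, H.1, H.2]
    exact ⟨rfl, rfl⟩
  · rw [crossingRel_true] at H ⊢
    rw [← h.left, ← h.right, H.1, H.2]
    exact ⟨rfl, rfl⟩

/-- Each strand carries its own power of the torsion through the crossing. That `j` and `k` are
independent is what allows the base point to be moved. -/
theorem crossingRel_shift (j k : ℤ) {s : Bool} {a a' b b' : S} (H : B.CrossingRel s a a' b b') :
    B.CrossingRel s (B.shift j a) (B.shift j a') (B.shift k b) (B.shift k b') := by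
  cases s
  · rw [crossingRel_false] at H ⊢
    rw [left_shift_left, left_shift_right, right_shift_left, right_shift_right, H.1, H.2]
    exact ⟨rfl, rfl⟩
  · rw [crossingRel_true] at H ⊢
    rw [left_shift_left, left_shift_right, right_shift_left, right_shift_right, H.1, H.2]
    exact ⟨rfl, rfl⟩

end Birack

/-! ### Labelings of Gauss codes and their natural bijections. -/

/-- A passage of a Gauss code with labels on the incoming and on the outgoing edge. -/
structure LabeledPassage (S : Type*) where
  passage : Passage
  source : S
  target : S

namespace LabeledPassage

variable {S T : Type*}

/-- Apply a map to the labels. -/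
def map (f : S → T) (P : LabeledPassage S) : LabeledPassage T := ⟨P.passage, f P.source, f P.target⟩

/-- The labels of consecutive passages fit, from the label `x` to the label `y`. -/
def IsPath : S → List (LabeledPassage S) → S → Prop
  | x, [], y => x = y
  | x, P :: l, y => P.source = x ∧ IsPath P.target l y

theorem isPath_append {x y : S} {l m : List (LabeledPassage S)} :
    IsPath x (l ++ m) y ↔ ∃ z, IsPath x l z ∧ IsPath z m y := by
  induction l generalizing x with
  | nil => simp [IsPath]
  | cons P l ih => simp [IsPath, ih, and_assoc]

theorem IsPath.right_unique {x y y' : S} {l : List (LabeledPassage S)} (h : IsPath x l y)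
    (h' : IsPath x l y') : y = y' := by
  induction l generalizing x with
  | nil => exact h.symm.trans h'
  | cons P l ih => exact ih h.2 h'.2

theorem IsPath.map {f : S → T} {x y : S} {l : List (LabeledPassage S)} (h : IsPath x l y) :
    IsPath (f x) (l.map (map f)) (f y) := by
  induction l generalizing x with
  | nil => exact congrArg f h
  | cons P l ih => exact ⟨congrArg f h.1, ih h.2⟩

theorem map_passage_map (f : S → T) (l : List (LabeledPassage S)) :
    (l.map (map f)).map passage = l.map passage := by
  simp [LabeledPassage.map, Function.comp_def]

end LabeledPassage

open LabeledPassage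

namespace Birack

variable {S T : Type*} (B : Birack S)

/-- The labels of `l` are related to the labels of `m` at all crossings at which `l` passes over
`m`. -/
def Over (l m : List (LabeledPassage S)) : Prop :=
  ∀ P ∈ l, ∀ Q ∈ m, P.passage.isOver = true → Q.passage.isOver = false →
    P.passage.crossing = Q.passage.crossing →
      B.CrossingRel P.passage.isPositive P.source P.target Q.source Q.target

/-- The crossing relations hold at all crossings of `l` with itself. -/
def Consistent (l : List (LabeledPassage S)) : Prop := B.Over l l

end Birack

/-- The writhe of a Gauss code. -/
def GaussCode.writhe (w : GaussCode) : ℤ :=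
  (w.map fun l => if l.isOver then (if l.isPositive then 1 else -1) else 0).sum

theorem GaussCode.writhe_append (w w' : GaussCode) :
    GaussCode.writhe (w ++ w') = w.writhe + GaussCode.writhe w' := by
  simp [GaussCode.writhe]

/-- A starting label and labels for all passages, whose total monodromy is the torsion to the
power of the writhe. -/
structure Birack.IsLabeling {S : Type*} (B : Birack S) (w : GaussCode)
    (x : S × List (LabeledPassage S)) : Prop where
  map_passage : x.2.map passage = w
  consistent : B.Consistent x.2
  isPath : IsPath x.1 x.2 (B.shift w.writhe x.1)

/-- The labelings of two codes are in a natural bijection. -/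
def LabelEquiv (w w' : GaussCode) : Prop :=
  ∃ R : ∀ {S : Type v}, Birack S → S × List (LabeledPassage S) → S × List (LabeledPassage S) → Prop,
    (∀ {S T : Type v} (B : Birack S) (B' : Birack T) (f : S → T), Birack.IsHom B B' f →
      ∀ x y, R B x y → R B' (x.map f (List.map (map f))) (y.map f (List.map (map f)))) ∧
    (∀ {S : Type v} (B : Birack S) (x), B.IsLabeling w x → ∃! y, B.IsLabeling w' y ∧ R B x y) ∧
    (∀ {S : Type v} (B : Birack S) (y), B.IsLabeling w' y → ∃! x, B.IsLabeling w x ∧ R B x y)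

theorem LabelEquiv.refl (w : GaussCode) : LabelEquiv.{v} w w :=
  ⟨fun _ x y => x = y, by rintro S T B B' f - x _ rfl; rfl,
    fun _ x hx => ⟨x, ⟨hx, rfl⟩, fun _ h => h.2.symm⟩,
    fun _ x hx => ⟨x, ⟨hx, rfl⟩, fun _ h => h.2⟩⟩

theorem LabelEquiv.symm {w w' : GaussCode} : LabelEquiv.{v} w w' → LabelEquiv.{v} w' w := by
  rintro ⟨R, h₁, h₂, h₃⟩
  exact ⟨fun B x y => R B y x, fun B B' f hf x y => h₁ B B' f hf y x, h₃, h₂⟩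

theorem existsUnique_comp {α β γ : Type*} {p : α → Prop} {q : β → Prop} {r : γ → Prop}
    {R : α → β → Prop} {R' : β → γ → Prop} (h₁ : ∀ x, p x → ∃! y, q y ∧ R x y)
    (h₂ : ∀ y, q y → ∃! z, r z ∧ R' y z) (x : α) (hx : p x) :
    ∃! z, r z ∧ ∃ y, q y ∧ R x y ∧ R' y z := by
  obtain ⟨y, ⟨hy, hxy⟩, hy'⟩ := h₁ x hx
  obtain ⟨z, ⟨hz, hyz⟩, hz'⟩ := h₂ y hy
  refine ⟨z, ⟨hz, y, hy, hxy, hyz⟩, ?_⟩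
  rintro z' ⟨hz₁, y', hy₁, hxy', hyz'⟩
  obtain rfl := hy' y' ⟨hy₁, hxy'⟩
  exact hz' z' ⟨hz₁, hyz'⟩

theorem Birack.IsLabeling.map {S T : Type*} {B : Birack S} {B' : Birack T} {f : S → T}
    (hf : Birack.IsHom B B' f) {w : GaussCode} {x : S × List (LabeledPassage S)}
    (h : B.IsLabeling w x) : B'.IsLabeling w (x.map f (List.map (LabeledPassage.map f))) := by
  refine ⟨(map_passage_map f _).trans h.map_passage, ?_, ?_⟩
  · intro P hP Q hQ h₁ h₂ h₃
    obtain ⟨P, hP', rfl⟩ := List.mem_map.1 hP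
    obtain ⟨Q, hQ', rfl⟩ := List.mem_map.1 hQ
    exact hf.crossingRel (h.consistent P hP' Q hQ' h₁ h₂ h₃)
  · have := h.isPath.map (f := f)
    rwa [hf.shift] at this

/-- Nothing is known about `R` off labelings, so the composite relation must require the middle term
to be a labeling. Its naturality then rests on `IsLabeling.map`. -/
theorem LabelEquiv.trans {w w' w'' : GaussCode} :
    LabelEquiv.{v} w w' → LabelEquiv.{v} w' w'' → LabelEquiv.{v} w w'' := by
  rintro ⟨R, h₁, h₂, h₃⟩ ⟨R', h₁', h₂', h₃'⟩
  refine ⟨fun B x z => ∃ y, B.IsLabeling w' y ∧ R B x y ∧ R' B y z, ?_, ?_, ?_⟩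
  · rintro S T B B' f hf x z ⟨y, hy, hxy, hyz⟩
    exact ⟨_, hy.map hf, h₁ B B' f hf _ _ hxy, h₁' B B' f hf _ _ hyz⟩
  · intro S B x hx
    exact existsUnique_comp (h₂ B) (h₂' B) x hx
  · intro S B x hx
    obtain ⟨z, ⟨h, y, a, b, c⟩, hz⟩ := existsUnique_comp (h₃' B) (h₃ B) x hx
    refine ⟨z, ⟨h, y, a, c, b⟩, ?_⟩
    rintro z' ⟨h', y', a', b', c'⟩
    exact hz z' ⟨h', y', a', c', b'⟩

/-! ### Change of base point and renaming -/

theorem Birack.Over.shift {S : Type*} {B : Birack S} {l m : List (LabeledPassage S)}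
    (h : B.Over l m) (j k : ℤ) :
    B.Over (l.map (LabeledPassage.map (B.shift j))) (m.map (LabeledPassage.map (B.shift k))) := by
  intro P hP Q hQ h₁ h₂ h₃
  obtain ⟨P, hP', rfl⟩ := List.mem_map.1 hP
  obtain ⟨Q, hQ', rfl⟩ := List.mem_map.1 hQ
  exact B.crossingRel_shift j k (h P hP' Q hQ' h₁ h₂ h₃)

theorem Birack.over_append_left {S : Type*} {B : Birack S} {l l' m : List (LabeledPassage S)} :
    B.Over (l ++ l') m ↔ B.Over l m ∧ B.Over l' m := by
  simp only [Birack.Over, List.mem_append, or_imp, forall_and]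

theorem Birack.over_append_right {S : Type*} {B : Birack S} {l m m' : List (LabeledPassage S)} :
    B.Over l (m ++ m') ↔ B.Over l m ∧ B.Over l m' := by
  simp only [Birack.Over, List.mem_append, or_imp, forall_and]

theorem LabeledPassage.map_shift_zero {S : Type*} (B : Birack S) (l : List (LabeledPassage S)) :
    l.map (map (B.shift 0)) = l := by
  have : map (B.shift 0) = id := by
    funext P
    simp [LabeledPassage.map, B.shift_zero]
  rw [this, List.map_id]

theorem LabeledPassage.map_shift_shift {S : Type*} (B : Birack S) (j k : ℤ)
    (l : List (LabeledPassage S)) :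
    (l.map (map (B.shift k))).map (map (B.shift j)) = l.map (map (B.shift (j + k))) := by
  rw [List.map_map]
  congr 1
  funext P
  simp [LabeledPassage.map, B.shift_add]

/-- Labelings of `u ++ v` and of `v ++ u` correspond under moving the base point past `u`. -/
def RotateRel (u v : GaussCode) {S : Type*} (B : Birack S) (x y : S × List (LabeledPassage S)) :
    Prop :=
  ∃ l m, l.map passage = u ∧ m.map passage = v ∧ x.2 = l ++ m ∧ IsPath x.1 l y.1 ∧
    y.2 = m ++ l.map (map (B.shift (GaussCode.writhe (u ++ v))))

theorem LabelEquiv.rotate (u v : GaussCode) : LabelEquiv.{v} (u ++ v) (v ++ u) := by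
  have hw : GaussCode.writhe (v ++ u) = GaussCode.writhe (u ++ v) := by
    rw [GaussCode.writhe_append, GaussCode.writhe_append, add_comm]
  refine ⟨RotateRel u v, ?_, ?_, ?_⟩
  · rintro S T B B' f hf ⟨x, _⟩ ⟨y, _⟩ ⟨l, m, hl, hm, h₁, h₂, h₃⟩
    refine ⟨l.map (map f), m.map (map f), by rw [map_passage_map, hl],
      by rw [map_passage_map, hm], by simp_all, h₂.map, ?_⟩
    simp only [Prod.map] at h₃ ⊢
    rw [h₃, List.map_append, List.map_map, List.map_map]
    congr 2
    funext P
    simp [LabeledPassage.map, hf.shift]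
  · rintro S B ⟨x, L⟩ ⟨h₁, h₂, h₃⟩
    dsimp only at h₁ h₂ h₃
    obtain ⟨l, m, rfl, hl, hm⟩ := List.map_eq_append_iff.1 h₁
    obtain ⟨y, hy₁, hy₂⟩ := isPath_append.1 h₃
    refine ⟨(y, m ++ l.map (map (B.shift (GaussCode.writhe (u ++ v))))),
      ⟨⟨?_, ?_, ?_⟩, l, m, hl, hm, rfl, hy₁, rfl⟩, ?_⟩
    · simp only [List.map_append, map_passage_map, hl, hm]
    -- Only `l` is shifted. Its crossings with `m` stay consistent because the two passages of a
    -- crossing can be shifted by different powers.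
    · simp only [Birack.Consistent, Birack.over_append_left, Birack.over_append_right] at h₂ ⊢
      have h := h₂.1.1.shift (GaussCode.writhe (u ++ v)) (GaussCode.writhe (u ++ v))
      have h' := h₂.1.2.shift 0 (GaussCode.writhe (u ++ v))
      have h'' := h₂.2.1.shift (GaussCode.writhe (u ++ v)) 0
      rw [map_shift_zero] at h' h''
      exact ⟨⟨h₂.2.2, h''⟩, h', h⟩
    · dsimp only
      rw [hw]
      exact isPath_append.2 ⟨_, hy₂, hy₁.map⟩
    · rintro ⟨y', L'⟩ ⟨-, l', m', hl', hm', h₄, h₅, h₆⟩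
      dsimp only at h₄ h₅ h₆
      obtain ⟨rfl, rfl⟩ := List.append_inj h₄ (by
        rw [← List.length_map (f := passage), ← List.length_map (f := passage) (as := l'), hl, hl'])
      rw [h₆, hy₁.right_unique h₅]
  · rintro S B ⟨y, L⟩ ⟨h₁, h₂, h₃⟩
    dsimp only at h₁ h₂ h₃
    set k := GaussCode.writhe (u ++ v) with hk
    rw [hw] at h₃
    obtain ⟨m, l, rfl, hm, hl⟩ := List.map_eq_append_iff.1 h₁
    obtain ⟨x, hx₁, hx₂⟩ := isPath_append.1 h₃
    have hx₃ := hx₂.map (f := B.shift (-k))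
    rw [B.shift_neg_shift] at hx₃
    -- The segment `l` runs from `x` to `y` shifted by `k`; shifted by `-k` it ends at `y`, where
    -- `m` starts.
    refine ⟨(B.shift (-k) x, l.map (map (B.shift (-k))) ++ m),
      ⟨⟨?_, ?_, ?_⟩, l.map (map (B.shift (-k))), m, by rw [map_passage_map, hl], hm, rfl, hx₃, ?_⟩,
        ?_⟩
    · simp only [List.map_append, map_passage_map, hl, hm]
    · simp only [Birack.Consistent, Birack.over_append_left, Birack.over_append_right] at h₂ ⊢
      have h := h₂.2.2.shift (-k) (-k)
      have h' := h₂.1.2.shift (-k) 0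
      have h'' := h₂.2.1.shift 0 (-k)
      rw [map_shift_zero] at h' h''
      exact ⟨⟨h, h''⟩, h', h₂.1.1⟩
    · dsimp only
      rw [B.shift_shift_neg]
      exact isPath_append.2 ⟨_, hx₃, hx₁⟩
    · dsimp only
      rw [map_shift_shift, add_neg_cancel, map_shift_zero]
    · rintro ⟨x', L'⟩ ⟨h₇, l', m', hl', hm', h₄, h₅, h₆⟩
      dsimp only at h₄ h₅ h₆
      obtain ⟨rfl, rfl⟩ := List.append_inj h₆ (by
        rw [← List.length_map (f := passage), ← List.length_map (f := passage) (as := m'), hm, hm'])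
      have h₈ := h₇.isPath
      dsimp only at h₈
      rw [h₄, isPath_append] at h₈
      obtain ⟨z, hz₁, hz₂⟩ := h₈
      obtain rfl := h₅.right_unique hz₁
      obtain rfl := hx₁.right_unique hz₂
      rw [h₄, map_shift_shift, neg_add_cancel, map_shift_zero, B.shift_neg_shift]

/-- Rename the crossing of a labelled passage. -/
def LabeledPassage.rename {S : Type*} (f : ℕ → ℕ) (P : LabeledPassage S) : LabeledPassage S :=
  ⟨⟨f P.passage.crossing, P.passage.isOver, P.passage.isPositive⟩, P.source, P.target⟩

theorem LabeledPassage.IsPath.rename {S : Type*} (f : ℕ → ℕ) {l : List (LabeledPassage S)} {x y : S}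
    (h : IsPath x l y) : IsPath x (l.map (LabeledPassage.rename f)) y := by
  induction l generalizing x with
  | nil => exact h
  | cons P l ih => exact ⟨h.1, ih h.2⟩

theorem GaussCode.writhe_rename (f : ℕ → ℕ) (w : GaussCode) :
    GaussCode.writhe (w.map fun l => ⟨f l.crossing, l.isOver, l.isPositive⟩) = w.writhe := by
  simp [GaussCode.writhe, Function.comp_def]

theorem Birack.IsLabeling.rename {S : Type*} {B : Birack S} {w : GaussCode}
    {x : S × List (LabeledPassage S)} (h : B.IsLabeling w x) (f : Equiv.Perm ℕ) :
    B.IsLabeling (w.map fun l => ⟨f l.crossing, l.isOver, l.isPositive⟩)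
      (x.1, x.2.map (LabeledPassage.rename f)) := by
  refine ⟨?_, ?_, ?_⟩
  · dsimp only
    rw [← h.map_passage, List.map_map, List.map_map]
    rfl
  · intro P hP Q hQ h₁ h₂ h₃
    obtain ⟨P, hP', rfl⟩ := List.mem_map.1 hP
    obtain ⟨Q, hQ', rfl⟩ := List.mem_map.1 hQ
    exact h.consistent P hP' Q hQ' h₁ h₂ (f.injective h₃)
  · rw [GaussCode.writhe_rename]
    exact h.isPath.rename f

theorem LabeledPassage.map_rename_symm {S : Type*} (f : Equiv.Perm ℕ)
    (l : List (LabeledPassage S)) :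
    (l.map (LabeledPassage.rename f)).map (LabeledPassage.rename f.symm) = l := by
  rw [List.map_map]
  convert List.map_id l using 2
  funext P
  simp [LabeledPassage.rename]

theorem LabelEquiv.rename (f : Equiv.Perm ℕ) (w : GaussCode) :
    LabelEquiv.{v} w (w.map fun l => ⟨f l.crossing, l.isOver, l.isPositive⟩) := by
  refine ⟨fun _ x y => y = (x.1, x.2.map (LabeledPassage.rename f)), ?_, ?_, ?_⟩
  · rintro S T B B' g - x _ rfl
    simp [Prod.map, LabeledPassage.map, LabeledPassage.rename, Function.comp_def]
  · intro S B x hx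
    exact ⟨_, ⟨hx.rename f, rfl⟩, fun y hy => hy.2⟩
  · intro S B y hy
    refine ⟨(y.1, y.2.map (LabeledPassage.rename f.symm)), ⟨?_, ?_⟩, ?_⟩
    · have := hy.rename f.symm
      simpa [Function.comp_def] using this
    · have := map_rename_symm f.symm y.2
      rw [Equiv.symm_symm] at this
      exact Prod.ext rfl this.symm
    · rintro x ⟨-, rfl⟩
      rw [map_rename_symm]

/-- Two codes without common crossings. -/
def GaussCode.Separate (u v : GaussCode) : Prop := ∀ p ∈ u, ∀ q ∈ v, p.crossing ≠ q.crossing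

theorem Birack.over_of_separate {S : Type*} (B : Birack S) {l m : List (LabeledPassage S)}
    (h : GaussCode.Separate (l.map passage) (m.map passage)) : B.Over l m :=
  fun _ hP _ hQ _ _ h' =>
    absurd h' (h _ (List.mem_map_of_mem hP) _ (List.mem_map_of_mem hQ))

theorem GaussCode.Separate.symm {u v : GaussCode} (h : u.Separate v) : GaussCode.Separate v u :=
  fun p hp q hq => (h q hq p hp).symm

theorem Birack.consistent_append {S : Type*} {B : Birack S} {l m : List (LabeledPassage S)}
    (h : GaussCode.Separate (l.map passage) (m.map passage)) :
    B.Consistent (l ++ m) ↔ B.Consistent l ∧ B.Consistent m := by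
  simp [Birack.Consistent, Birack.over_append_left, Birack.over_append_right,
    B.over_of_separate h, B.over_of_separate h.symm]

/-- Consistency depends only on the set of labelled passages, so it is insensitive to the order in
which segments are met. -/
theorem Birack.consistent_congr {S : Type*} {B : Birack S} {l m : List (LabeledPassage S)}
    (h : ∀ P, P ∈ l ↔ P ∈ m) : B.Consistent l ↔ B.Consistent m := by
  simp only [Birack.Consistent, Birack.Over, h]

/-! ### The first Reidemeister move -/

namespace Birack

variable {S : Type*} (B : Birack S)

/-- The crossing relation of a kink from `x` to `y` whose loop is labelled `b`. -/
def KinkRel (o s : Bool) (x b y : S) : Prop :=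
  bif o then B.CrossingRel s x b b y else B.CrossingRel s b y x b

/-- The sign of a crossing. -/
def _root_.signOf (s : Bool) : ℤ := if s then 1 else -1

variable {B}

/-- The four types are the right and left closures of `σ` and of `σ⁻¹`: the closure is on the right
if `o = s` and on the left otherwise. Both closures have the same torsion. -/
theorem KinkRel.eq_shift {o s : Bool} {x b y : S} (h : B.KinkRel o s x b y) :
    y = B.shift (signOf s) x := by
  cases o <;> cases s <;> obtain ⟨h₁, h₂⟩ := h
  · rw [B.left_eq_torsion h₂] at h₁
    rw [← h₁, ← B.shift_one]
    exact (B.shift_neg_shift 1 y).symm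
  · rw [B.right_leftKink h₁] at h₂
    rw [← h₂, ← B.shift_one]
    rfl
  · rw [B.right_leftKink h₁] at h₂
    rw [← h₂, ← B.shift_one]
    exact (B.shift_neg_shift 1 y).symm
  · rw [B.left_eq_torsion h₂] at h₁
    rw [← h₁, ← B.shift_one]
    rfl

theorem KinkRel.unique {o s : Bool} {x b b' y : S} (h : B.KinkRel o s x b y)
    (h' : B.KinkRel o s x b' y) : b = b' := by
  cases o <;> cases s
  · exact B.kink_unique h.2 h'.2
  · exact B.leftKink_unique h.1 h'.1
  · exact B.leftKink_unique h.1 h'.1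
  · exact B.kink_unique h.2 h'.2

variable (B)

theorem kinkRel_exists (o s : Bool) (x : S) :
    ∃ b, B.KinkRel o s (B.shift (-signOf s) x) b x := by
  have h₁ : B.shift 1 (B.shift (-1) x) = x := B.shift_shift_neg 1 x
  rw [B.shift_one] at h₁
  cases o <;> cases s
  · obtain ⟨b, hb, hb'⟩ := B.kink_exists x
    exact ⟨b, hb'.trans (B.shift_one x).symm, hb⟩
  · obtain ⟨b, hb, hb'⟩ := B.leftKink_exists (B.shift (-1) x)
    exact ⟨b, hb, hb'.trans h₁⟩
  · obtain ⟨b, hb, hb'⟩ := B.leftKink_exists x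
    exact ⟨b, hb, hb'.trans (B.shift_one x).symm⟩
  · obtain ⟨b, hb, hb'⟩ := B.kink_exists (B.shift (-1) x)
    exact ⟨b, hb'.trans h₁, hb⟩

theorem consistent_kink {c : ℕ} {o s : Bool} {x b b' y : S} :
    B.Consistent [⟨⟨c, o, s⟩, x, b⟩, ⟨⟨c, !o, s⟩, b', y⟩] ↔
      bif o then B.CrossingRel s x b b' y else B.CrossingRel s b' y x b := by
  cases o <;> simp [Consistent, Over]

end Birack

theorem GaussCode.separate_of_fresh {w : GaussCode} {c : ℕ} (hc : w.Fresh c) (o o' s s' : Bool) :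
    GaussCode.Separate [⟨c, o, s⟩, ⟨c, o', s'⟩] w := by
  intro p hp q hq
  have := hc q hq
  simp only [List.mem_cons, List.not_mem_nil, or_false] at hp
  rcases hp with rfl | rfl <;> exact this.symm

theorem GaussCode.writhe_kink (w : GaussCode) (c : ℕ) (o s : Bool) :
    GaussCode.writhe (⟨c, o, s⟩ :: ⟨c, !o, s⟩ :: w) = signOf s + w.writhe := by
  cases o <;> simp [GaussCode.writhe, signOf]

/-- The kink takes `x` to `y = χ^{±1} x` and adds the same `±1` to the writhe, so the final label
required by the long code, computed from `x`, is the one required by the short code, computed from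
`y`. -/
theorem Birack.isLabeling_kink {S : Type*} (B : Birack S) {w : GaussCode} {c : ℕ} {o s : Bool}
    (hc : w.Fresh c) {x : S} {L : List (LabeledPassage S)} :
    B.IsLabeling (⟨c, o, s⟩ :: ⟨c, !o, s⟩ :: w) (x, L) ↔
      ∃ b y l, L = ⟨⟨c, o, s⟩, x, b⟩ :: ⟨⟨c, !o, s⟩, b, y⟩ :: l ∧ B.KinkRel o s x b y ∧
        B.IsLabeling w (y, l) := by
  have key : ∀ {b y : S} {l : List (LabeledPassage S)}, l.map passage = w →
      (B.Consistent (⟨⟨c, o, s⟩, x, b⟩ :: ⟨⟨c, !o, s⟩, b, y⟩ :: l) ↔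
        B.KinkRel o s x b y ∧ B.Consistent l) := by
    intro b y l hl
    refine (Birack.consistent_append
      (l := [⟨⟨c, o, s⟩, x, b⟩, ⟨⟨c, !o, s⟩, b, y⟩]) ?_).trans (and_congr_left' B.consistent_kink)
    rw [hl]
    exact GaussCode.separate_of_fresh hc _ _ _ _
  constructor
  · rintro ⟨h₁, h₂, h₃⟩
    dsimp only at h₁ h₂ h₃
    obtain ⟨⟨p, x', b⟩, L, rfl, rfl, h₄⟩ := List.map_eq_cons_iff.1 h₁
    obtain ⟨⟨q, b', y⟩, l, rfl, rfl, h₅⟩ := List.map_eq_cons_iff.1 h₄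
    obtain ⟨rfl, rfl, h₆⟩ := h₃
    obtain ⟨h₇, h₈⟩ := (key h₅).1 h₂
    refine ⟨_, y, l, rfl, h₇, h₅, h₈, ?_⟩
    dsimp only
    rwa [h₇.eq_shift, ← B.shift_add, add_comm, ← GaussCode.writhe_kink w c o s, ← h₇.eq_shift]
  · rintro ⟨b, y, l, rfl, h₁, h₂, h₃, h₄⟩
    dsimp only at h₂ h₃ h₄
    refine ⟨by simp [h₂], (key h₂).2 ⟨h₁, h₃⟩, rfl, rfl, ?_⟩
    dsimp only
    rwa [GaussCode.writhe_kink, add_comm, B.shift_add, ← h₁.eq_shift]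

theorem LabelEquiv.reidemeister1 (w : GaussCode) (c : ℕ) (o s : Bool) (hc : w.Fresh c) :
    LabelEquiv.{v} w (⟨c, o, s⟩ :: ⟨c, !o, s⟩ :: w) := by
  -- The condition on the starting labels is not redundant: for an empty `w` the list of passages
  -- does not determine `x.1`.
  refine ⟨fun B x y => x.1 = B.shift (signOf s) y.1 ∧ ∃ P Q, y.2 = P :: Q :: x.2, ?_, ?_, ?_⟩
  · rintro S T B B' f hf x y ⟨h, P, Q, h'⟩
    exact ⟨by simp [h, hf.shift], P.map f, Q.map f, by simp [h']⟩
  · rintro S B ⟨x, l⟩ h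
    obtain ⟨b, hb⟩ := B.kinkRel_exists o s x
    refine ⟨(_, _), ⟨(B.isLabeling_kink hc).2 ⟨b, x, l, rfl, hb, h⟩, hb.eq_shift, _, _, rfl⟩, ?_⟩
    rintro ⟨y, L⟩ ⟨h₁, h₂, _, _, h₃⟩
    obtain ⟨b', x', l', rfl, h₄, h₅⟩ := (B.isLabeling_kink hc).1 h₁
    dsimp only at h₂ h₃
    obtain ⟨-, -, rfl⟩ : _ ∧ _ ∧ l' = l := by simpa using h₃
    obtain rfl := h₂.trans h₄.eq_shift.symm
    rw [h₂, B.shift_neg_shift, ← h₂] at hb ⊢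
    rw [hb.unique h₄]
  · rintro S B ⟨y, L⟩ h
    obtain ⟨b, x, l, rfl, h₁, h₂⟩ := (B.isLabeling_kink hc).1 h
    refine ⟨(x, l), ⟨h₂, h₁.eq_shift, _, _, rfl⟩, ?_⟩
    rintro ⟨x', l'⟩ ⟨-, h₃, _, _, h₄⟩
    dsimp only at h₃ h₄
    obtain ⟨-, -, rfl⟩ : _ ∧ _ ∧ l = l' := by simpa using h₄
    rw [h₃, ← h₁.eq_shift]

/-! ### Replacement of tangles with three strands -/

/-- A labeling of a tangle whose three strands are `s₁`, `s₂`, `s₃` and run from `x₁`, `x₂`, `x₃`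
to `y₁`, `y₂`, `y₃`. -/
structure Birack.IsTangleLabeling {S : Type*} (B : Birack S) (s₁ s₂ s₃ : GaussCode)
    (x₁ y₁ x₂ y₂ x₃ y₃ : S) (l₁ l₂ l₃ : List (LabeledPassage S)) : Prop where
  map₁ : l₁.map passage = s₁
  map₂ : l₂.map passage = s₂
  map₃ : l₃.map passage = s₃
  path₁ : IsPath x₁ l₁ y₁
  path₂ : IsPath x₂ l₂ y₂
  path₃ : IsPath x₃ l₃ y₃
  consistent : B.Consistent (l₁ ++ l₂ ++ l₃)

/-- Every labeling of the first tangle determines a unique labeling of the second tangle with the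
same boundary. -/
def TangleLE (s₁ s₂ s₃ s₁' s₂' s₃' : GaussCode) : Prop :=
  ∀ {S : Type v} (B : Birack S) (x₁ y₁ x₂ y₂ x₃ y₃ : S) (l₁ l₂ l₃ : List (LabeledPassage S)),
    B.IsTangleLabeling s₁ s₂ s₃ x₁ y₁ x₂ y₂ x₃ y₃ l₁ l₂ l₃ →
      ∃ l₁' l₂' l₃', B.IsTangleLabeling s₁' s₂' s₃' x₁ y₁ x₂ y₂ x₃ y₃ l₁' l₂' l₃' ∧
        ∀ m₁ m₂ m₃, B.IsTangleLabeling s₁' s₂' s₃' x₁ y₁ x₂ y₂ x₃ y₃ m₁ m₂ m₃ →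
          m₁ = l₁' ∧ m₂ = l₂' ∧ m₃ = l₃'

/-- Labelings of two codes which agree outside of a tangle. -/
def TangleRel {S : Type*} (x x' : S × List (LabeledPassage S)) (l₁ l₂ l₃ l₁' l₂' l₃' m₁ m₂ m₃ :
    List (LabeledPassage S)) (y₁ x₂ y₂ x₃ y₃ : S) : Prop :=
  x.1 = x'.1 ∧ x.2 = l₁ ++ m₁ ++ l₂ ++ m₂ ++ l₃ ++ m₃ ∧
    x'.2 = l₁' ++ m₁ ++ l₂' ++ m₂ ++ l₃' ++ m₃ ∧ (IsPath x.1 l₁ y₁ ∧ IsPath x.1 l₁' y₁) ∧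
      IsPath y₁ m₁ x₂ ∧ (IsPath x₂ l₂ y₂ ∧ IsPath x₂ l₂' y₂) ∧ IsPath y₂ m₂ x₃ ∧
        (IsPath x₃ l₃ y₃ ∧ IsPath x₃ l₃' y₃)

theorem isPath_six {S : Type*} {x z : S} {l₁ l₂ l₃ m₁ m₂ m₃ : List (LabeledPassage S)} :
    IsPath x (l₁ ++ m₁ ++ l₂ ++ m₂ ++ l₃ ++ m₃) z ↔ ∃ y₁ x₂ y₂ x₃ y₃, IsPath x l₁ y₁ ∧
      IsPath y₁ m₁ x₂ ∧ IsPath x₂ l₂ y₂ ∧ IsPath y₂ m₂ x₃ ∧ IsPath x₃ l₃ y₃ ∧ IsPath y₃ m₃ z := by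
  simp only [isPath_append]
  constructor
  · rintro ⟨y₃, ⟨x₃, ⟨y₂, ⟨x₂, ⟨y₁, h₁, h₂⟩, h₃⟩, h₄⟩, h₅⟩, h₆⟩
    exact ⟨y₁, x₂, y₂, x₃, y₃, h₁, h₂, h₃, h₄, h₅, h₆⟩
  · rintro ⟨y₁, x₂, y₂, x₃, y₃, h₁, h₂, h₃, h₄, h₅, h₆⟩
    exact ⟨y₃, ⟨x₃, ⟨y₂, ⟨x₂, ⟨y₁, h₁, h₂⟩, h₃⟩, h₄⟩, h₅⟩, h₆⟩

theorem consistent_six {S : Type*} {B : Birack S} {l₁ l₂ l₃ m₁ m₂ m₃ : List (LabeledPassage S)}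
    (h : GaussCode.Separate ((l₁ ++ l₂ ++ l₃).map passage) ((m₁ ++ m₂ ++ m₃).map passage)) :
    B.Consistent (l₁ ++ m₁ ++ l₂ ++ m₂ ++ l₃ ++ m₃) ↔
      B.Consistent (l₁ ++ l₂ ++ l₃) ∧ B.Consistent (m₁ ++ m₂ ++ m₃) := by
  rw [← Birack.consistent_append h]
  refine Birack.consistent_congr fun P => ?_
  simp only [List.mem_append]
  tauto

/-- The labels on the arcs `u`, `v`, `t` outside the tangle are kept and those inside are replaced;
equal writhes keep the closing condition. The relation names the boundary labels because an empty
arc does not record them, and it contains the paths through both tangles so that it is symmetric in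
them. -/
theorem tangle_forward {s₁ s₂ s₃ s₁' s₂' s₃' u v t : GaussCode}
    (hs : GaussCode.Separate (s₁ ++ s₂ ++ s₃) (u ++ v ++ t))
    (hs' : GaussCode.Separate (s₁' ++ s₂' ++ s₃') (u ++ v ++ t))
    (hw : GaussCode.writhe (s₁ ++ u ++ s₂ ++ v ++ s₃ ++ t) =
      GaussCode.writhe (s₁' ++ u ++ s₂' ++ v ++ s₃' ++ t))
    (H : TangleLE.{v} s₁ s₂ s₃ s₁' s₂' s₃') {S : Type v} (B : Birack S)
    (x : S × List (LabeledPassage S))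
    (hx : B.IsLabeling (s₁ ++ u ++ s₂ ++ v ++ s₃ ++ t) x) :
    ∃! x', B.IsLabeling (s₁' ++ u ++ s₂' ++ v ++ s₃' ++ t) x' ∧
      ∃ l₁ l₂ l₃ l₁' l₂' l₃' m₁ m₂ m₃ y₁ x₂ y₂ x₃ y₃, (l₁.map passage = s₁ ∧
        l₁'.map passage = s₁' ∧ m₁.map passage = u ∧ l₂.map passage = s₂ ∧ l₂'.map passage = s₂' ∧
        m₂.map passage = v ∧ l₃.map passage = s₃ ∧ l₃'.map passage = s₃' ∧
        m₃.map passage = t) ∧ TangleRel x x' l₁ l₂ l₃ l₁' l₂' l₃' m₁ m₂ m₃ y₁ x₂ y₂ x₃ y₃ := by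
  obtain ⟨x, L⟩ := x
  obtain ⟨h₁, h₂, h₃⟩ := hx
  dsimp only at h₁ h₂ h₃
  obtain ⟨L, m₃, rfl, g₁, rfl⟩ := List.map_eq_append_iff.1 h₁
  obtain ⟨L, l₃, rfl, g₂, rfl⟩ := List.map_eq_append_iff.1 g₁
  obtain ⟨L, m₂, rfl, g₃, rfl⟩ := List.map_eq_append_iff.1 g₂
  obtain ⟨L, l₂, rfl, g₄, rfl⟩ := List.map_eq_append_iff.1 g₃
  obtain ⟨l₁, m₁, rfl, rfl, rfl⟩ := List.map_eq_append_iff.1 g₄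
  obtain ⟨y₁, x₂, y₂, x₃, y₃, p₁, p₂, p₃, p₄, p₅, p₆⟩ := isPath_six.1 h₃
  simp only [← List.map_append] at hs hs'
  obtain ⟨c₁, c₂⟩ := (consistent_six hs).1 h₂
  obtain ⟨l₁', l₂', l₃', hl, hu⟩ := H B x y₁ x₂ y₂ x₃ y₃ l₁ l₂ l₃ ⟨rfl, rfl, rfl, p₁, p₃, p₅, c₁⟩
  refine ⟨(x, l₁' ++ m₁ ++ l₂' ++ m₂ ++ l₃' ++ m₃), ⟨⟨?_, ?_, ?_⟩, l₁, l₂, l₃, l₁', l₂', l₃',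
    m₁, m₂, m₃, y₁, x₂, y₂, x₃, y₃, ⟨rfl, hl.map₁, rfl, rfl, hl.map₂, rfl, rfl, hl.map₃, rfl⟩,
    rfl, rfl, rfl, ⟨p₁, hl.path₁⟩, p₂, ⟨p₃, hl.path₂⟩, p₄, p₅, hl.path₃⟩, ?_⟩
  · simp [hl.map₁, hl.map₂, hl.map₃]
  · refine (consistent_six ?_).2 ⟨hl.consistent, c₂⟩
    simpa [hl.map₁, hl.map₂, hl.map₃] using hs'
  · dsimp only
    rw [← hw]
    exact isPath_six.2 ⟨_, _, _, _, _, hl.path₁, p₂, hl.path₂, p₄, hl.path₃, p₆⟩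
  · rintro ⟨x', L⟩ ⟨⟨-, g₁, -⟩, n₁, n₂, n₃, n₁', n₂', n₃', o₁, o₂, o₃, z₁, w₂, z₂, w₃, z₃,
      ⟨e₁, e₁', e₂, e₃, e₃', e₄, e₅, e₅', e₆⟩, rfl, e₇, e₈, ⟨q₁, q₁'⟩, q₂, ⟨q₃, q₃'⟩, q₄, q₅, q₅'⟩
    dsimp only at e₇ e₈ q₁ q₁' g₁
    -- Two decompositions of one labelled list over the same code have segments of equal lengths,
    -- hence coincide.
    have len : ∀ {l m : List (LabeledPassage S)}, l.map passage = m.map passage →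
        l.length = m.length := fun {l m} h => by
      rw [← List.length_map (f := passage), h, List.length_map]
    obtain ⟨f₁, rfl⟩ := List.append_inj' e₇ (len e₆.symm)
    obtain ⟨f₂, rfl⟩ := List.append_inj' f₁ (len e₅.symm)
    obtain ⟨f₃, rfl⟩ := List.append_inj' f₂ (len e₄.symm)
    obtain ⟨f₄, rfl⟩ := List.append_inj' f₃ (len e₃.symm)
    obtain ⟨rfl, rfl⟩ := List.append_inj' f₄ (len e₂.symm)
    obtain rfl := p₁.right_unique q₁
    obtain rfl := p₂.right_unique q₂
    obtain rfl := p₃.right_unique q₃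
    obtain rfl := p₄.right_unique q₄
    obtain rfl := p₅.right_unique q₅
    subst e₈
    have hs'' : GaussCode.Separate ((n₁' ++ n₂' ++ n₃').map passage)
        ((m₁ ++ m₂ ++ m₃).map passage) := by
      simpa [e₁', e₃', e₅'] using hs'
    obtain ⟨rfl, rfl, rfl⟩ := hu n₁' n₂' n₃'
      ⟨e₁', e₃', e₅', q₁', q₃', q₅', ((consistent_six hs'').1 g₁).1⟩
    rfl

theorem LabelEquiv.of_tangle {s₁ s₂ s₃ s₁' s₂' s₃' u v t : GaussCode}
    (hs : GaussCode.Separate (s₁ ++ s₂ ++ s₃) (u ++ v ++ t))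
    (hs' : GaussCode.Separate (s₁' ++ s₂' ++ s₃') (u ++ v ++ t))
    (hw : GaussCode.writhe (s₁ ++ u ++ s₂ ++ v ++ s₃ ++ t) =
      GaussCode.writhe (s₁' ++ u ++ s₂' ++ v ++ s₃' ++ t))
    (H : TangleLE.{v} s₁ s₂ s₃ s₁' s₂' s₃') (H' : TangleLE.{v} s₁' s₂' s₃' s₁ s₂ s₃) :
    LabelEquiv.{v} (s₁ ++ u ++ s₂ ++ v ++ s₃ ++ t) (s₁' ++ u ++ s₂' ++ v ++ s₃' ++ t) := by
  refine ⟨fun _ x x' => ∃ l₁ l₂ l₃ l₁' l₂' l₃' m₁ m₂ m₃ y₁ x₂ y₂ x₃ y₃, (l₁.map passage = s₁ ∧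
        l₁'.map passage = s₁' ∧ m₁.map passage = u ∧ l₂.map passage = s₂ ∧ l₂'.map passage = s₂' ∧
        m₂.map passage = v ∧ l₃.map passage = s₃ ∧ l₃'.map passage = s₃' ∧
        m₃.map passage = t) ∧ TangleRel x x' l₁ l₂ l₃ l₁' l₂' l₃' m₁ m₂ m₃ y₁ x₂ y₂ x₃ y₃,
    ?_, fun B x hx => tangle_forward hs hs' hw H B x hx, ?_⟩
  · rintro S T B B' f - ⟨x, L⟩ ⟨x', L'⟩ ⟨n₁, n₂, n₃, n₁', n₂', n₃', o₁, o₂, o₃, z₁, w₂, z₂, w₃, z₃,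
      ⟨e₁, e₁', e₂, e₃, e₃', e₄, e₅, e₅', e₆⟩, e, e₇, e₈, ⟨q₁, q₁'⟩, q₂, ⟨q₃, q₃'⟩, q₄, q₅, q₅'⟩
    dsimp only at e e₇ e₈ q₁ q₁'
    subst e e₇ e₈
    refine ⟨n₁.map (map f), n₂.map (map f), n₃.map (map f), n₁'.map (map f), n₂'.map (map f),
      n₃'.map (map f), o₁.map (map f), o₂.map (map f), o₃.map (map f), f z₁, f w₂, f z₂, f w₃,
      f z₃, by simp only [map_passage_map]; exact ⟨e₁, e₁', e₂, e₃, e₃', e₄, e₅, e₅', e₆⟩, rfl,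
      by simp, by simp, ⟨q₁.map, q₁'.map⟩, q₂.map, ⟨q₃.map, q₃'.map⟩, q₄.map, q₅.map, q₅'.map⟩
  · intro S B x' hx'
    obtain ⟨x, ⟨h, n₁, n₂, n₃, n₁', n₂', n₃', o₁, o₂, o₃, z₁, w₂, z₂, w₃, z₃,
      ⟨e₁, e₁', e₂, e₃, e₃', e₄, e₅, e₅', e₆⟩, e, e₇, e₈, ⟨q₁, q₁'⟩, q₂, ⟨q₃, q₃'⟩, q₄, q₅, q₅'⟩,
      hu⟩ := tangle_forward hs' hs hw.symm H' B x' hx'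
    refine ⟨x, ⟨h, n₁', n₂', n₃', n₁, n₂, n₃, o₁, o₂, o₃, z₁, w₂, z₂, w₃, z₃,
      ⟨e₁', e₁, e₂, e₃', e₃, e₄, e₅', e₅, e₆⟩, e.symm, e₈, e₇, e ▸ ⟨q₁', q₁⟩, q₂, ⟨q₃', q₃⟩, q₄,
      q₅', q₅⟩, ?_⟩
    clear e e₇ e₈ q₁ q₁' q₂ q₃ q₃' q₄ q₅ q₅' e₁ e₁' e₂ e₃ e₃' e₄ e₅ e₅' e₆ h
    rintro w ⟨h, n₁, n₂, n₃, n₁', n₂', n₃', o₁, o₂, o₃, z₁, w₂, z₂, w₃, z₃,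
      ⟨e₁, e₁', e₂, e₃, e₃', e₄, e₅, e₅', e₆⟩, e, e₇, e₈, ⟨q₁, q₁'⟩, q₂, ⟨q₃, q₃'⟩, q₄, q₅, q₅'⟩
    exact hu w ⟨h, n₁', n₂', n₃', n₁, n₂, n₃, o₁, o₂, o₃, z₁, w₂, z₂, w₃, z₃,
      ⟨e₁', e₁, e₂, e₃', e₃, e₄, e₅', e₅, e₆⟩, e.symm, e₈, e₇, e ▸ ⟨q₁', q₁⟩, q₂, ⟨q₃', q₃⟩, q₄,
      q₅', q₅⟩

/-! ### The second and third Reidemeister moves. -/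

theorem isPath_pair {S : Type*} {p q : Passage} {x y : S} {l : List (LabeledPassage S)} :
    l.map passage = [p, q] ∧ IsPath x l y ↔ ∃ m, l = [⟨p, x, m⟩, ⟨q, m, y⟩] := by
  constructor
  · rintro ⟨h₁, h₂⟩
    obtain ⟨⟨p', x', m⟩, l, rfl, rfl, h₃⟩ := List.map_eq_cons_iff.1 h₁
    obtain ⟨⟨q', m', y'⟩, l, rfl, rfl, h₄⟩ := List.map_eq_cons_iff.1 h₃
    obtain rfl := List.map_eq_nil_iff.1 h₄
    obtain ⟨rfl, rfl, rfl⟩ := h₂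
    exact ⟨_, rfl⟩
  · rintro ⟨m, rfl⟩
    exact ⟨rfl, rfl, rfl, rfl⟩

theorem Birack.isTangleLabeling_nil {S : Type*} {B : Birack S} {x₁ y₁ x₂ y₂ x₃ y₃ : S}
    {l₁ l₂ l₃ : List (LabeledPassage S)} :
    B.IsTangleLabeling [] [] [] x₁ y₁ x₂ y₂ x₃ y₃ l₁ l₂ l₃ ↔
      (l₁ = [] ∧ l₂ = [] ∧ l₃ = []) ∧ x₁ = y₁ ∧ x₂ = y₂ ∧ x₃ = y₃ := by
  constructor
  · rintro ⟨h₁, h₂, h₃, h₄, h₅, h₆, -⟩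
    obtain rfl := List.map_eq_nil_iff.1 h₁
    obtain rfl := List.map_eq_nil_iff.1 h₂
    obtain rfl := List.map_eq_nil_iff.1 h₃
    exact ⟨⟨rfl, rfl, rfl⟩, h₄, h₅, h₆⟩
  · rintro ⟨⟨rfl, rfl, rfl⟩, rfl, rfl, rfl⟩
    exact ⟨rfl, rfl, rfl, rfl, rfl, rfl, by simp [Birack.Consistent, Birack.Over]⟩

theorem Birack.isTangleLabeling_two {S : Type*} {B : Birack S} {p q p' q' : Passage}
    {x₁ y₁ x₂ y₂ x₃ y₃ : S} {l₁ l₂ l₃ : List (LabeledPassage S)} :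
    B.IsTangleLabeling [p, q] [p', q'] [] x₁ y₁ x₂ y₂ x₃ y₃ l₁ l₂ l₃ ↔
      ∃ m n, (l₁ = [⟨p, x₁, m⟩, ⟨q, m, y₁⟩] ∧ l₂ = [⟨p', x₂, n⟩, ⟨q', n, y₂⟩] ∧ l₃ = []) ∧
        x₃ = y₃ ∧
        B.Consistent [⟨p, x₁, m⟩, ⟨q, m, y₁⟩, ⟨p', x₂, n⟩, ⟨q', n, y₂⟩] := by
  constructor
  · rintro ⟨h₁, h₂, h₃, h₄, h₅, h₆, h₇⟩
    obtain ⟨m, rfl⟩ := isPath_pair.1 ⟨h₁, h₄⟩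
    obtain ⟨n, rfl⟩ := isPath_pair.1 ⟨h₂, h₅⟩
    obtain rfl := List.map_eq_nil_iff.1 h₃
    exact ⟨m, n, ⟨rfl, rfl, rfl⟩, h₆, h₇⟩
  · rintro ⟨m, n, ⟨rfl, rfl, rfl⟩, rfl, h⟩
    exact ⟨rfl, rfl, rfl, ⟨rfl, rfl, rfl⟩, ⟨rfl, rfl, rfl⟩, rfl, h⟩

theorem Birack.isTangleLabeling_three {S : Type*} {B : Birack S} {p q p' q' p'' q'' : Passage}
    {x₁ y₁ x₂ y₂ x₃ y₃ : S} {l₁ l₂ l₃ : List (LabeledPassage S)} :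
    B.IsTangleLabeling [p, q] [p', q'] [p'', q''] x₁ y₁ x₂ y₂ x₃ y₃ l₁ l₂ l₃ ↔
      ∃ k m n, (l₁ = [⟨p, x₁, k⟩, ⟨q, k, y₁⟩] ∧ l₂ = [⟨p', x₂, m⟩, ⟨q', m, y₂⟩] ∧
        l₃ = [⟨p'', x₃, n⟩, ⟨q'', n, y₃⟩]) ∧
        B.Consistent [⟨p, x₁, k⟩, ⟨q, k, y₁⟩, ⟨p', x₂, m⟩, ⟨q', m, y₂⟩, ⟨p'', x₃, n⟩,
          ⟨q'', n, y₃⟩] := by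
  constructor
  · rintro ⟨h₁, h₂, h₃, h₄, h₅, h₆, h₇⟩
    obtain ⟨k, rfl⟩ := isPath_pair.1 ⟨h₁, h₄⟩
    obtain ⟨m, rfl⟩ := isPath_pair.1 ⟨h₂, h₅⟩
    obtain ⟨n, rfl⟩ := isPath_pair.1 ⟨h₃, h₆⟩
    exact ⟨k, m, n, ⟨rfl, rfl, rfl⟩, h₇⟩
  · rintro ⟨k, m, n, ⟨rfl, rfl, rfl⟩, h⟩
    exact ⟨rfl, rfl, rfl, ⟨rfl, rfl, rfl⟩, ⟨rfl, rfl, rfl⟩, ⟨rfl, rfl, rfl⟩, h⟩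

theorem Birack.consistent_reidemeister2_parallel {S : Type*} {B : Birack S} {c d : ℕ} {s : Bool}
    (hcd : c ≠ d) {x₁ y₁ x₂ y₂ m n : S} :
    B.Consistent [⟨⟨c, true, s⟩, x₁, m⟩, ⟨⟨d, true, !s⟩, m, y₁⟩, ⟨⟨c, false, s⟩, x₂, n⟩,
      ⟨⟨d, false, !s⟩, n, y₂⟩] ↔ B.CrossingRel s x₁ m x₂ n ∧ B.CrossingRel (!s) m y₁ n y₂ := by
  simp [Birack.Consistent, Birack.Over, hcd, hcd.symm]

theorem Birack.consistent_reidemeister2_antiparallel {S : Type*} {B : Birack S} {c d : ℕ} {s : Bool}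
    (hcd : c ≠ d) {x₁ y₁ x₂ y₂ m n : S} :
    B.Consistent [⟨⟨c, true, s⟩, x₁, m⟩, ⟨⟨d, true, !s⟩, m, y₁⟩, ⟨⟨d, false, !s⟩, x₂, n⟩,
      ⟨⟨c, false, s⟩, n, y₂⟩] ↔ B.CrossingRel s x₁ m n y₂ ∧ B.CrossingRel (!s) m y₁ x₂ n := by
  simp [Birack.Consistent, Birack.Over, hcd, hcd.symm]

/-- With parallel strands both labels entering a crossing are known, so bijectivity of the operation
is all that is needed. The clauses are: the strands leave the bigon with the labels they entered
with, the inner labels are unique, and they exist. -/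
theorem Birack.crossingRel_parallel {S : Type*} (B : Birack S) (s : Bool) :
    (∀ {x m x' y m' y'}, B.CrossingRel s x m x' m' → B.CrossingRel (!s) m y m' y' →
      x = y ∧ x' = y') ∧
    (∀ {x m x' m' n n'}, B.CrossingRel s x m x' m' → B.CrossingRel s x n x' n' →
      m = n ∧ m' = n') ∧
    (∀ x x', ∃ m m', B.CrossingRel s x m x' m' ∧ B.CrossingRel (!s) m x m' x') := by
  cases s
  · refine ⟨?_, ?_, ?_⟩
    · rintro x m x' y m' y' ⟨h₁, h₂⟩ ⟨h₃, h₄⟩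
      exact ⟨h₂.symm.trans h₄, h₁.symm.trans h₃⟩
    · rintro x m x' m' n n' ⟨h₁, h₂⟩ ⟨h₃, h₄⟩
      exact B.op_injective (h₁.trans h₃.symm) (h₂.trans h₄.symm)
    · intro x x'
      obtain ⟨m, m', h, h'⟩ := B.op_surjective x' x
      exact ⟨m, m', ⟨h, h'⟩, h, h'⟩
  · refine ⟨?_, ?_, ?_⟩
    · rintro x m x' y m' y' ⟨h₁, h₂⟩ ⟨h₃, h₄⟩
      exact B.op_injective (h₁.trans h₃.symm) (h₂.trans h₄.symm)
    · rintro x m x' m' n n' ⟨h₁, h₂⟩ ⟨h₃, h₄⟩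
      exact ⟨h₂.symm.trans h₄, h₁.symm.trans h₃⟩
    · intro x x'
      exact ⟨_, _, ⟨rfl, rfl⟩, rfl, rfl⟩

/-- With antiparallel strands one knows an incoming label of one strand and an outgoing label of the
other, so the crossing must be solved sideways: this is where dualizability enters. -/
theorem Birack.crossingRel_antiparallel {S : Type*} (B : Birack S) (s : Bool) :
    (∀ {x m x' y m' y'}, B.CrossingRel s x m m' y' → B.CrossingRel (!s) m y x' m' →
      x = y ∧ x' = y') ∧
    (∀ {x m x' m' n n'}, B.CrossingRel s x m m' x' → B.CrossingRel s x n n' x' →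
      m = n ∧ m' = n') ∧
    (∀ x x', ∃ m m', B.CrossingRel s x m m' x' ∧ B.CrossingRel (!s) m x x' m') := by
  cases s
  · refine ⟨?_, ?_, ?_⟩
    · rintro x m x' y m' y' ⟨h₁, h₂⟩ ⟨h₃, h₄⟩
      obtain rfl := B.left_injective (h₁.trans h₃.symm)
      exact ⟨h₂.symm.trans h₄, rfl⟩
    · rintro x m x' m' n n' ⟨h₁, h₂⟩ ⟨h₃, h₄⟩
      obtain rfl := B.right_injective (h₂.trans h₄.symm)
      exact ⟨rfl, h₁.symm.trans h₃⟩
    · intro x x'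
      obtain ⟨m, h⟩ := B.right_surjective x' x
      exact ⟨m, B.left m x', ⟨rfl, h⟩, rfl, h⟩
  · refine ⟨?_, ?_, ?_⟩
    · rintro x m x' y m' y' ⟨h₁, h₂⟩ ⟨h₃, h₄⟩
      obtain rfl := B.right_injective (h₂.trans h₄.symm)
      exact ⟨rfl, h₃.symm.trans h₁⟩
    · rintro x m x' m' n n' ⟨h₁, h₂⟩ ⟨h₃, h₄⟩
      obtain rfl := B.left_injective (h₁.trans h₃.symm)
      exact ⟨h₂.symm.trans h₄, rfl⟩
    · intro x x'
      obtain ⟨m', h⟩ := B.left_surjective x x'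
      exact ⟨B.right x m', m', ⟨h, rfl⟩, h, rfl⟩

theorem GaussCode.separate_of_forall_fresh {s w : GaussCode}
    (h : ∀ p ∈ s, w.Fresh p.crossing) : s.Separate w :=
  fun p hp q hq => (h p hp q hq).symm

theorem LabelEquiv.reidemeister2_parallel (u v : GaussCode) (c d : ℕ) (s : Bool) (hcd : c ≠ d)
    (hc : GaussCode.Fresh c (u ++ v)) (hd : GaussCode.Fresh d (u ++ v)) :
    LabelEquiv.{v} (u ++ v)
      (⟨c, true, s⟩ :: ⟨d, true, !s⟩ :: u ++ ⟨c, false, s⟩ :: ⟨d, false, !s⟩ :: v) := by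
  have := LabelEquiv.of_tangle.{v} (s₁ := []) (s₂ := []) (s₃ := []) (u := u) (v := v) (t := [])
    (s₁' := [⟨c, true, s⟩, ⟨d, true, !s⟩]) (s₂' := [⟨c, false, s⟩, ⟨d, false, !s⟩]) (s₃' := [])
    (by simp [GaussCode.Separate])
    (GaussCode.separate_of_forall_fresh (by simp [hc, hd]))
    (by cases s <;> simp [GaussCode.writhe]) ?_ ?_
  · simpa using this
  · intro S B x₁ y₁ x₂ y₂ x₃ y₃ l₁ l₂ l₃ h
    obtain ⟨-, rfl, rfl, rfl⟩ := Birack.isTangleLabeling_nil.1 h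
    simp only [Birack.isTangleLabeling_two, Birack.consistent_reidemeister2_parallel hcd]
    obtain ⟨m, n, h₁, h₂⟩ := (B.crossingRel_parallel s).2.2 x₁ x₂
    refine ⟨_, _, _, ⟨m, n, ⟨rfl, rfl, rfl⟩, trivial, h₁, h₂⟩, ?_⟩
    rintro _ _ _ ⟨m', n', ⟨rfl, rfl, rfl⟩, -, h₃, h₄⟩
    obtain ⟨rfl, rfl⟩ := (B.crossingRel_parallel s).2.1 h₁ h₃
    exact ⟨rfl, rfl, rfl⟩
  · intro S B x₁ y₁ x₂ y₂ x₃ y₃ l₁ l₂ l₃ h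
    obtain ⟨m, n, -, rfl, h'⟩ := Birack.isTangleLabeling_two.1 h
    obtain ⟨h₁, h₂⟩ := (Birack.consistent_reidemeister2_parallel hcd).1 h'
    obtain ⟨rfl, rfl⟩ := (B.crossingRel_parallel s).1 h₁ h₂
    simp only [Birack.isTangleLabeling_nil]
    exact ⟨[], [], [], ⟨⟨rfl, rfl, rfl⟩, trivial, trivial, trivial⟩, fun _ _ _ h => h.1⟩

theorem LabelEquiv.reidemeister2_antiparallel (u v : GaussCode) (c d : ℕ) (s : Bool) (hcd : c ≠ d)
    (hc : GaussCode.Fresh c (u ++ v)) (hd : GaussCode.Fresh d (u ++ v)) :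
    LabelEquiv.{v} (u ++ v)
      (⟨c, true, s⟩ :: ⟨d, true, !s⟩ :: u ++ ⟨d, false, !s⟩ :: ⟨c, false, s⟩ :: v) := by
  have := LabelEquiv.of_tangle.{v} (s₁ := []) (s₂ := []) (s₃ := []) (u := u) (v := v) (t := [])
    (s₁' := [⟨c, true, s⟩, ⟨d, true, !s⟩]) (s₂' := [⟨d, false, !s⟩, ⟨c, false, s⟩]) (s₃' := [])
    (by simp [GaussCode.Separate])
    (GaussCode.separate_of_forall_fresh (by simp [hc, hd]))
    (by cases s <;> simp [GaussCode.writhe]) ?_ ?_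
  · simpa using this
  · intro S B x₁ y₁ x₂ y₂ x₃ y₃ l₁ l₂ l₃ h
    obtain ⟨-, rfl, rfl, rfl⟩ := Birack.isTangleLabeling_nil.1 h
    simp only [Birack.isTangleLabeling_two, Birack.consistent_reidemeister2_antiparallel hcd]
    obtain ⟨m, n, h₁, h₂⟩ := (B.crossingRel_antiparallel s).2.2 x₁ x₂
    refine ⟨_, _, _, ⟨m, n, ⟨rfl, rfl, rfl⟩, trivial, h₁, h₂⟩, ?_⟩
    rintro _ _ _ ⟨m', n', ⟨rfl, rfl, rfl⟩, -, h₃, h₄⟩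
    obtain ⟨rfl, rfl⟩ := (B.crossingRel_antiparallel s).2.1 h₁ h₃
    exact ⟨rfl, rfl, rfl⟩
  · intro S B x₁ y₁ x₂ y₂ x₃ y₃ l₁ l₂ l₃ h
    obtain ⟨m, n, -, rfl, h'⟩ := Birack.isTangleLabeling_two.1 h
    obtain ⟨h₁, h₂⟩ := (Birack.consistent_reidemeister2_antiparallel hcd).1 h'
    obtain ⟨rfl, rfl⟩ := (B.crossingRel_antiparallel s).1 h₁ h₂
    simp only [Birack.isTangleLabeling_nil]
    exact ⟨[], [], [], ⟨⟨rfl, rfl, rfl⟩, trivial, trivial, trivial⟩, fun _ _ _ h => h.1⟩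

namespace Birack

variable {S : Type*} {B : Birack S} {p k p' q m q' s n s' : S}

/-- The relations between the labels of the three strands before a third Reidemeister move. -/
def BraidBefore (B : Birack S) (p k p' q m q' s n s' : S) : Prop :=
  B.CrossingRel true p k q m ∧ B.CrossingRel true k p' s n ∧ B.CrossingRel true m q' n s'

/-- The relations between the labels of the three strands after a third Reidemeister move. -/
def BraidAfter (B : Birack S) (p k p' q m q' s n s' : S) : Prop :=
  B.CrossingRel true k p' m q' ∧ B.CrossingRel true p k n s' ∧ B.CrossingRel true q m s n

/-- On either side of the move all labels are functions of the incoming `p`, `q`, `s`. The three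
Yang–Baxter identities say that the outgoing labels agree, and uniqueness of the inner labels is
automatic. -/
theorem BraidBefore.exists_after (h : B.BraidBefore p k p' q m q' s n s') :
    ∃ k' m' n', B.BraidAfter p k' p' q m' q' s n' s' := by
  obtain ⟨⟨rfl, rfl⟩, ⟨rfl, rfl⟩, rfl, rfl⟩ := h
  exact ⟨_, _, _, ⟨(B.yangBaxter_middle _ _ _).symm, (B.yangBaxter_right _ _ _).symm⟩,
    ⟨(B.yangBaxter_left _ _ _).symm, rfl⟩, rfl, rfl⟩

theorem BraidAfter.exists_before (h : B.BraidAfter p k p' q m q' s n s') :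
    ∃ k' m' n', B.BraidBefore p k' p' q m' q' s n' s' := by
  obtain ⟨⟨h₁, h₂⟩, ⟨h₃, h₄⟩, h₅, h₆⟩ := h
  subst h₅ h₆ h₃ h₄ h₁ h₂
  exact ⟨_, _, _, ⟨rfl, rfl⟩, ⟨rfl, B.yangBaxter_right _ _ _⟩, B.yangBaxter_left _ _ _,
    B.yangBaxter_middle _ _ _⟩

theorem BraidBefore.unique {k' m' n' : S} (h : B.BraidBefore p k p' q m q' s n s')
    (h' : B.BraidBefore p k' p' q m' q' s n' s') : k = k' ∧ m = m' ∧ n = n' := by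
  obtain ⟨⟨rfl, rfl⟩, ⟨rfl, rfl⟩, -⟩ := h
  obtain ⟨⟨rfl, rfl⟩, ⟨rfl, h⟩, -⟩ := h'
  exact ⟨rfl, rfl, rfl⟩

theorem BraidAfter.unique {k' m' n' : S} (h : B.BraidAfter p k p' q m q' s n s')
    (h' : B.BraidAfter p k' p' q m' q' s n' s') : k = k' ∧ m = m' ∧ n = n' := by
  obtain ⟨-, ⟨h₃, rfl⟩, rfl, rfl⟩ := h
  obtain ⟨-, ⟨h₃, rfl⟩, rfl, rfl⟩ := h'
  exact ⟨rfl, rfl, rfl⟩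

end Birack

theorem LabelEquiv.reidemeister3_order123 (u v t : GaussCode) (a b c : ℕ) (hab : a ≠ b)
    (hac : a ≠ c) (hbc : b ≠ c) (ha : GaussCode.Fresh a (u ++ v ++ t))
    (hb : GaussCode.Fresh b (u ++ v ++ t)) (hc : GaussCode.Fresh c (u ++ v ++ t)) :
    LabelEquiv.{v}
      (⟨a, true, true⟩ :: ⟨b, true, true⟩ :: u ++ ⟨a, false, true⟩ :: ⟨c, true, true⟩ :: v ++
        ⟨b, false, true⟩ :: ⟨c, false, true⟩ :: t)
      (⟨b, true, true⟩ :: ⟨a, true, true⟩ :: u ++ ⟨c, true, true⟩ :: ⟨a, false, true⟩ :: v ++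
        ⟨c, false, true⟩ :: ⟨b, false, true⟩ :: t) := by
  have key₁ : ∀ {S : Type v} (B : Birack S) (x₁ k y₁ x₂ m y₂ x₃ n y₃ : S), B.Consistent
      [⟨⟨a, true, true⟩, x₁, k⟩, ⟨⟨b, true, true⟩, k, y₁⟩, ⟨⟨a, false, true⟩, x₂, m⟩,
        ⟨⟨c, true, true⟩, m, y₂⟩, ⟨⟨b, false, true⟩, x₃, n⟩, ⟨⟨c, false, true⟩, n, y₃⟩] ↔
      B.BraidBefore x₁ k y₁ x₂ m y₂ x₃ n y₃ := by
    intros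
    simp [Birack.Consistent, Birack.Over, hab, hac, hbc, hab.symm, hac.symm, hbc.symm,
      Birack.BraidBefore]
  have key₂ : ∀ {S : Type v} (B : Birack S) (x₁ k y₁ x₂ m y₂ x₃ n y₃ : S), B.Consistent
      [⟨⟨b, true, true⟩, x₁, k⟩, ⟨⟨a, true, true⟩, k, y₁⟩, ⟨⟨c, true, true⟩, x₂, m⟩,
        ⟨⟨a, false, true⟩, m, y₂⟩, ⟨⟨c, false, true⟩, x₃, n⟩, ⟨⟨b, false, true⟩, n, y₃⟩] ↔
      B.BraidAfter x₁ k y₁ x₂ m y₂ x₃ n y₃ := by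
    intros
    simp [Birack.Consistent, Birack.Over, hab, hac, hbc, hab.symm, hac.symm, hbc.symm,
      Birack.BraidAfter]
    tauto
  have := LabelEquiv.of_tangle.{v} (u := u) (v := v) (t := t)
    (s₁ := [⟨a, true, true⟩, ⟨b, true, true⟩]) (s₂ := [⟨a, false, true⟩, ⟨c, true, true⟩])
    (s₃ := [⟨b, false, true⟩, ⟨c, false, true⟩])
    (s₁' := [⟨b, true, true⟩, ⟨a, true, true⟩]) (s₂' := [⟨c, true, true⟩, ⟨a, false, true⟩])
    (s₃' := [⟨c, false, true⟩, ⟨b, false, true⟩])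
    (GaussCode.separate_of_forall_fresh (by simp [-List.append_assoc, ha, hb, hc]))
    (GaussCode.separate_of_forall_fresh (by simp [-List.append_assoc, ha, hb, hc]))
    (by simp [GaussCode.writhe]) ?_ ?_
  · simpa using this
  · intro S B x₁ y₁ x₂ y₂ x₃ y₃ l₁ l₂ l₃ h
    simp only [Birack.isTangleLabeling_three, key₁, key₂] at h ⊢
    obtain ⟨k, m, n, -, h⟩ := h
    obtain ⟨k', m', n', h'⟩ := h.exists_after
    refine ⟨_, _, _, ⟨k', m', n', ⟨rfl, rfl, rfl⟩, h'⟩, ?_⟩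
    rintro _ _ _ ⟨i, j, l, ⟨rfl, rfl, rfl⟩, h''⟩
    obtain ⟨rfl, rfl, rfl⟩ := h'.unique h''
    exact ⟨rfl, rfl, rfl⟩
  · intro S B x₁ y₁ x₂ y₂ x₃ y₃ l₁ l₂ l₃ h
    simp only [Birack.isTangleLabeling_three, key₁, key₂] at h ⊢
    obtain ⟨k, m, n, -, h⟩ := h
    obtain ⟨k', m', n', h'⟩ := h.exists_before
    refine ⟨_, _, _, ⟨k', m', n', ⟨rfl, rfl, rfl⟩, h'⟩, ?_⟩
    rintro _ _ _ ⟨i, j, l, ⟨rfl, rfl, rfl⟩, h''⟩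
    obtain ⟨rfl, rfl, rfl⟩ := h'.unique h''
    exact ⟨rfl, rfl, rfl⟩

theorem LabelEquiv.reidemeister3_order132 (u v t : GaussCode) (a b c : ℕ) (hab : a ≠ b)
    (hac : a ≠ c) (hbc : b ≠ c) (ha : GaussCode.Fresh a (u ++ v ++ t))
    (hb : GaussCode.Fresh b (u ++ v ++ t)) (hc : GaussCode.Fresh c (u ++ v ++ t)) :
    LabelEquiv.{v}
      (⟨a, true, true⟩ :: ⟨b, true, true⟩ :: u ++ ⟨b, false, true⟩ :: ⟨c, false, true⟩ :: v ++
        ⟨a, false, true⟩ :: ⟨c, true, true⟩ :: t)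
      (⟨b, true, true⟩ :: ⟨a, true, true⟩ :: u ++ ⟨c, false, true⟩ :: ⟨b, false, true⟩ :: v ++
        ⟨c, true, true⟩ :: ⟨a, false, true⟩ :: t) := by
  have key₁ : ∀ {S : Type v} (B : Birack S) (x₁ k y₁ x₂ m y₂ x₃ n y₃ : S), B.Consistent
      [⟨⟨a, true, true⟩, x₁, k⟩, ⟨⟨b, true, true⟩, k, y₁⟩, ⟨⟨b, false, true⟩, x₂, n⟩,
        ⟨⟨c, false, true⟩, n, y₂⟩, ⟨⟨a, false, true⟩, x₃, m⟩, ⟨⟨c, true, true⟩, m, y₃⟩] ↔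
      B.BraidBefore x₁ k y₁ x₃ m y₃ x₂ n y₂ := by
    intros
    simp [Birack.Consistent, Birack.Over, hab, hac, hbc, hab.symm, hac.symm, hbc.symm,
      Birack.BraidBefore]
  have key₂ : ∀ {S : Type v} (B : Birack S) (x₁ k y₁ x₂ m y₂ x₃ n y₃ : S), B.Consistent
      [⟨⟨b, true, true⟩, x₁, k⟩, ⟨⟨a, true, true⟩, k, y₁⟩, ⟨⟨c, false, true⟩, x₂, n⟩,
        ⟨⟨b, false, true⟩, n, y₂⟩, ⟨⟨c, true, true⟩, x₃, m⟩, ⟨⟨a, false, true⟩, m, y₃⟩] ↔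
      B.BraidAfter x₁ k y₁ x₃ m y₃ x₂ n y₂ := by
    intros
    simp [Birack.Consistent, Birack.Over, hab, hac, hbc, hab.symm, hac.symm, hbc.symm,
      Birack.BraidAfter]
    tauto
  have := LabelEquiv.of_tangle.{v} (u := u) (v := v) (t := t)
    (s₁ := [⟨a, true, true⟩, ⟨b, true, true⟩]) (s₂ := [⟨b, false, true⟩, ⟨c, false, true⟩])
    (s₃ := [⟨a, false, true⟩, ⟨c, true, true⟩])
    (s₁' := [⟨b, true, true⟩, ⟨a, true, true⟩]) (s₂' := [⟨c, false, true⟩, ⟨b, false, true⟩])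
    (s₃' := [⟨c, true, true⟩, ⟨a, false, true⟩])
    (GaussCode.separate_of_forall_fresh (by simp [-List.append_assoc, ha, hb, hc]))
    (GaussCode.separate_of_forall_fresh (by simp [-List.append_assoc, ha, hb, hc]))
    (by simp [GaussCode.writhe]) ?_ ?_
  · simpa using this
  · intro S B x₁ y₁ x₂ y₂ x₃ y₃ l₁ l₂ l₃ h
    simp only [Birack.isTangleLabeling_three, key₁, key₂] at h ⊢
    obtain ⟨k, n, m, -, h⟩ := h
    obtain ⟨k', m', n', h'⟩ := h.exists_after
    refine ⟨_, _, _, ⟨k', n', m', ⟨rfl, rfl, rfl⟩, h'⟩, ?_⟩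
    rintro _ _ _ ⟨i, l, j, ⟨rfl, rfl, rfl⟩, h''⟩
    obtain ⟨rfl, rfl, rfl⟩ := h'.unique h''
    exact ⟨rfl, rfl, rfl⟩
  · intro S B x₁ y₁ x₂ y₂ x₃ y₃ l₁ l₂ l₃ h
    simp only [Birack.isTangleLabeling_three, key₁, key₂] at h ⊢
    obtain ⟨k, n, m, -, h⟩ := h
    obtain ⟨k', m', n', h'⟩ := h.exists_before
    refine ⟨_, _, _, ⟨k', n', m', ⟨rfl, rfl, rfl⟩, h'⟩, ?_⟩
    rintro _ _ _ ⟨i, l, j, ⟨rfl, rfl, rfl⟩, h''⟩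
    obtain ⟨rfl, rfl, rfl⟩ := h'.unique h''
    exact ⟨rfl, rfl, rfl⟩

theorem LabelEquiv.of_gaussMove {w w' : GaussCode} (h : GaussMove w w') : LabelEquiv.{v} w w' := by
  cases h with
  | rotate u v => exact rotate u v
  | rename f w => exact rename f w
  | reidemeister1 w c o s hc => exact reidemeister1 w c o s hc
  | reidemeister2_parallel u v c d s hcd hc hd => exact reidemeister2_parallel u v c d s hcd hc hd
  | reidemeister2_antiparallel u v c d s hcd hc hd =>
    exact reidemeister2_antiparallel u v c d s hcd hc hd
  | reidemeister3_order123 u v t a b c hab hac hbc ha hb hc =>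
    exact reidemeister3_order123 u v t a b c hab hac hbc ha hb hc
  | reidemeister3_order132 u v t a b c hab hac hbc ha hb hc =>
    exact reidemeister3_order132 u v t a b c hab hac hbc ha hb hc

theorem LabelEquiv.of_sameKnot {w w' : GaussCode} (h : SameKnot w w') : LabelEquiv.{v} w w' := by
  induction h with
  | rel _ _ h => exact of_gaussMove h
  | refl => exact refl _
  | symm _ _ _ ih => exact ih.symm
  | trans _ _ _ _ _ ih₁ ih₂ => exact ih₁.trans ih₂

/-! ### Labels carried through a braid word. -/

/-- The operation of a birack as a bijection. -/
noncomputable def Birack.op {S : Type*} (B : Birack S) : S × S ≃ S × S :=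
  Equiv.ofBijective (fun a => (B.left a.1 a.2, B.right a.1 a.2)) (by
    constructor
    · rintro ⟨a, b⟩ ⟨a', b'⟩ h
      obtain ⟨rfl, rfl⟩ := B.op_injective (congrArg Prod.fst h) (congrArg Prod.snd h)
      rfl
    · rintro ⟨c, d⟩
      obtain ⟨a, b, rfl, rfl⟩ := B.op_surjective c d
      exact ⟨(a, b), rfl⟩)

theorem Birack.op_apply {S : Type*} (B : Birack S) (a b : S) :
    B.op (a, b) = (B.left a b, B.right a b) := rfl

/-- The operation or its inverse. -/
noncomputable def Birack.opSign {S : Type*} (B : Birack S) (s : Bool) : S × S ≃ S × S :=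
  bif s then B.op else B.op.symm

theorem Birack.IsHom.opSign {S T : Type*} {B : Birack S} {B' : Birack T} {f : S → T}
    (h : Birack.IsHom B B' f) (s : Bool) (a : S × S) :
    (B.opSign s a).map f f = B'.opSign s (a.map f f) := by
  have hop : ∀ a : S × S, (B.op a).map f f = B'.op (a.map f f) := by
    rintro ⟨a, b⟩
    simp only [Birack.op_apply, Prod.map, h.left, h.right]
  cases s
  · apply B'.op.injective
    simp only [Birack.opSign, cond_false]
    rw [← hop, Equiv.apply_symm_apply, Equiv.apply_symm_apply]
  · exact hop a

theorem Birack.crossingRel_iff {S : Type*} (B : Birack S) {s : Bool} {a b c d : S} :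
    B.opSign s (a, b) = (c, d) ↔
      bif s then B.CrossingRel s a d b c else B.CrossingRel s b c a d := by
  cases s
  · simp only [Birack.opSign, cond_false, Equiv.symm_apply_eq, Birack.op_apply, Prod.mk.injEq,
      Birack.crossingRel_false]
    exact and_congr eq_comm eq_comm
  · simp only [Birack.opSign, cond_true, Birack.op_apply, Prod.mk.injEq, Birack.crossingRel_true]

namespace BraidWord

variable {n : ℕ}

/-- The strand at the left of a letter. -/
def leftStrand (i : {i : ℕ // i + 1 < n}) : Fin n := ⟨i.1, by omega⟩

/-- The strand at the right of a letter. -/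
def rightStrand (i : {i : ℕ // i + 1 < n}) : Fin n := ⟨i.1 + 1, i.2⟩

theorem leftStrand_ne (i : {i : ℕ // i + 1 < n}) : leftStrand i ≠ rightStrand i := by
  simp [leftStrand, rightStrand]

/-- The transposition underlying a letter. -/
def swap (i : {i : ℕ // i + 1 < n}) : Equiv.Perm (Fin n) :=
  Equiv.swap (leftStrand i) (rightStrand i)

theorem swap_left (i : {i : ℕ // i + 1 < n}) : swap i (leftStrand i) = rightStrand i :=
  Equiv.swap_apply_left _ _

theorem swap_right (i : {i : ℕ // i + 1 < n}) : swap i (rightStrand i) = leftStrand i :=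
  Equiv.swap_apply_right _ _

theorem swap_of_ne {i : {i : ℕ // i + 1 < n}} {p : Fin n} (h : p ≠ leftStrand i)
    (h' : p ≠ rightStrand i) : swap i p = p :=
  Equiv.swap_apply_of_ne_of_ne h h'

theorem swap_swap (i : {i : ℕ // i + 1 < n}) (p : Fin n) : swap i (swap i p) = p :=
  Equiv.swap_apply_self _ _ _

theorem toBraid_nil : toBraid ([] : BraidWord n) = 1 := rfl

/-- The braid of a letter. -/
def letterBraid (i : {i : ℕ // i + 1 < n}) (s : Bool) : BraidGroup n :=
  bif s then BraidGroup.gen n i else (BraidGroup.gen n i)⁻¹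

theorem toBraid_cons (i : {i : ℕ // i + 1 < n}) (s : Bool) (w : BraidWord n) :
    toBraid ((i, s) :: w) = letterBraid i s * toBraid w := by
  have h : FreeGroup.mk ((i, s) :: w) = FreeGroup.mk [(i, s)] * FreeGroup.mk w := by
    rw [FreeGroup.mul_mk]
    rfl
  rw [toBraid, h, map_mul]
  congr 1
  cases s
  · have : (FreeGroup.mk [(i, false)]) = (FreeGroup.of i)⁻¹ := rfl
    rw [this, map_inv]
    rfl
  · rfl

theorem _root_.BraidGroup.lift_gen {G : Type*} [Group G] (f : {i : ℕ // i + 1 < n} → G) (far adj)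
    (i : {i : ℕ // i + 1 < n}) : BraidGroup.lift f far adj (BraidGroup.gen n i) = f i := by
  simp [BraidGroup.lift, BraidGroup.gen]

theorem perm_gen (i : {i : ℕ // i + 1 < n}) :
    BraidGroup.perm n (BraidGroup.gen n i) = swap i :=
  BraidGroup.lift_gen _ _ _ i

theorem perm_letterBraid (i : {i : ℕ // i + 1 < n}) (s : Bool) :
    BraidGroup.perm n (letterBraid i s) = swap i := by
  cases s
  · rw [letterBraid, cond_false, map_inv, perm_gen]
    exact Equiv.swap_inv _ _
  · exact perm_gen i

/-- The final position of a strand. -/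
def final (w : BraidWord n) : Equiv.Perm (Fin n) := (BraidGroup.perm n w.toBraid)⁻¹

theorem final_nil (p : Fin n) : final [] p = p := by
  simp [final, toBraid_nil]

/-- The inverse in `final` accounts for the order of multiplication: in the permutation of a product
the last letter acts first, whereas a strand meets the first letter first. -/
theorem final_cons (i : {i : ℕ // i + 1 < n}) (s : Bool) (w : BraidWord n) (p : Fin n) :
    final ((i, s) :: w) p = final w (swap i p) := by
  have : (swap i)⁻¹ = swap i := Equiv.swap_inv _ _
  simp [final, toBraid_cons, perm_letterBraid, this]

/-- The passage of the strand at position `p` through the letter `σ_i^{±1}` with number `k`. -/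
def passages (i : {i : ℕ // i + 1 < n}) (s : Bool) (k : ℕ) (p : Fin n) : GaussCode :=
  if p = leftStrand i then [⟨k, s, s⟩] else if p = rightStrand i then [⟨k, !s, s⟩] else []

theorem passages_left (i : {i : ℕ // i + 1 < n}) (s : Bool) (k : ℕ) :
    passages i s k (leftStrand i) = [⟨k, s, s⟩] := if_pos rfl

theorem passages_right (i : {i : ℕ // i + 1 < n}) (s : Bool) (k : ℕ) :
    passages i s k (rightStrand i) = [⟨k, !s, s⟩] := by
  rw [passages, if_neg (leftStrand_ne i).symm, if_pos rfl]

theorem passages_of_ne {i : {i : ℕ // i + 1 < n}} {p : Fin n} (h : p ≠ leftStrand i)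
    (h' : p ≠ rightStrand i) (s : Bool) (k : ℕ) : passages i s k p = [] := by
  rw [passages, if_neg h, if_neg h']

theorem follow_cons (i : {i : ℕ // i + 1 < n}) (s : Bool) (w : BraidWord n) (k : ℕ) (p : Fin n) :
    follow ((i, s) :: w) k p =
      (passages i s k p ++ (follow w (k + 1) (swap i p)).1, (follow w (k + 1) (swap i p)).2) := by
  by_cases h : p = leftStrand i
  · subst h
    rw [passages_left, swap_left, follow, if_pos (show (leftStrand i).1 = i.1 from rfl)]
    rfl
  by_cases h' : p = rightStrand i
  · subst h'
    rw [passages_right, swap_right, follow, if_neg (by simp [rightStrand]),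
      if_pos (show (rightStrand i).1 = i.1 + 1 from rfl)]
    rfl
  · rw [passages_of_ne h h', swap_of_ne h h', follow,
      if_neg (show ¬p.1 = i.1 from fun e => h (Fin.ext e)),
      if_neg (show ¬p.1 = i.1 + 1 from fun e => h' (Fin.ext e))]
    rfl

theorem follow_snd (w : BraidWord n) (k : ℕ) (p : Fin n) : (follow w k p).2 = final w p := by
  induction w generalizing k p with
  | nil => rw [final_nil]; rfl
  | cons l w ih =>
    obtain ⟨i, s⟩ := l
    rw [follow_cons, final_cons]
    exact ih _ _

theorem travel_eq (w : BraidWord n) (m : ℕ) (p : Fin n) :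
    travel w m p = (List.range m).flatMap fun j => (follow w 0 ((final w)^[j] p : Fin n)).1 := by
  induction m generalizing p with
  | zero => rfl
  | succ m ih =>
    rw [travel, follow_snd, ih, List.range_succ_eq_map, List.flatMap_cons, List.flatMap_map]
    rfl

theorem writhe_toBraid_cons (i : {i : ℕ // i + 1 < n}) (s : Bool) (w : BraidWord n) :
    BraidGroup.writhe (toBraid ((i, s) :: w)) = signOf s + BraidGroup.writhe (toBraid w) := by
  rw [toBraid_cons]
  unfold BraidGroup.writhe
  rw [map_mul, toAdd_mul]
  congr 1
  cases s
  · rw [letterBraid, cond_false, map_inv, toAdd_inv, BraidGroup.lift_gen]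
    rfl
  · rw [letterBraid, cond_true, BraidGroup.lift_gen]
    rfl

theorem sum_writhe_passages (i : {i : ℕ // i + 1 < n}) (s : Bool) (k : ℕ) :
    ∑ p, GaussCode.writhe (passages i s k p) = signOf s := by
  rw [← Finset.sum_subset (Finset.subset_univ {leftStrand i, rightStrand i}),
    Finset.sum_pair (leftStrand_ne i), passages_left, passages_right]
  · cases s <;> simp [GaussCode.writhe, signOf]
  · intro p _ hp
    simp only [Finset.mem_insert, Finset.mem_singleton, not_or] at hp
    rw [passages_of_ne hp.1 hp.2]
    rfl

theorem sum_writhe_follow (w : BraidWord n) (k : ℕ) :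
    ∑ p : Fin n, GaussCode.writhe (follow w k p).1 = w.toBraid.writhe := by
  induction w generalizing k with
  | nil => simp [follow, GaussCode.writhe, toBraid_nil, BraidGroup.writhe]
  | cons l w ih =>
    obtain ⟨i, s⟩ := l
    simp only [follow_cons, GaussCode.writhe_append, Finset.sum_add_distrib, sum_writhe_passages,
      writhe_toBraid_cons]
    rw [← ih (k + 1), Equiv.sum_comp (swap i) fun p => GaussCode.writhe (follow w (k + 1) p).1]

theorem crossing_passages {i : {i : ℕ // i + 1 < n}} {s : Bool} {k : ℕ} {p : Fin n} {q : Passage}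
    (h : q ∈ passages i s k p) : q.crossing = k := by
  unfold passages at h
  split_ifs at h <;> simp_all

theorem le_crossing_follow {w : BraidWord n} {k : ℕ} {p : Fin n} {q : Passage}
    (h : q ∈ (follow w k p).1) : k ≤ q.crossing := by
  induction w generalizing k p with
  | nil => simp [follow] at h
  | cons l w ih =>
    obtain ⟨i, s⟩ := l
    rw [follow_cons, List.mem_append] at h
    rcases h with h | h
    · exact (crossing_passages h).ge
    · exact (Nat.le_succ k).trans (ih h)

end BraidWord

namespace Birack

open BraidWord

variable {S T : Type*} (B : Birack S) {n : ℕ}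

/-- The labels after a letter, in terms of the labels before it. -/
noncomputable def letter (i : {i : ℕ // i + 1 < n}) (s : Bool) (x : Fin n → S) : Fin n → S :=
  fun p => if p = leftStrand i then (B.opSign s (x (leftStrand i), x (rightStrand i))).1
    else if p = rightStrand i then (B.opSign s (x (leftStrand i), x (rightStrand i))).2 else x p

theorem letter_left (i : {i : ℕ // i + 1 < n}) (s : Bool) (x : Fin n → S) :
    B.letter i s x (leftStrand i) = (B.opSign s (x (leftStrand i), x (rightStrand i))).1 :=
  if_pos rfl

theorem letter_right (i : {i : ℕ // i + 1 < n}) (s : Bool) (x : Fin n → S) :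
    B.letter i s x (rightStrand i) = (B.opSign s (x (leftStrand i), x (rightStrand i))).2 := by
  rw [letter, if_neg (leftStrand_ne i).symm, if_pos rfl]

theorem letter_of_ne {i : {i : ℕ // i + 1 < n}} {p : Fin n} (h : p ≠ leftStrand i)
    (h' : p ≠ rightStrand i) (s : Bool) (x : Fin n → S) : B.letter i s x p = x p := by
  rw [letter, if_neg h, if_neg h']

theorem IsHom.letter {B : Birack S} {B' : Birack T} {f : S → T} (h : IsHom B B' f)
    (i : {i : ℕ // i + 1 < n}) (s : Bool) (x : Fin n → S) :
    f ∘ B.letter i s x = B'.letter i s (f ∘ x) := by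
  have := h.opSign s (x (leftStrand i), x (rightStrand i))
  funext p
  simp only [Birack.letter, Function.comp_apply]
  split_ifs
  · exact congrArg Prod.fst this
  · exact congrArg Prod.snd this
  · rfl

/-- The labels at the end of a braid word. -/
noncomputable def run : BraidWord n → (Fin n → S) → Fin n → S
  | [], x => x
  | (i, s) :: w, x => run w (B.letter i s x)

/-- The labelled passages of a strand through a letter. -/
noncomputable def letterLabels (i : {i : ℕ // i + 1 < n}) (s : Bool) (k : ℕ) (x : Fin n → S)
    (p : Fin n) : List (LabeledPassage S) :=
  (passages i s k p).map fun q => ⟨q, x p, B.letter i s x (swap i p)⟩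

/-- The labelled passages of a strand through a braid word. -/
noncomputable def labels : BraidWord n → ℕ → (Fin n → S) → Fin n → List (LabeledPassage S)
  | [], _, _, _ => []
  | (i, s) :: w, k, x, p =>
    B.letterLabels i s k x p ++ labels w (k + 1) (B.letter i s x) (swap i p)

theorem map_passage_letterLabels (i : {i : ℕ // i + 1 < n}) (s : Bool) (k : ℕ) (x : Fin n → S)
    (p : Fin n) : (B.letterLabels i s k x p).map passage = passages i s k p := by
  simp [letterLabels, Function.comp_def]

theorem map_passage_labels (w : BraidWord n) (k : ℕ) (x : Fin n → S) (p : Fin n) :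
    (B.labels w k x p).map passage = (follow w k p).1 := by
  induction w generalizing k x p with
  | nil => rfl
  | cons l w ih =>
    obtain ⟨i, s⟩ := l
    rw [labels, List.map_append, map_passage_letterLabels, ih, follow_cons]

theorem isPath_letterLabels (i : {i : ℕ // i + 1 < n}) (s : Bool) (k : ℕ) (x : Fin n → S)
    (p : Fin n) : IsPath (x p) (B.letterLabels i s k x p) (B.letter i s x (swap i p)) := by
  by_cases h : p = leftStrand i
  · subst h
    rw [letterLabels, passages_left]
    exact ⟨rfl, rfl⟩
  by_cases h' : p = rightStrand i
  · subst h'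
    rw [letterLabels, passages_right]
    exact ⟨rfl, rfl⟩
  · rw [letterLabels, passages_of_ne h h', swap_of_ne h h', B.letter_of_ne h h']
    exact rfl

theorem isPath_labels (w : BraidWord n) (k : ℕ) (x : Fin n → S) (p : Fin n) :
    IsPath (x p) (B.labels w k x p) (B.run w x (final w p)) := by
  induction w generalizing k x p with
  | nil => rw [final_nil]; exact rfl
  | cons l w ih =>
    obtain ⟨i, s⟩ := l
    rw [labels, final_cons]
    exact isPath_append.2 ⟨_, B.isPath_letterLabels i s k x p, ih _ _ _⟩

theorem over_letterLabels (i : {i : ℕ // i + 1 < n}) (s : Bool) (k : ℕ) (x : Fin n → S)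
    (p q : Fin n) : B.Over (B.letterLabels i s k x p) (B.letterLabels i s k x q) := by
  have hx : B.opSign s (x (leftStrand i), x (rightStrand i)) =
      (B.letter i s x (leftStrand i), B.letter i s x (rightStrand i)) := by
    rw [letter_left, letter_right]
  rw [crossingRel_iff] at hx
  intro P hP Q hQ h₁ h₂ h₃
  simp only [letterLabels, passages] at hP hQ
  split_ifs at hP hQ <;> cases s <;> simp_all [swap_left, swap_right]

theorem over_passages_follow {k : ℕ} {i : {i : ℕ // i + 1 < n}} {s : Bool} {w : BraidWord n}
    {p q : Fin n} : GaussCode.Separate (passages i s k p) (follow w (k + 1) q).1 := by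
  intro a ha b hb
  have h₁ := crossing_passages ha
  have h₂ := le_crossing_follow hb
  omega

theorem over_labels (w : BraidWord n) (k : ℕ) (x : Fin n → S) (p q : Fin n) :
    B.Over (B.labels w k x p) (B.labels w k x q) := by
  induction w generalizing k x p q with
  | nil => simp [labels, Over]
  | cons l w ih =>
    obtain ⟨i, s⟩ := l
    simp only [labels, over_append_left, over_append_right]
    refine ⟨⟨B.over_letterLabels i s k x p q, B.over_of_separate ?_⟩, B.over_of_separate ?_,
      ih _ _ _ _⟩
    all_goals rw [map_passage_letterLabels, map_passage_labels]
    · exact over_passages_follow.symm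
    · exact over_passages_follow

/-- The labels of all strands are determined by the labels at the start. -/
theorem eq_labels (w : BraidWord n) (k : ℕ) (x z : Fin n → S)
    (d : Fin n → List (LabeledPassage S)) (hd : ∀ p, (d p).map passage = (follow w k p).1)
    (hp : ∀ p, IsPath (x p) (d p) (z p)) (ho : ∀ p q, B.Over (d p) (d q)) (p : Fin n) :
    d p = B.labels w k x p := by
  induction w generalizing k x z d p with
  | nil => exact List.map_eq_nil_iff.1 (hd p)
  | cons l w ih =>
    obtain ⟨i, s⟩ := l
    have : ∀ p, ∃ a b, d p = a ++ b ∧ a.map passage = passages i s k p ∧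
        b.map passage = (follow w (k + 1) (swap i p)).1 := by
      intro p
      have := hd p
      rw [follow_cons] at this
      exact List.map_eq_append_iff.1 this
    choose a b hab ha hb using this
    have : ∀ p, ∃ y, IsPath (x p) (a p) y ∧ IsPath y (b p) (z p) := by
      intro p
      have := hp p
      rwa [hab, isPath_append] at this
    choose y hy₁ hy₂ using this
    have one : ∀ {p : Fin n} {q : Passage}, passages i s k p = [q] → a p = [⟨q, x p, y p⟩] := by
      intro p q h
      obtain ⟨⟨q', x', y'⟩, l, h₁, rfl, h₂⟩ := List.map_eq_cons_iff.1 ((ha p).trans h)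
      obtain rfl := List.map_eq_nil_iff.1 h₂
      have h₃ := hy₁ p
      rw [h₁] at h₃ ⊢
      obtain ⟨rfl, rfl⟩ := h₃
      rfl
    have hl := one (passages_left i s k)
    have hr := one (passages_right i s k)
    -- The first letter is one crossing between two strands, and its relation determines all labels
    -- `y` after that letter from `x`.
    have hrel : B.opSign s (x (leftStrand i), x (rightStrand i)) =
        (y (rightStrand i), y (leftStrand i)) := by
      rw [crossingRel_iff]
      have h₁ := ho (leftStrand i) (rightStrand i)
      have h₂ := ho (rightStrand i) (leftStrand i)
      rw [hab, hab, hl, hr] at h₁ h₂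
      cases s
      · exact h₂ _ (List.mem_append_left _ (List.mem_singleton_self _)) _
          (List.mem_append_left _ (List.mem_singleton_self _)) rfl rfl rfl
      · exact h₁ _ (List.mem_append_left _ (List.mem_singleton_self _)) _
          (List.mem_append_left _ (List.mem_singleton_self _)) rfl rfl rfl
    have hy : ∀ p, y p = B.letter i s x (swap i p) := by
      intro p
      by_cases h : p = leftStrand i
      · rw [h, swap_left, letter_right, hrel]
      by_cases h' : p = rightStrand i
      · rw [h', swap_right, letter_left, hrel]
      · rw [swap_of_ne h h', B.letter_of_ne h h']
        have h₃ := hy₁ p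
        rw [List.map_eq_nil_iff.1 ((ha p).trans (passages_of_ne h h' s k))] at h₃
        exact h₃.symm
    -- The remaining word is indexed by positions after the letter, so the strands are renumbered by
    -- the involution `swap i`.
    have hbl := ih (k + 1) (B.letter i s x) (fun p => z (swap i p)) (fun p => b (swap i p))
      (fun p => by rw [hb, swap_swap])
      (fun p => by
        have := hy₂ (swap i p)
        rwa [hy, swap_swap] at this)
      (fun p q => by
        have := ho (swap i p) (swap i q)
        rw [hab, hab, over_append_left, over_append_right, over_append_right] at this
        exact this.2.2) (swap i p)
    rw [swap_swap] at hbl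
    rw [hab, labels, hbl]
    congr 1
    by_cases h : p = leftStrand i
    · rw [h, hl, letterLabels, passages_left, hy]
      rfl
    by_cases h' : p = rightStrand i
    · rw [h', hr, letterLabels, passages_right, hy]
      rfl
    · have := passages_of_ne h h' s k
      rw [List.map_eq_nil_iff.1 ((ha p).trans this), letterLabels, this]
      rfl

theorem IsHom.labels {B : Birack S} {B' : Birack T} {f : S → T} (h : IsHom B B' f)
    (w : BraidWord n) (k : ℕ) (x : Fin n → S) (p : Fin n) :
    (B.labels w k x p).map (map f) = B'.labels w k (f ∘ x) p := by
  induction w generalizing k x p with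
  | nil => rfl
  | cons l w ih =>
    obtain ⟨i, s⟩ := l
    rw [Birack.labels, Birack.labels, List.map_append, ih, h.letter]
    congr 1
    simp only [Birack.letterLabels, List.map_map, ← h.letter]
    rfl

end Birack

/-! ### Labelings of the closure of a braid word. -/

theorem List.flatMap_range_congr {α : Type*} {m : ℕ} {g h : ℕ → List α}
    (H : ∀ j < m, g j = h j) : (List.range m).flatMap g = (List.range m).flatMap h :=
  List.flatMap_congr fun j hj => H j (List.mem_range.1 hj)

theorem List.exists_of_map_eq_flatMap_range {α β : Type*} {f : α → β} {l : List α} {m : ℕ}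
    {g : ℕ → List β} (h : l.map f = (List.range m).flatMap g) :
    ∃ d : ℕ → List α, l = (List.range m).flatMap d ∧ ∀ j < m, (d j).map f = g j := by
  induction m generalizing l with
  | zero => exact ⟨fun _ => [], by simpa using h, by simp⟩
  | succ m ih =>
    rw [List.range_succ, List.flatMap_append, List.flatMap_singleton] at h
    obtain ⟨l₁, l₂, rfl, h₁, h₂⟩ := List.map_eq_append_iff.1 h
    obtain ⟨d, rfl, hd⟩ := ih h₁
    -- Only the value at `j = m` matters in the second case.
    refine ⟨fun j => if j < m then d j else l₂, ?_, ?_⟩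
    · rw [List.range_succ, List.flatMap_append, List.flatMap_singleton, if_neg (lt_irrefl m)]
      congr 1
      exact List.flatMap_range_congr fun j hj => (if_pos hj).symm
    · intro j hj
      by_cases h' : j < m
      · simp only [h', if_true, hd j h']
      · obtain rfl : j = m := by omega
        simp only [lt_irrefl, if_false, h₂]

theorem List.eq_of_flatMap_range_eq {α : Type*} {m : ℕ} {d d' : ℕ → List α}
    (hl : ∀ j < m, (d j).length = (d' j).length)
    (h : (List.range m).flatMap d = (List.range m).flatMap d') : ∀ j < m, d j = d' j := by
  induction m with
  | zero => simp
  | succ m ih =>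
    simp only [List.range_succ, List.flatMap_append, List.flatMap_singleton] at h
    obtain ⟨h₁, h₂⟩ := List.append_inj' h (hl m (Nat.lt_succ_self m))
    intro j hj
    rcases Nat.lt_succ_iff_lt_or_eq.1 hj with h' | rfl
    · exact ih (fun j hj => hl j (by omega)) h₁ j h'
    · exact h₂

theorem isPath_flatMap_range {S : Type*} {y z : S} {m : ℕ} {d : ℕ → List (LabeledPassage S)} :
    IsPath y ((List.range m).flatMap d) z ↔
      ∃ Y : ℕ → S, Y 0 = y ∧ Y m = z ∧ ∀ j < m, IsPath (Y j) (d j) (Y (j + 1)) := by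
  induction m generalizing z with
  | zero => exact ⟨fun h => ⟨fun _ => y, rfl, h, by simp⟩, fun ⟨Y, h, h', _⟩ => h.symm.trans h'⟩
  | succ m ih =>
    rw [List.range_succ, List.flatMap_append, List.flatMap_singleton, isPath_append]
    constructor
    · rintro ⟨w, h₁, h₂⟩
      obtain ⟨Y, h₃, h₄, h₅⟩ := ih.1 h₁
      refine ⟨fun j => if j ≤ m then Y j else z, by simpa using h₃, by simp, fun j hj => ?_⟩
      rcases Nat.lt_succ_iff_lt_or_eq.1 hj with h' | rfl
      · simpa [h'.le, Nat.succ_le_iff.2 h'] using h₅ j h'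
      · simpa [h₄] using h₂
    · rintro ⟨Y, h₁, h₂, h₃⟩
      exact ⟨Y m, ih.2 ⟨Y, h₁, rfl, fun j hj => h₃ j (by omega)⟩, h₂ ▸ h₃ m (Nat.lt_succ_self m)⟩

/-- The orbit of a permutation of `Fin n` which is a single cycle is enumerated by `0, …, n - 1`. -/
theorem exists_orbit_enumeration {n : ℕ} (e : Equiv.Perm (Fin n)) (h : ∀ i j, e.SameCycle i j)
    (a : Fin n) : (∀ p, ∃ j < n, e^[j] a = p) ∧
      (∀ i < n, ∀ j < n, e^[i] a = e^[j] a → i = j) ∧ e^[n] a = a := by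
  set d := Function.minimalPeriod e a with hd
  have hd0 : 0 < d := Function.minimalPeriod_pos_of_mem_periodicPts
    (Function.Injective.mem_periodicPts e.injective a)
  have hinj : Set.InjOn (fun j => e^[j] a) (Set.Iio d) := Function.iterate_injOn_Iio_minimalPeriod
  have hsurj : ∀ p, ∃ j < d, e^[j] a = p := by
    intro p
    obtain ⟨j, hj⟩ := (h a p).exists_nat_pow_eq
    refine ⟨j % d, Nat.mod_lt _ hd0, ?_⟩
    rw [Function.iterate_mod_minimalPeriod_eq, ← Equiv.Perm.coe_pow, hj]
  -- The first `d` iterates enumerate all of `Fin n` without repetition, so the period is found by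
  -- counting.
  have hdn : d = n := by
    have hb : Function.Bijective fun j : Fin d => e^[j] a := by
      constructor
      · intro i j hij
        exact Fin.ext (hinj i.2 j.2 hij)
      · intro p
        obtain ⟨j, hj, hp⟩ := hsurj p
        exact ⟨⟨j, hj⟩, hp⟩
    simpa using Fintype.card_of_bijective hb
  rw [hdn] at hsurj hinj
  refine ⟨hsurj, fun i hi j hj hij => hinj hi hj hij, ?_⟩
  have hper : e^[d] a = a := Function.iterate_minimalPeriod
  rwa [hdn] at hper

namespace Birack

open BraidWord

variable {S T : Type*} (B : Birack S) {n : ℕ}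

/-- The labels at the end of the word are the labels at the start, up to the torsion to the power
of the writhe at the strand `a`. -/
def IsClosed (w : BraidWord n) (a : Fin n) (x : Fin n → S) : Prop :=
  ∀ p, B.run w x p = if p = a then B.shift w.toBraid.writhe (x p) else x p

/-- The labeling of the Gauss code of the closure given by the labels at the start of the word. -/
noncomputable def closureLabeling (w : BraidWord n) (a : Fin n) (x : Fin n → S) :
    S × List (LabeledPassage S) :=
  (x a, (List.range n).flatMap fun j => B.labels w 0 x ((final w)^[j] a))

variable {B}

theorem IsHom.closureLabeling {B' : Birack T} {f : S → T} (h : IsHom B B' f) (w : BraidWord n)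
    (a : Fin n) (x : Fin n → S) :
    (B.closureLabeling w a x).map f (List.map (map f)) = B'.closureLabeling w a (f ∘ x) := by
  simp only [Birack.closureLabeling, Prod.map, List.map_flatMap, h.labels]
  rfl

theorem closureCode_eq {w : BraidWord n} {a : Fin n} (ha : a.1 = 0) :
    w.closureCode = (List.range n).flatMap fun j => (follow w 0 ((final w)^[j] a : Fin n)).1 := by
  rw [← travel_eq w n a, ha, closureCode]

theorem _root_.BraidWord.sameCycle_final {w : BraidWord n} (hw : w.toBraid.ClosesToKnot)
    (i j : Fin n) : (final w).SameCycle i j :=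
  (hw.2 i j).inv

theorem _root_.GaussCode.writhe_flatMap_range (m : ℕ) (g : ℕ → GaussCode) :
    GaussCode.writhe ((List.range m).flatMap g) = ∑ j ∈ Finset.range m, GaussCode.writhe (g j) := by
  induction m with
  | zero => rfl
  | succ m ih =>
    rw [List.range_succ, List.flatMap_append, List.flatMap_singleton, GaussCode.writhe_append, ih,
      Finset.sum_range_succ]

/-- The tour visits each of the `n` strands once, and `GaussCode.writhe` counts a crossing at its
overpass only. -/
theorem writhe_closureCode {w : BraidWord n} (hw : w.toBraid.ClosesToKnot) :
    w.closureCode.writhe = w.toBraid.writhe := by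
  obtain ⟨h₁, h₂, -⟩ := exists_orbit_enumeration (final w) (sameCycle_final hw) ⟨0, hw.1⟩
  rw [closureCode_eq (a := ⟨0, hw.1⟩) rfl, GaussCode.writhe_flatMap_range, ← sum_writhe_follow w 0]
  refine Finset.sum_bij (fun j _ => (final w)^[j] ⟨0, hw.1⟩) (fun _ _ => Finset.mem_univ _) ?_ ?_
    fun _ _ => rfl
  · intro i hi j hj hij
    exact h₂ i (Finset.mem_range.1 hi) j (Finset.mem_range.1 hj) hij
  · intro p _
    obtain ⟨j, hj, h⟩ := h₁ p
    exact ⟨j, Finset.mem_range.2 hj, h⟩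

/-- This lemma and the next two make `closureLabeling` a bijection from closed tuples to labelings
of the closure. -/
theorem IsClosed.isLabeling {w : BraidWord n} (hw : w.toBraid.ClosesToKnot) {a : Fin n}
    (ha : a.1 = 0) {x : Fin n → S} (hx : B.IsClosed w a x) :
    B.IsLabeling w.closureCode (B.closureLabeling w a x) := by
  obtain ⟨h₁, h₂, h₃⟩ := exists_orbit_enumeration (final w) (sameCycle_final hw) a
  refine ⟨?_, ?_, ?_⟩
  · simp only [closureLabeling, List.map_flatMap, map_passage_labels, closureCode_eq ha]
  · intro P hP Q hQ
    obtain ⟨i, -, hi⟩ := List.mem_flatMap.1 hP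
    obtain ⟨j, -, hj⟩ := List.mem_flatMap.1 hQ
    exact B.over_labels w 0 x _ _ P hi Q hj
  · rw [writhe_closureCode hw]
    -- At `j = n` the tour is back at `a`, but the path has to end at the shifted label, so the
    -- value there is overridden.
    refine isPath_flatMap_range.2 ⟨fun j => if j = n then B.shift w.toBraid.writhe (x a) else
      x ((final w)^[j] a), ?_, if_pos rfl, fun j hj => ?_⟩
    · exact if_neg hw.1.ne
    · have := B.isPath_labels w 0 x ((final w)^[j] a)
      rw [hx, ← Function.iterate_succ_apply' (final w) j a] at this
      beta_reduce
      rw [if_neg hj.ne]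
      by_cases hj' : j + 1 = n
      · subst hj'
        rw [h₃, if_pos rfl] at this
        rwa [if_pos rfl]
      · rw [if_neg hj']
        have hne : (final w)^[j + 1] a ≠ a :=
          fun h => absurd (h₂ (j + 1) (by omega) 0 (by omega) h) (by omega)
        rwa [if_neg hne] at this

/-- Along the tour, the entering label and the passages of a strand determine its leaving label.
Until the tour returns to `a`, this is the entering label of the next strand. -/
theorem IsClosed.eq {w : BraidWord n} (hw : w.toBraid.ClosesToKnot) {a : Fin n}
    {x x' : Fin n → S} (hx : B.IsClosed w a x) (hx' : B.IsClosed w a x')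
    (h : B.closureLabeling w a x = B.closureLabeling w a x') : x = x' := by
  obtain ⟨h₁, h₂, h₃⟩ := exists_orbit_enumeration (final w) (sameCycle_final hw) a
  have hl := List.eq_of_flatMap_range_eq (fun j _ => by
    rw [← List.length_map (f := passage), map_passage_labels, ← B.map_passage_labels w 0 x',
      List.length_map]) (congrArg Prod.snd h)
  have key : ∀ j < n, x ((final w)^[j] a) = x' ((final w)^[j] a) := by
    intro j
    induction j with
    | zero => exact fun _ => congrArg Prod.fst h
    | succ j ih =>
      intro hj
      have g := B.isPath_labels w 0 x ((final w)^[j] a)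
      have g' := B.isPath_labels w 0 x' ((final w)^[j] a)
      have hne : (final w)^[j + 1] a ≠ a :=
        fun h => absurd (h₂ (j + 1) hj 0 (by omega) h) (by omega)
      rw [hx, ← Function.iterate_succ_apply' (final w) j a, if_neg hne, ih (by omega),
        hl j (by omega)] at g
      rw [hx', ← Function.iterate_succ_apply' (final w) j a, if_neg hne] at g'
      exact g.right_unique g'
  funext p
  obtain ⟨j, hj, rfl⟩ := h₁ p
  exact key j hj

theorem IsLabeling.exists_isClosed {w : BraidWord n} (hw : w.toBraid.ClosesToKnot) {a : Fin n}
    (ha : a.1 = 0) {y : S × List (LabeledPassage S)} (hy : B.IsLabeling w.closureCode y) :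
    ∃ x, B.IsClosed w a x ∧ B.closureLabeling w a x = y := by
  obtain ⟨h₁, h₂, h₃⟩ := exists_orbit_enumeration (final w) (sameCycle_final hw) a
  obtain ⟨y, l⟩ := y
  obtain ⟨g₁, g₂, g₃⟩ := hy
  dsimp only at g₁ g₂ g₃
  rw [closureCode_eq ha] at g₁
  rw [writhe_closureCode hw] at g₃
  obtain ⟨d, rfl, hd⟩ := List.exists_of_map_eq_flatMap_range g₁
  obtain ⟨Y, hY₀, hYn, hY⟩ := isPath_flatMap_range.1 g₃
  -- `idx p` is the time at which the tour from `a` enters position `p`.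
  choose idx hidx hidx' using h₁
  have hidx_iter : ∀ j < n, idx ((final w)^[j] a) = j :=
    fun j hj => h₂ _ (hidx _) _ hj (hidx' _)
  have hlab := B.eq_labels w 0 (fun p => Y (idx p)) (fun p => Y (idx p + 1)) (fun p => d (idx p))
    (fun p => by rw [hd _ (hidx p), hidx']) (fun p => hY _ (hidx p))
    (fun p q P hP Q hQ => g₂ P (List.mem_flatMap.2 ⟨_, List.mem_range.2 (hidx p), hP⟩) Q
      (List.mem_flatMap.2 ⟨_, List.mem_range.2 (hidx q), hQ⟩))
  have hidx_a : idx a = 0 := hidx_iter 0 hw.1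
  refine ⟨fun p => Y (idx p), ?_, ?_⟩
  · intro p
    obtain ⟨q, rfl⟩ := (final w).surjective p
    have h₄ := B.isPath_labels w 0 (fun p => Y (idx p)) q
    rw [← hlab] at h₄
    rw [h₄.right_unique (hY _ (hidx q))]
    have hq : (final w) q = (final w)^[idx q + 1] a := by
      rw [Function.iterate_succ_apply', hidx']
    -- A strand that is not the last of the tour hands its label to the next one. The last one
    -- returns to `a`, where `Y n` is `Y 0` shifted by the writhe.
    rcases (Nat.succ_le_of_lt (hidx q)).lt_or_eq with h | h
    · have h₅ : (final w) q ≠ a := fun h' =>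
        absurd (h₂ (idx q + 1) h 0 hw.1 (hq.symm.trans h')) (Nat.succ_ne_zero _)
      rw [if_neg h₅]
      beta_reduce
      rw [hq]
      exact congrArg Y (hidx_iter _ h).symm
    · replace h : idx q + 1 = n := h
      rw [h, h₃] at hq
      rw [if_pos hq, h, hYn]
      beta_reduce
      rw [hq, hidx_a, hY₀]
  · refine Prod.ext ?_ (List.flatMap_range_congr fun j hj => ?_)
    · exact (congrArg Y hidx_a).trans hY₀
    · rw [← hlab, hidx_iter j hj]

end Birack

/-! ### From biracks back to the category. -/

noncomputable section

namespace Cocartesian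

variable {C : Type u} [Category.{v} C] [HasFiniteColimits C] {A : C}

/-- Coequalizers with the identity are isomorphic if the invariant morphisms out of the two objects
are in a natural bijection. -/
theorem nonempty_iso_of_rel {P Q : C} (f : P ⟶ P) (g : Q ⟶ Q)
    (R : ∀ {X : C}, (P ⟶ X) → (Q ⟶ X) → Prop)
    (hR : ∀ {X Y : C} (h : X ⟶ Y) (x : P ⟶ X) (y : Q ⟶ X), R x y → R (x ≫ h) (y ≫ h))
    (h₁ : ∀ {X : C} (x : P ⟶ X), f ≫ x = x → ∃! y : Q ⟶ X, g ≫ y = y ∧ R x y)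
    (h₂ : ∀ {X : C} (y : Q ⟶ X), g ≫ y = y → ∃! x : P ⟶ X, f ≫ x = x ∧ R x y) :
    Nonempty (coequalizer (𝟙 P) f ≅ coequalizer (𝟙 Q) g) := by
  have hf : f ≫ coequalizer.π (𝟙 P) f = coequalizer.π (𝟙 P) f := by
    rw [← coequalizer.condition, Category.id_comp]
  have hg : g ≫ coequalizer.π (𝟙 Q) g = coequalizer.π (𝟙 Q) g := by
    rw [← coequalizer.condition, Category.id_comp]
  -- The Yoneda argument: the partners of the two universal invariant morphisms induce the maps
  -- between the coequalizers.
  obtain ⟨y, ⟨hy, hxy⟩, hy'⟩ := h₁ _ hf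
  obtain ⟨x, ⟨hx, hxy'⟩, hx'⟩ := h₂ _ hg
  let a : coequalizer (𝟙 P) f ⟶ coequalizer (𝟙 Q) g :=
    coequalizer.desc x (by rw [Category.id_comp, hx])
  let b : coequalizer (𝟙 Q) g ⟶ coequalizer (𝟙 P) f :=
    coequalizer.desc y (by rw [Category.id_comp, hy])
  have ha : coequalizer.π (𝟙 P) f ≫ a = x := coequalizer.π_desc _ _
  have hb : coequalizer.π (𝟙 Q) g ≫ b = y := coequalizer.π_desc _ _
  refine ⟨⟨a, b, ?_, ?_⟩⟩
  · apply coequalizer.hom_ext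
    have e := hR b _ _ hxy'
    rw [hb] at e
    rw [← Category.assoc, ha, Category.comp_id]
    -- By naturality `x ≫ b` and the universal morphism are both partners of `y`, so they agree.
    exact (h₂ y hy).unique ⟨by rw [← Category.assoc, hx], e⟩ ⟨hf, hxy⟩
  · apply coequalizer.hom_ext
    have e := hR a _ _ hxy
    rw [ha] at e
    rw [← Category.assoc, hb, Category.comp_id]
    exact (h₁ x hx).unique ⟨by rw [← Category.assoc, hy], e⟩ ⟨hg, hxy'⟩

variable {σ : A ⨿ A ⟶ A ⨿ A}

theorem comp_desc (σ : A ⨿ A ⟶ A ⨿ A) {X : C} (a b : A ⟶ X) :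
    σ ≫ coprod.desc a b =
      coprod.desc (coprod.inl ≫ σ ≫ coprod.desc a b) (coprod.inr ≫ σ ≫ coprod.desc a b) := by
  apply coprod.hom_ext <;> simp only [coprod.inl_desc, coprod.inr_desc]

theorem pair_comp {n i : ℕ} (hi : i + 1 < n) {X : C} (x : copower A n ⟶ X) :
    pair A n i hi ≫ x = coprod.desc (Sigma.ι (fun _ : Fin n => A) ⟨i, by omega⟩ ≫ x)
      (Sigma.ι (fun _ : Fin n => A) ⟨i + 1, hi⟩ ≫ x) := by
  apply coprod.hom_ext <;>
    simp only [pair, coprod.inl_desc, coprod.inr_desc, coprod.inl_desc_assoc, coprod.inr_desc_assoc]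

theorem twist_comp_desc_three (σ : A ⨿ A ⟶ A ⨿ A) {X : C} (p q s : A ⟶ X) :
    twist σ 3 0 (by omega) ≫ Sigma.desc ![p, q, s] =
        Sigma.desc ![coprod.inl ≫ σ ≫ coprod.desc p q, coprod.inr ≫ σ ≫ coprod.desc p q, s] ∧
      twist σ 3 1 (by omega) ≫ Sigma.desc ![p, q, s] =
        Sigma.desc ![p, coprod.inl ≫ σ ≫ coprod.desc q s, coprod.inr ≫ σ ≫ coprod.desc q s] := by
  constructor
  all_goals
    apply Sigma.hom_ext
    intro k
    rw [Sigma.ι_desc, ← Category.assoc]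
    fin_cases k
  · rw [ι_twist_left _ _ _ rfl]
    simp [pair_comp]
  · rw [ι_twist_right _ _ _ rfl]
    simp [pair_comp]
  · rw [ι_twist_of_ne _ _ _ (by decide) (by decide)]
    simp
  · rw [ι_twist_of_ne _ _ _ (by decide) (by decide)]
    simp
  · rw [ι_twist_left _ _ _ rfl]
    simp [pair_comp]
  · rw [ι_twist_right _ _ _ rfl]
    simp [pair_comp]

/-- The hypothesis says that `coprod.desc a b` coequalizes `σ i₂` and `i₂`. The induced map out of
`E` restricts to `a` along `j'` and to the right-hand side along `j`. -/
theorem torsionAut_comp (hσ : IsReidemeister σ) {X : C} {a b : A ⟶ X}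
    (h : coprod.inr ≫ σ ≫ coprod.desc a b = b) :
    (torsionAut hσ).hom ≫ a = coprod.inl ≫ σ ≫ coprod.desc a b := by
  have : IsIso ((coprod.inl : A ⟶ A ⨿ A) ≫ partialClosureπ σ) := hσ.isWada
  have h' : (coprod.inr ≫ σ) ≫ coprod.desc a b = coprod.inr ≫ coprod.desc a b := by
    rw [Category.assoc, h, coprod.inr_desc]
  have e : inv ((coprod.inl : A ⟶ A ⨿ A) ≫ partialClosureπ σ) ≫ a =
      coequalizer.desc (coprod.desc a b) h' := by
    rw [IsIso.inv_comp_eq, Category.assoc, coequalizer.π_desc, coprod.inl_desc]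
  change torsion σ hσ.isWada ≫ a = _
  rw [torsion, Category.assoc, e, Category.assoc, Category.assoc, coequalizer.π_desc]

theorem desc_ext_iff {X : C} {a b a' b' : A ⟶ X} :
    coprod.desc a b = coprod.desc a' b' ↔ a = a' ∧ b = b' := by
  constructor
  · intro h
    have h₁ := congrArg (coprod.inl ≫ ·) h
    have h₂ := congrArg (coprod.inr ≫ ·) h
    simp only [coprod.inl_desc, coprod.inr_desc] at h₁ h₂
    exact ⟨h₁, h₂⟩
  · rintro ⟨rfl, rfl⟩
    rfl

theorem exists_desc {X : C} (f : A ⨿ A ⟶ X) : ∃ a b : A ⟶ X, f = coprod.desc a b :=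
  ⟨coprod.inl ≫ f, coprod.inr ≫ f, by
    apply coprod.hom_ext <;> simp only [coprod.inl_desc, coprod.inr_desc]⟩

/-- Precomposition with an automorphism. -/
def precomp (f : Aut A) (X : C) : Equiv.Perm (A ⟶ X) where
  toFun a := f.hom ≫ a
  invFun a := f.inv ≫ a
  left_inv a := f.inv_hom_id_assoc a
  right_inv a := f.hom_inv_id_assoc a

/-- The birack of morphisms from `A` to `X`. -/
def homBirack (hσ : IsReidemeister σ) (X : C) : Birack (A ⟶ X) where
  left a b := coprod.inl ≫ σ ≫ coprod.desc a b
  right a b := coprod.inr ≫ σ ≫ coprod.desc a b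
  torsion := precomp (torsionAut hσ) X
  op_injective {a b a' b'} h h' := by
    have := hσ.isYangBaxter.isIso
    rw [← desc_ext_iff, ← cancel_epi σ, comp_desc σ a b, comp_desc σ a' b', h, h']
  op_surjective c d := by
    have := hσ.isYangBaxter.isIso
    obtain ⟨a, b, h⟩ := exists_desc (inv σ ≫ coprod.desc c d)
    refine ⟨a, b, ?_, ?_⟩ <;>
      rw [← h, IsIso.hom_inv_id_assoc]
    · exact coprod.inl_desc _ _
    · exact coprod.inr_desc _ _
  left_injective {a b b'} h := by
    have := hσ.isDualizable.left
    have : coprod.desc a b = coprod.desc a b' := by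
      -- Precomposition with `(σ i₁, i₁)` sends `(a, b)` to `(left a b, a)`, so its invertibility
      -- makes each `left a` bijective. For the operation `right` the map `(σ i₂, i₂)` plays this
      -- role.
      rw [← cancel_epi (coprod.desc (coprod.inl ≫ σ) coprod.inl : A ⨿ A ⟶ A ⨿ A)]
      apply coprod.hom_ext <;>
        simp only [coprod.inl_desc, coprod.inl_desc_assoc, coprod.inr_desc_assoc, Category.assoc, h]
    exact (desc_ext_iff.1 this).2
  left_surjective a c := by
    have := hσ.isDualizable.left
    obtain ⟨a', b, h⟩ := exists_desc
      (inv (coprod.desc (coprod.inl ≫ σ) coprod.inl : A ⨿ A ⟶ A ⨿ A) ≫ coprod.desc c a)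
    rw [IsIso.inv_comp_eq] at h
    have h₁ := congrArg (coprod.inl ≫ ·) h
    have h₂ := congrArg (coprod.inr ≫ ·) h
    simp only [coprod.inl_desc, coprod.inr_desc, coprod.inl_desc_assoc, coprod.inr_desc_assoc,
      Category.assoc] at h₁ h₂
    subst h₂
    exact ⟨b, h₁.symm⟩
  right_injective {a a' b} h := by
    have := hσ.isDualizable.right
    have : coprod.desc a b = coprod.desc a' b := by
      rw [← cancel_epi (coprod.desc (coprod.inr ≫ σ) coprod.inr : A ⨿ A ⟶ A ⨿ A)]
      apply coprod.hom_ext <;>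
        simp only [coprod.inr_desc, coprod.inl_desc_assoc, coprod.inr_desc_assoc, Category.assoc, h]
    exact (desc_ext_iff.1 this).1
  right_surjective b c := by
    have := hσ.isDualizable.right
    obtain ⟨a, b', h⟩ := exists_desc
      (inv (coprod.desc (coprod.inr ≫ σ) coprod.inr : A ⨿ A ⟶ A ⨿ A) ≫ coprod.desc c b)
    rw [IsIso.inv_comp_eq] at h
    have h₁ := congrArg (coprod.inl ≫ ·) h
    have h₂ := congrArg (coprod.inr ≫ ·) h
    simp only [coprod.inl_desc, coprod.inr_desc, coprod.inl_desc_assoc, coprod.inr_desc_assoc,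
      Category.assoc] at h₁ h₂
    subst h₂
    exact ⟨a, h₁.symm⟩
  -- The Yang–Baxter equation is evaluated on the triple `(p, q, s)`; the three inclusions give the
  -- three identities. Under precomposition the rightmost factor acts on labels first.
  yangBaxter_left p q s := by
    have h := congrArg (Sigma.ι (fun _ : Fin 3 => A) 0 ≫ · ≫ Sigma.desc ![p, q, s])
      hσ.isYangBaxter.yangBaxter
    simpa [twist_comp_desc_three] using h.symm
  yangBaxter_middle p q s := by
    have h := congrArg (Sigma.ι (fun _ : Fin 3 => A) 1 ≫ · ≫ Sigma.desc ![p, q, s])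
      hσ.isYangBaxter.yangBaxter
    simpa [twist_comp_desc_three] using h.symm
  yangBaxter_right p q s := by
    have h := congrArg (Sigma.ι (fun _ : Fin 3 => A) 2 ≫ · ≫ Sigma.desc ![p, q, s])
      hσ.isYangBaxter.yangBaxter
    simpa [twist_comp_desc_three] using h.symm
  kink_exists a := by
    have : IsIso ((coprod.inl : A ⟶ A ⨿ A) ≫ partialClosureπ σ) := hσ.isWada
    -- Pairs `(a, b)` with `right a b = b` are the morphisms out of `E`. As `j'` is invertible, each
    -- `a` extends to exactly one of them.
    obtain ⟨a', b, h⟩ := exists_desc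
      (partialClosureπ σ ≫ inv ((coprod.inl : A ⟶ A ⨿ A) ≫ partialClosureπ σ) ≫ a)
    have h₁ : a = a' := by
      have := congrArg (coprod.inl ≫ ·) h
      rwa [← Category.assoc, IsIso.hom_inv_id_assoc, coprod.inl_desc] at this
    have h₂ : coprod.inr ≫ σ ≫ coprod.desc a' b = b := by
      rw [← h, ← Category.assoc, ← Category.assoc, coequalizer.condition, Category.assoc, h,
        coprod.inr_desc]
    subst h₁
    exact ⟨b, h₂, (torsionAut_comp hσ h₂).symm⟩
  kink_unique {a b b'} h h' := by
    have : IsIso ((coprod.inl : A ⟶ A ⨿ A) ≫ partialClosureπ σ) := hσ.isWada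
    have e : (coprod.inr ≫ σ) ≫ coprod.desc a b = coprod.inr ≫ coprod.desc a b := by
      rw [Category.assoc, h, coprod.inr_desc]
    have e' : (coprod.inr ≫ σ) ≫ coprod.desc a b' = coprod.inr ≫ coprod.desc a b' := by
      rw [Category.assoc, h', coprod.inr_desc]
    have : coequalizer.desc _ e = coequalizer.desc _ e' := by
      rw [← cancel_epi ((coprod.inl : A ⟶ A ⨿ A) ≫ partialClosureπ σ)]
      simp only [Category.assoc, coequalizer.π_desc, coprod.inl_desc]
    have h₃ := congrArg (coprod.inr ≫ coequalizer.π _ _ ≫ ·) this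
    simpa only [coequalizer.π_desc, coprod.inr_desc] using h₃

theorem isHom_homBirack (hσ : IsReidemeister σ) {X Y : C} (h : X ⟶ Y) :
    Birack.IsHom (homBirack hσ X) (homBirack hσ Y) (· ≫ h) where
  left a b := by simp [homBirack]
  right a b := by simp [homBirack]
  torsion a := by simp [homBirack, precomp]

theorem homBirack_shift (hσ : IsReidemeister σ) {X : C} (k : ℤ) (a : A ⟶ X) :
    (homBirack hσ X).shift k a = (torsionAut hσ ^ k).hom ≫ a := by
  have hn : ∀ (n : ℕ) (a : A ⟶ X),
      (homBirack hσ X).shift n a = (torsionAut hσ ^ (n : ℤ)).hom ≫ a := by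
    intro n
    induction n with
    | zero =>
      intro a
      rw [Nat.cast_zero, Birack.shift_zero, zpow_zero]
      exact (Category.id_comp a).symm
    | succ n ih =>
      intro a
      push_cast
      rw [add_comm, Birack.shift_add, ih, Birack.shift_one, add_comm, zpow_add_one]
      exact (Category.assoc _ _ _).symm
  obtain ⟨n, rfl | rfl⟩ := k.eq_nat_or_neg
  · exact hn n a
  · rw [← (Birack.shift (homBirack hσ X) n).apply_eq_iff_eq, Birack.shift_shift_neg, hn,
      ← Category.assoc]
    have : (torsionAut hσ ^ (-(n : ℤ))) * (torsionAut hσ ^ (n : ℤ)) = 1 := by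
      rw [← zpow_add, neg_add_cancel, zpow_zero]
    have h₂ : (torsionAut hσ ^ (n : ℤ)).hom ≫ (torsionAut hσ ^ (-(n : ℤ))).hom = 𝟙 A :=
      congrArg Iso.hom this
    rw [h₂, Category.id_comp]

/-- The components of a morphism out of a copower. -/
def vec {n : ℕ} {X : C} (x : copower A n ⟶ X) (p : Fin n) : A ⟶ X :=
  Sigma.ι (fun _ : Fin n => A) p ≫ x

theorem vec_injective {n : ℕ} {X : C} {x y : copower A n ⟶ X} (h : vec x = vec y) : x = y :=
  Sigma.hom_ext _ _ (congrFun h)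

theorem vec_desc {n : ℕ} {X : C} (x : Fin n → (A ⟶ X)) : vec (Sigma.desc x) = x := by
  funext p
  simp [vec]

open BraidWord

theorem vec_twist (f : A ⨿ A ⟶ A ⨿ A) {n : ℕ} (i : {i : ℕ // i + 1 < n}) {X : C}
    (x : copower A n ⟶ X) (p : Fin n) : vec (twist f n i.1 i.2 ≫ x) p =
      if p = leftStrand i then
        coprod.inl ≫ f ≫ coprod.desc (vec x (leftStrand i)) (vec x (rightStrand i))
      else if p = rightStrand i then
        coprod.inr ≫ f ≫ coprod.desc (vec x (leftStrand i)) (vec x (rightStrand i))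
      else vec x p := by
  rw [vec, ← Category.assoc]
  split_ifs with h h'
  · subst h
    rw [ι_twist_left f i.2 _ rfl, Category.assoc, Category.assoc, pair_comp]
    rfl
  · subst h'
    rw [ι_twist_right f i.2 _ rfl, Category.assoc, Category.assoc, pair_comp]
    rfl
  · rw [ι_twist_of_ne f i.2 _ (fun e => h (Fin.ext e)) (fun e => h' (Fin.ext e))]
    rfl

theorem opSign_homBirack (hσ : IsReidemeister σ) {X : C} (s : Bool) (a b : A ⟶ X) :
    haveI := hσ.isYangBaxter.isIso
    (homBirack hσ X).opSign s (a, b) =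
      (coprod.inl ≫ (bif s then σ else inv σ) ≫ coprod.desc a b,
        coprod.inr ≫ (bif s then σ else inv σ) ≫ coprod.desc a b) := by
  have := hσ.isYangBaxter.isIso
  cases s
  · rw [Birack.opSign, cond_false, Equiv.symm_apply_eq, Birack.op_apply]
    simp only [homBirack, cond_false, Prod.mk.injEq]
    rw [← comp_desc, IsIso.hom_inv_id_assoc]
    exact ⟨(coprod.inl_desc _ _).symm, (coprod.inr_desc _ _).symm⟩
  · rfl

theorem vec_letterBraid (hσ : IsReidemeister σ) {n : ℕ} (i : {i : ℕ // i + 1 < n}) (s : Bool)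
    {X : C} (x : copower A n ⟶ X) :
    vec ((braidAction hσ.isYangBaxter n (letterBraid i s)).hom ≫ x) =
      (homBirack hσ X).letter i s (vec x) := by
  have := hσ.isYangBaxter.isIso
  have h : (braidAction hσ.isYangBaxter n (letterBraid i s)).hom =
      twist (bif s then σ else inv σ) n i.1 i.2 := by
    cases s
    · rw [letterBraid, cond_false, map_inv, braidAction, BraidGroup.lift_gen]
      rfl
    · rw [letterBraid, cond_true, braidAction, BraidGroup.lift_gen]
      rfl
  funext p
  rw [h, vec_twist, Birack.letter, opSign_homBirack]

/-- Precomposition reverses the composition order of the left action, so the first letter of the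
word is the first to act on labels. -/
theorem vec_toBraid (hσ : IsReidemeister σ) {n : ℕ} (w : BraidWord n) {X : C}
    (x : copower A n ⟶ X) :
    vec ((braidAction hσ.isYangBaxter n w.toBraid).hom ≫ x) =
      (homBirack hσ X).run w (vec x) := by
  induction w generalizing x with
  | nil => rw [toBraid_nil, map_one]; exact congrArg vec (Category.id_comp x)
  | cons l w ih =>
    obtain ⟨i, s⟩ := l
    rw [toBraid_cons, map_mul, Birack.run, ← vec_letterBraid, ← ih]
    exact congrArg vec (Category.assoc _ _ _)

theorem vec_onFirst (f : A ⟶ A) {n : ℕ} {X : C} (x : copower A n ⟶ X) (p : Fin n) :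
    vec (onFirst f n ≫ x) p = if p.1 = 0 then f ≫ vec x p else vec x p := by
  simp only [vec, onFirst, Sigma.ι_map_assoc]
  split_ifs <;> simp

/-- The factor `χ^{-w}` on the first summand undoes the jump by `χ^w` at the strand `a`. -/
theorem psi_comp_eq_iff (hσ : IsReidemeister σ) {n : ℕ} (w : BraidWord n) {a : Fin n}
    (ha : a.1 = 0) {X : C} (x : copower A n ⟶ X) :
    psi hσ w.toBraid ≫ x = x ↔ (homBirack hσ X).IsClosed w a (vec x) := by
  have hp : ∀ p : Fin n, p.1 = 0 ↔ p = a := fun p => by rw [Fin.ext_iff, ha]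
  constructor
  · intro h p
    have := congrFun (congrArg vec h) p
    rw [psi, Category.assoc, vec_onFirst, vec_toBraid] at this
    simp only [hp, ← homBirack_shift] at this
    split_ifs at this ⊢
    · rw [← this, Birack.shift_shift_neg]
    · exact this
  · intro h
    apply vec_injective
    funext p
    rw [psi, Category.assoc, vec_onFirst, vec_toBraid hσ, h p]
    simp only [hp, ← homBirack_shift]
    split_ifs
    · rw [Birack.shift_neg_shift]
    · rfl

/-- Invariant tuples are labelings of the closure codes, and these correspond naturally by
`LabelEquiv.of_sameKnot`. Both directions are instances of one statement, applied to `R` and to its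
converse. -/
theorem nonempty_iso_of_sameKnot (hσ : IsReidemeister σ) {n m : ℕ} (x : BraidWord n)
    (y : BraidWord m) (hx : x.toBraid.ClosesToKnot) (hy : y.toBraid.ClosesToKnot)
    (h : SameKnot x.closureCode y.closureCode) :
    Nonempty (writheAdjustedClosure hσ x.toBraid ≅ writheAdjustedClosure hσ y.toBraid) := by
  obtain ⟨R, h₁, h₂, h₃⟩ := LabelEquiv.of_sameKnot.{v} h
  have key : ∀ {n m : ℕ} {x : BraidWord n} {y : BraidWord m} (hx : x.toBraid.ClosesToKnot)
      (hy : y.toBraid.ClosesToKnot)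
      {R : ∀ {S : Type v}, Birack S → S × List (LabeledPassage S) →
        S × List (LabeledPassage S) → Prop}
      (h₂ : ∀ {S : Type v} (B : Birack S) (a), B.IsLabeling x.closureCode a →
        ∃! b, B.IsLabeling y.closureCode b ∧ R B a b) {X : C} (f : copower A n ⟶ X),
      psi hσ x.toBraid ≫ f = f → ∃! g : copower A m ⟶ X, psi hσ y.toBraid ≫ g = g ∧
        R (homBirack hσ X) ((homBirack hσ X).closureLabeling x ⟨0, hx.1⟩ (vec f))
          ((homBirack hσ X).closureLabeling y ⟨0, hy.1⟩ (vec g)) := by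
    intro n m x y hx hy R h₂ X f hf
    rw [psi_comp_eq_iff hσ x (a := ⟨0, hx.1⟩) rfl] at hf
    obtain ⟨b, ⟨hb, hR⟩, hb'⟩ := h₂ _ _ (hf.isLabeling hx rfl)
    obtain ⟨g, hg, rfl⟩ := hb.exists_isClosed hy (a := ⟨0, hy.1⟩) rfl
    refine ⟨Sigma.desc g, ⟨?_, ?_⟩, ?_⟩
    · rwa [psi_comp_eq_iff hσ y (a := ⟨0, hy.1⟩) rfl, vec_desc]
    · rwa [vec_desc]
    · rintro g' ⟨hg₁, hg₂⟩
      rw [psi_comp_eq_iff hσ y (a := ⟨0, hy.1⟩) rfl] at hg₁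
      have := hg₁.eq hy hg (hb' _ ⟨hg₁.isLabeling hy rfl, hg₂⟩)
      apply vec_injective
      rw [vec_desc, this]
  refine nonempty_iso_of_rel _ _ (fun {X} f g => R (homBirack hσ X)
    ((homBirack hσ X).closureLabeling x ⟨0, hx.1⟩ (vec f))
    ((homBirack hσ X).closureLabeling y ⟨0, hy.1⟩ (vec g))) ?_ (key hx hy h₂)
    (key hy hx (R := fun B a b => R B b a) h₃)
  intro X Y k f g hfg
  have := h₁ _ _ _ (isHom_homBirack hσ k) _ _ hfg
  rw [(isHom_homBirack hσ k).closureLabeling, (isHom_homBirack hσ k).closureLabeling] at this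
  convert this using 2 <;> funext p <;> simp [vec]

end Cocartesian

end

/-! ### Stabilization of braid words: permutation, writhe and labels. -/

namespace BraidWord

variable {n : ℕ}

theorem toBraid_surjective (β : BraidGroup n) : ∃ w : BraidWord n, w.toBraid = β := by
  obtain ⟨g, rfl⟩ := PresentedGroup.mk_surjective _ β
  exact ⟨g.toWord, by rw [toBraid, FreeGroup.mk_toWord]⟩

theorem toBraid_append (w w' : BraidWord n) : toBraid (w ++ w') = toBraid w * toBraid w' := by
  rw [toBraid, ← FreeGroup.mul_mk, map_mul]
  rfl

theorem toBraid_singleton (i : {i : ℕ // i + 1 < n}) (s : Bool) :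
    toBraid [(i, s)] = letterBraid i s := by
  rw [toBraid_cons, toBraid_nil, mul_one]

theorem final_append (w w' : BraidWord n) (p : Fin n) : final (w ++ w') p = final w' (final w p) := by
  simp [final, toBraid_append]

/-- The same generator on one more strand. -/
def addStrandGen (i : {i : ℕ // i + 1 < n}) : {i : ℕ // i + 1 < n + 1} := ⟨i.1, by omega⟩

/-- The same word on one more strand. -/
def addStrand (w : BraidWord n) : BraidWord (n + 1) := w.map fun l => (addStrandGen l.1, l.2)

theorem toBraid_addStrand (w : BraidWord n) :
    w.addStrand.toBraid = BraidGroup.addStrand n w.toBraid := by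
  induction w with
  | nil => exact (map_one (BraidGroup.addStrand n)).symm
  | cons l w ih =>
    obtain ⟨i, s⟩ := l
    have h : addStrand w = w.map fun l => (addStrandGen l.1, l.2) := rfl
    rw [addStrand, List.map_cons, toBraid_cons, toBraid_cons, map_mul, ← h, ih]
    congr 1
    cases s
    · simp only [letterBraid, cond_false, map_inv, BraidGroup.addStrand, BraidGroup.lift_gen]
      rfl
    · simp only [letterBraid, cond_true, BraidGroup.addStrand, BraidGroup.lift_gen]
      rfl

theorem leftStrand_addStrandGen (i : {i : ℕ // i + 1 < n}) :
    leftStrand (addStrandGen i) = (leftStrand i).castSucc := rfl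

theorem rightStrand_addStrandGen (i : {i : ℕ // i + 1 < n}) :
    rightStrand (addStrandGen i) = (rightStrand i).castSucc := rfl

theorem swap_addStrandGen_castSucc (i : {i : ℕ // i + 1 < n}) (p : Fin n) :
    swap (addStrandGen i) p.castSucc = (swap i p).castSucc := by
  by_cases h : p = leftStrand i
  · rw [h, ← leftStrand_addStrandGen, swap_left, swap_left, rightStrand_addStrandGen]
  by_cases h' : p = rightStrand i
  · rw [h', ← rightStrand_addStrandGen, swap_right, swap_right, leftStrand_addStrandGen]
  · rw [swap_of_ne h h', swap_of_ne]
    · rwa [leftStrand_addStrandGen, Ne, Fin.castSucc_inj]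
    · rwa [rightStrand_addStrandGen, Ne, Fin.castSucc_inj]

theorem last_ne_strand (i : {i : ℕ // i + 1 < n}) :
    Fin.last n ≠ leftStrand (addStrandGen i) ∧ Fin.last n ≠ rightStrand (addStrandGen i) :=
  ⟨(Fin.castSucc_ne_last (leftStrand i)).symm, (Fin.castSucc_ne_last (rightStrand i)).symm⟩

theorem final_addStrand_castSucc (w : BraidWord n) (p : Fin n) :
    final w.addStrand p.castSucc = (final w p).castSucc := by
  induction w generalizing p with
  | nil => exact (final_nil _).trans (congrArg Fin.castSucc (final_nil p).symm)
  | cons l w ih =>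
    rw [final_cons, ← ih, ← swap_addStrandGen_castSucc, ← final_cons]
    rfl

theorem final_addStrand_last (w : BraidWord n) :
    final w.addStrand (Fin.last n) = Fin.last n := by
  induction w with
  | nil => exact final_nil _
  | cons l w ih =>
    have := final_cons (addStrandGen l.1) l.2 (addStrand w) (Fin.last n)
    rw [swap_of_ne (last_ne_strand _).1 (last_ne_strand _).2, ih] at this
    exact this

/-- The last generator on `n + 2` strands. -/
def lastGen (n : ℕ) : {i : ℕ // i + 1 < n + 2} := ⟨n, by omega⟩

/-- Stabilization of a braid word. -/
def stabilize (w : BraidWord (n + 1)) (s : Bool) : BraidWord (n + 2) :=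
  w.addStrand ++ [(lastGen n, s)]

theorem leftStrand_lastGen : leftStrand (lastGen n) = (Fin.last n).castSucc := rfl

theorem rightStrand_lastGen : rightStrand (lastGen n) = Fin.last (n + 1) := rfl

theorem final_stabilize (w : BraidWord (n + 1)) (s : Bool) (p : Fin (n + 2)) :
    final (w.stabilize s) p = swap (lastGen n) (final w.addStrand p) := by
  rw [stabilize, final_append, final_cons, final_nil]

theorem final_stabilize_castSucc (w : BraidWord (n + 1)) (s : Bool) (p : Fin (n + 1)) :
    final (w.stabilize s) p.castSucc =
      if final w p = Fin.last n then Fin.last (n + 1) else (final w p).castSucc := by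
  rw [final_stabilize, final_addStrand_castSucc]
  split_ifs with h
  · rw [h, ← leftStrand_lastGen, swap_left, rightStrand_lastGen]
  · rw [swap_of_ne]
    · rwa [leftStrand_lastGen, Ne, Fin.castSucc_inj]
    · exact Fin.castSucc_ne_last _

theorem final_stabilize_last (w : BraidWord (n + 1)) (s : Bool) :
    final (w.stabilize s) (Fin.last (n + 1)) = (Fin.last n).castSucc := by
  rw [final_stabilize, final_addStrand_last, ← rightStrand_lastGen, swap_right, leftStrand_lastGen]

theorem _root_.Equiv.Perm.SameCycle.map {α β : Type*} {σ : Equiv.Perm α} {τ : Equiv.Perm β}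
    {f : α → β} (hf : ∀ a, τ.SameCycle (f a) (f (σ a))) {a b : α} (h : σ.SameCycle a b) :
    τ.SameCycle (f a) (f b) := by
  have hn : ∀ (k : ℕ) (a : α), τ.SameCycle (f a) (f ((σ ^ k) a)) := by
    intro k
    induction k with
    | zero => exact fun a => Equiv.Perm.SameCycle.refl _ _
    | succ k ih =>
      intro a
      rw [pow_succ', Equiv.Perm.mul_apply]
      exact (ih a).trans (hf _)
  obtain ⟨k, rfl⟩ := h
  obtain ⟨k, rfl | rfl⟩ := k.eq_nat_or_neg
  · exact hn k a
  · have := hn k ((σ ^ (-(k : ℤ))) a)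
    rw [zpow_neg, zpow_natCast, ← Equiv.Perm.mul_apply, mul_inv_cancel, Equiv.Perm.one_apply] at this
    rw [zpow_neg, zpow_natCast]
    exact this.symm

theorem closesToKnot_iff {w : BraidWord n} :
    w.toBraid.ClosesToKnot ↔ 0 < n ∧ ∀ i j, (final w).SameCycle i j := by
  simp only [BraidGroup.ClosesToKnot, final, Equiv.Perm.sameCycle_inv]

theorem closesToKnot_stabilize (w : BraidWord (n + 1)) (s : Bool) :
    (w.stabilize s).toBraid.ClosesToKnot ↔ w.toBraid.ClosesToKnot := by
  rw [closesToKnot_iff, closesToKnot_iff]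
  simp only [Nat.zero_lt_succ, true_and]
  constructor
  · intro h i j
    -- `ρ` merges the new strand with its neighbour, so one step of the stabilized permutation
    -- becomes at most one step of the old one.
    let ρ : Fin (n + 2) → Fin (n + 1) := Fin.lastCases (Fin.last n) id
    have hl : ρ (Fin.last (n + 1)) = Fin.last n := Fin.lastCases_last
    have hc : ∀ p : Fin (n + 1), ρ p.castSucc = p := fun p => Fin.lastCases_castSucc p
    have key : ∀ a, (final w).SameCycle (ρ a) (ρ (final (w.stabilize s) a)) := by
      intro a
      refine Fin.lastCases ?_ (fun p => ?_) a
      · rw [final_stabilize_last, hl, hc]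
      · rw [final_stabilize_castSucc, hc]
        have e : ρ (if final w p = Fin.last n then Fin.last (n + 1) else (final w p).castSucc) =
            final w p := by
          split_ifs with h
          · rw [hl, h]
          · rw [hc]
        rw [e]
        exact Equiv.Perm.sameCycle_apply_right.2 (Equiv.Perm.SameCycle.refl _ _)
    have := (h i.castSucc j.castSucc).map key
    rwa [hc, hc] at this
  · intro h
    have key : ∀ p : Fin (n + 1),
        (final (w.stabilize s)).SameCycle p.castSucc (final w p).castSucc := by
      intro p
      by_cases hp : final w p = Fin.last n
      -- A strand leaving `w` at its last position makes a detour along the new strand, so two steps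
      -- replace one.
      · refine ⟨2, ?_⟩
        have e := final_stabilize_castSucc w s p
        rw [if_pos hp] at e
        rw [zpow_ofNat, pow_two, Equiv.Perm.mul_apply, e, final_stabilize_last, hp]
      · have e := final_stabilize_castSucc w s p
        rw [if_neg hp] at e
        rw [← e]
        exact Equiv.Perm.sameCycle_apply_right.2 (Equiv.Perm.SameCycle.refl _ _)
    have hcast : ∀ a : Fin (n + 2), ∃ p : Fin (n + 1),
        (final (w.stabilize s)).SameCycle a p.castSucc := by
      intro a
      refine Fin.lastCases ⟨Fin.last n, ?_⟩ (fun p => ⟨p, Equiv.Perm.SameCycle.refl _ _⟩) a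
      rw [← final_stabilize_last w s]
      exact Equiv.Perm.sameCycle_apply_right.2 (Equiv.Perm.SameCycle.refl _ _)
    intro a b
    obtain ⟨p, hp⟩ := hcast a
    obtain ⟨q, hq⟩ := hcast b
    exact hp.trans (((h p q).map (f := Fin.castSucc) key).trans hq.symm)

end BraidWord

namespace BraidGroup

variable {n : ℕ}

theorem writhe_mul (β γ : BraidGroup n) : (β * γ).writhe = β.writhe + γ.writhe := by
  unfold writhe
  rw [map_mul, toAdd_mul]

theorem writhe_inv (β : BraidGroup n) : (β⁻¹).writhe = -β.writhe := by
  unfold writhe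
  rw [map_inv, toAdd_inv]

theorem writhe_conj (β γ : BraidGroup n) : (γ * β * γ⁻¹).writhe = β.writhe := by
  rw [writhe_mul, writhe_mul, writhe_inv]
  ring

theorem closesToKnot_conj (β γ : BraidGroup n) :
    (γ * β * γ⁻¹).ClosesToKnot ↔ β.ClosesToKnot := by
  simp only [ClosesToKnot, map_mul, map_inv, Equiv.Perm.sameCycle_conj]
  refine and_congr_right fun _ => ⟨fun h i j => ?_, fun h i j => h _ _⟩
  have := h (perm n γ i) (perm n γ j)
  simpa only [← Equiv.Perm.mul_apply, inv_mul_cancel, Equiv.Perm.one_apply] using this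

end BraidGroup

open BraidWord

namespace BraidWord

variable {n : ℕ}

theorem writhe_nil : (toBraid ([] : BraidWord n)).writhe = 0 := by
  simp [toBraid_nil, BraidGroup.writhe]

theorem writhe_addStrand (w : BraidWord n) : w.addStrand.toBraid.writhe = w.toBraid.writhe := by
  induction w with
  | nil => exact writhe_nil.trans writhe_nil.symm
  | cons l w ih =>
    rw [writhe_toBraid_cons, ← ih, ← writhe_toBraid_cons (addStrandGen l.1)]
    rfl

theorem writhe_stabilize (w : BraidWord (n + 1)) (s : Bool) :
    (w.stabilize s).toBraid.writhe = w.toBraid.writhe + signOf s := by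
  rw [stabilize, toBraid_append, BraidGroup.writhe_mul, writhe_addStrand, writhe_toBraid_cons,
    writhe_nil, add_zero]

end BraidWord

namespace Birack

variable {S : Type*} (B : Birack S) {n : ℕ}

/-- The strands exchange positions, and each takes its exponent along; hence `j` and `k` are
swapped. -/
theorem opSign_shift (s : Bool) (j k : ℤ) (a b : S) :
    B.opSign s (B.shift j a, B.shift k b) =
      (B.shift k (B.opSign s (a, b)).1, B.shift j (B.opSign s (a, b)).2) := by
  have h : B.opSign s (a, b) = ((B.opSign s (a, b)).1, (B.opSign s (a, b)).2) := rfl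
  rw [crossingRel_iff] at h ⊢
  cases s
  · exact B.crossingRel_shift (s := false) k j h
  · exact B.crossingRel_shift (s := true) j k h

theorem letter_shift (i : {i : ℕ // i + 1 < n}) (s : Bool) (g : Fin n → ℤ) (x : Fin n → S)
    (p : Fin n) : B.letter i s (fun q => B.shift (g q) (x q)) p =
      B.shift (g (swap i p)) (B.letter i s x p) := by
  by_cases h : p = leftStrand i
  · rw [h, letter_left, letter_left, opSign_shift, swap_left]
  by_cases h' : p = rightStrand i
  · rw [h', letter_right, letter_right, opSign_shift, swap_right]
  · rw [B.letter_of_ne h h', B.letter_of_ne h h', swap_of_ne h h']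

theorem run_append (w w' : BraidWord n) (x : Fin n → S) :
    B.run (w ++ w') x = B.run w' (B.run w x) := by
  induction w generalizing x with
  | nil => rfl
  | cons l w ih => exact ih _

theorem letter_addStrandGen_castSucc (i : {i : ℕ // i + 1 < n}) (s : Bool) (x : Fin (n + 1) → S)
    (p : Fin n) : B.letter (addStrandGen i) s x p.castSucc =
      B.letter i s (fun q => x q.castSucc) p := by
  by_cases h : p = leftStrand i
  · rw [h, ← leftStrand_addStrandGen, letter_left, letter_left]
    rfl
  by_cases h' : p = rightStrand i
  · rw [h', ← rightStrand_addStrandGen, letter_right, letter_right]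
    rfl
  · rw [B.letter_of_ne h h', letter_of_ne]
    · rwa [leftStrand_addStrandGen, Ne, Fin.castSucc_inj]
    · rwa [rightStrand_addStrandGen, Ne, Fin.castSucc_inj]

theorem run_addStrand_castSucc (w : BraidWord n) (x : Fin (n + 1) → S) (p : Fin n) :
    B.run w.addStrand x p.castSucc = B.run w (fun q => x q.castSucc) p := by
  induction w generalizing x with
  | nil => rfl
  | cons l w ih =>
    refine (ih _).trans ?_
    simp only [letter_addStrandGen_castSucc]
    rfl

theorem run_addStrand_last (w : BraidWord n) (x : Fin (n + 1) → S) :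
    B.run w.addStrand x (Fin.last n) = x (Fin.last n) := by
  induction w generalizing x with
  | nil => rfl
  | cons l w ih =>
    exact (ih _).trans (B.letter_of_ne (last_ne_strand _).1 (last_ne_strand _).2 _ _)

/-- Closing the right strand of `σ^{±1}` makes a kink that the left strand enters as overpass for
`σ` and as underpass for `σ⁻¹`, so the sign occurs in both arguments of `KinkRel`. -/
theorem opSign_eq_iff {s : Bool} {a b c : S} :
    B.opSign s (a, b) = (c, b) ↔ B.KinkRel s s a b c := by
  rw [crossingRel_iff]
  cases s <;> rfl

theorem opSign_kink {s : Bool} {a b : S} (h : (B.opSign s (a, b)).2 = b) :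
    (B.opSign s (a, b)).1 = B.shift (signOf s) a :=
  (B.opSign_eq_iff.1 (Prod.ext rfl h : B.opSign s (a, b) = ((B.opSign s (a, b)).1, b))).eq_shift

theorem existsUnique_opSign (s : Bool) (a : S) : ∃! b, (B.opSign s (a, b)).2 = b := by
  obtain ⟨b, hb⟩ := B.kinkRel_exists s s (B.shift (signOf s) a)
  rw [shift_neg_shift] at hb
  refine ⟨b, congrArg Prod.snd (B.opSign_eq_iff.2 hb), fun b' hb' => ?_⟩
  have h : B.KinkRel s s a b' (B.opSign s (a, b')).1 := B.opSign_eq_iff.1 (Prod.ext rfl hb')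
  rw [B.opSign_kink hb'] at h
  exact h.unique hb

end Birack

/-! ### Markov invariance. -/

noncomputable section

namespace Cocartesian

open BraidWord

variable {C : Type u} [Category.{v} C] [HasFiniteColimits C] {A : C} {σ : A ⨿ A ⟶ A ⨿ A}

/-- The powers of the torsion with exponents `g` on the summands of a copower. -/
def torsionPow (hσ : IsReidemeister σ) {n : ℕ} (g : Fin n → ℤ) : Aut (copower A n) where
  hom := Limits.Sigma.map fun p => (torsionAut hσ ^ g p).hom
  inv := Limits.Sigma.map fun p => (torsionAut hσ ^ g p).inv
  hom_inv_id := by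
    apply Sigma.hom_ext
    intro p
    simp only [Sigma.ι_map_assoc, Sigma.ι_map, Category.comp_id]
    exact Iso.hom_inv_id_assoc (torsionAut hσ ^ g p) _
  inv_hom_id := by
    apply Sigma.hom_ext
    intro p
    simp only [Sigma.ι_map_assoc, Sigma.ι_map, Category.comp_id]
    exact Iso.inv_hom_id_assoc (torsionAut hσ ^ g p) _

theorem vec_torsionPow (hσ : IsReidemeister σ) {n : ℕ} (g : Fin n → ℤ) {X : C}
    (x : copower A n ⟶ X) (p : Fin n) :
    vec ((torsionPow hσ g).hom ≫ x) p = (homBirack hσ X).shift (g p) (vec x p) := by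
  simp only [vec, torsionPow, Sigma.ι_map_assoc, homBirack_shift]

theorem aut_ext_of_vec {n : ℕ} {f g : Aut (copower A n)}
    (h : ∀ {X : C} (x : copower A n ⟶ X) (p : Fin n), vec (f.hom ≫ x) p = vec (g.hom ≫ x) p) :
    f = g := by
  apply Aut.ext
  rw [← Category.comp_id f.hom, ← Category.comp_id g.hom]
  exact vec_injective (funext (h (𝟙 _)))

theorem vec_mul {n : ℕ} (f g : Aut (copower A n)) {X : C} (x : copower A n ⟶ X) :
    vec ((f * g).hom ≫ x) = vec (g.hom ≫ f.hom ≫ x) :=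
  congrArg vec (Category.assoc _ _ _)

theorem torsionPow_add (hσ : IsReidemeister σ) {n : ℕ} (g h : Fin n → ℤ) :
    torsionPow hσ (g + h) = torsionPow hσ g * torsionPow hσ h := by
  refine aut_ext_of_vec fun x p => ?_
  rw [vec_mul, vec_torsionPow, vec_torsionPow, vec_torsionPow, Pi.add_apply, add_comm,
    Birack.shift_add]

/-- This is the sliding of torsion along strands, `Birack.letter_shift`, transported to
automorphisms by testing on all morphisms out of the copower. -/
theorem letterBraid_mul_torsionPow (hσ : IsReidemeister σ) {n : ℕ} (i : {i : ℕ // i + 1 < n})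
    (s : Bool) (g : Fin n → ℤ) :
    braidAction hσ.isYangBaxter n (letterBraid i s) * torsionPow hσ g =
      torsionPow hσ (g ∘ swap i) * braidAction hσ.isYangBaxter n (letterBraid i s) := by
  refine aut_ext_of_vec fun x p => ?_
  have h : vec ((torsionPow hσ (g ∘ swap i)).hom ≫ x) =
      fun q => (homBirack hσ _).shift ((g ∘ swap i) q) (vec x q) :=
    funext fun q => vec_torsionPow hσ _ x q
  rw [vec_mul, vec_mul, vec_torsionPow, vec_letterBraid, vec_letterBraid, h, Birack.letter_shift,
    Function.comp_apply, swap_swap]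

/-- Moving powers of the torsion through a braid. -/
theorem braidAction_mul_torsionPow (hσ : IsReidemeister σ) {n : ℕ} (β : BraidGroup n)
    (g : Fin n → ℤ) : braidAction hσ.isYangBaxter n β * torsionPow hσ (g ∘ BraidGroup.perm n β) =
      torsionPow hσ g * braidAction hσ.isYangBaxter n β := by
  obtain ⟨w, rfl⟩ := toBraid_surjective β
  induction w generalizing g with
  | nil => simp [toBraid_nil]
  | cons l w ih =>
    obtain ⟨i, s⟩ := l
    have h : (g ∘ BraidGroup.perm n (toBraid ((i, s) :: w))) =
        (g ∘ swap i) ∘ BraidGroup.perm n (toBraid w) := by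
      rw [toBraid_cons, map_mul, perm_letterBraid]
      rfl
    have h' : (g ∘ swap i) ∘ swap i = g := funext fun p => congrArg g (swap_swap i p)
    rw [h, toBraid_cons, map_mul, mul_assoc, ih, ← mul_assoc, letterBraid_mul_torsionPow, h',
      mul_assoc]

theorem single_comp_perm {n : ℕ} (e : Equiv.Perm (Fin n)) (p : Fin n) (k : ℤ) :
    (Pi.single (e p) k : Fin n → ℤ) ∘ e = Pi.single p k := by
  funext q
  simp [Pi.single_apply]

/-- The place of a power of the torsion does not matter up to conjugation. -/
theorem isConj_torsionPow (hσ : IsReidemeister σ) {n : ℕ} {β : BraidGroup n}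
    (hβ : β.ClosesToKnot) (g : Fin n → ℤ) (k : ℤ) (p q : Fin n) :
    IsConj (braidAction hσ.isYangBaxter n β * torsionPow hσ (g + Pi.single p k))
      (braidAction hσ.isYangBaxter n β * torsionPow hσ (g + Pi.single q k)) := by
  have step : ∀ p, IsConj (braidAction hσ.isYangBaxter n β * torsionPow hσ (g + Pi.single p k))
      (braidAction hσ.isYangBaxter n β *
        torsionPow hσ (g + Pi.single (BraidGroup.perm n β p) k)) := by
    intro p
    -- Conjugation by `χ^k` at position `perm β p` removes the factor there and pushes it through
    -- `β`, so that it reappears at `p`.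
    refine IsConj.symm (isConj_iff.2 ⟨torsionPow hσ (Pi.single (BraidGroup.perm n β p) k), ?_⟩)
    rw [torsionPow_add, mul_inv_eq_iff_eq_mul, ← mul_assoc, ← braidAction_mul_torsionPow,
      single_comp_perm, add_comm g (Pi.single p k), torsionPow_add]
    simp only [mul_assoc]
  -- As the permutation of `β` is a single cycle, iterating the step reaches every strand.
  obtain ⟨j, rfl⟩ := (hβ.2 p q).exists_nat_pow_eq
  induction j with
  | zero => exact IsConj.refl _
  | succ j ih =>
    rw [pow_succ', Equiv.Perm.mul_apply]
    exact ih.trans (step _)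

theorem nonempty_iso_of_isConj {P : C} {f g : Aut P} (h : IsConj f g) :
    Nonempty (coequalizer (𝟙 P) f.hom ≅ coequalizer (𝟙 P) g.hom) := by
  obtain ⟨c, rfl⟩ := isConj_iff.1 h
  have e : (c * f * c⁻¹).hom = c.inv ≫ f.hom ≫ c.hom := rfl
  have h₁ : ∀ {X : C} (x : P ⟶ X), c.hom ≫ c.inv ≫ x = x := fun x => Iso.hom_inv_id_assoc c x
  have h₂ : ∀ {X : C} (x : P ⟶ X), c.inv ≫ c.hom ≫ x = x := fun x => Iso.inv_hom_id_assoc c x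
  refine nonempty_iso_of_rel _ _ (fun x y => x = c.hom ≫ y)
    (fun h x y hxy => by rw [hxy, Category.assoc]) ?_ ?_
  · intro X x hx
    refine ⟨c.inv ≫ x, ⟨?_, ?_⟩, ?_⟩
    · rw [e, Category.assoc, Category.assoc, h₁, hx]
    · rw [h₁]
    · rintro y ⟨-, rfl⟩
      rw [h₂]
  · intro X y hy
    refine ⟨c.hom ≫ y, ⟨?_, rfl⟩, fun x hx => hx.2⟩
    rw [e] at hy
    nth_rewrite 2 [← hy]
    simp only [Category.assoc, h₁]

theorem psi_eq (hσ : IsReidemeister σ) {n : ℕ} (β : BraidGroup n) {a : Fin n} (ha : a.1 = 0) :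
    psi hσ β = (braidAction hσ.isYangBaxter n β * torsionPow hσ (Pi.single a (-β.writhe))).hom := by
  have h : onFirst ((torsionAut hσ) ^ (-β.writhe)).hom n =
      (torsionPow hσ (Pi.single a (-β.writhe))).hom := by
    rw [← Category.comp_id (onFirst _ _), ← Category.comp_id (torsionPow _ _).hom]
    apply vec_injective
    funext p
    rw [vec_onFirst, vec_torsionPow, homBirack_shift]
    by_cases hp : p = a
    · subst hp
      rw [if_pos ha, Pi.single_eq_same]
    · have hp' : p.1 ≠ 0 := fun h => hp (Fin.ext (h.trans ha.symm))
      rw [if_neg hp', Pi.single_eq_of_ne hp, zpow_zero]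
      exact (Category.id_comp _).symm
  rw [psi, h]
  rfl

theorem writheAdjustedClosure_eq (hσ : IsReidemeister σ) {n : ℕ} (β : BraidGroup n) {a : Fin n}
    (ha : a.1 = 0) : writheAdjustedClosure hσ β = coequalizer (𝟙 (copower A n))
      (braidAction hσ.isYangBaxter n β * torsionPow hσ (Pi.single a (-β.writhe))).hom := by
  have h : ∀ {f g : copower A n ⟶ copower A n}, f = g →
      coequalizer (𝟙 (copower A n)) f = coequalizer (𝟙 (copower A n)) g := by
    rintro f _ rfl
    rfl
  exact h (psi_eq hσ β ha)

theorem nonempty_iso_conj (hσ : IsReidemeister σ) {n : ℕ} (β γ : BraidGroup n)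
    (hβ : β.ClosesToKnot) :
    Nonempty (writheAdjustedClosure hσ β ≅ writheAdjustedClosure hσ (γ * β * γ⁻¹)) := by
  let a : Fin n := ⟨0, hβ.1⟩
  rw [writheAdjustedClosure_eq hσ _ (a := a) rfl, writheAdjustedClosure_eq hσ _ (a := a) rfl,
    BraidGroup.writhe_conj]
  apply nonempty_iso_of_isConj
  -- Conjugation by `γ` carries a factor at `γ⁻¹ a` to `a`, so the torsion is first moved from `a`
  -- to `γ⁻¹ a`.
  have h₁ := isConj_torsionPow hσ hβ 0 (-β.writhe) a ((BraidGroup.perm n γ)⁻¹ a)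
  rw [zero_add, zero_add] at h₁
  refine h₁.trans (isConj_iff.2 ⟨braidAction hσ.isYangBaxter n γ, ?_⟩)
  have h₂ := braidAction_mul_torsionPow hσ γ (Pi.single a (-β.writhe))
  have h₃ := single_comp_perm (BraidGroup.perm n γ) ((BraidGroup.perm n γ)⁻¹ a) (-β.writhe)
  rw [← Equiv.Perm.mul_apply, mul_inv_cancel, Equiv.Perm.one_apply] at h₃
  rw [h₃] at h₂
  rw [map_mul, map_mul, map_inv, mul_inv_eq_iff_eq_mul, mul_assoc, mul_assoc, mul_assoc, ← h₂,
    inv_mul_cancel_left]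

theorem braidAction_mul_torsionPow_comp_eq_iff (hσ : IsReidemeister σ) {n : ℕ} (w : BraidWord n)
    (g : Fin n → ℤ) {X : C} (x : copower A n ⟶ X) :
    (braidAction hσ.isYangBaxter n w.toBraid * torsionPow hσ g).hom ≫ x = x ↔
      ∀ p, (homBirack hσ X).shift (g p) ((homBirack hσ X).run w (vec x) p) = vec x p := by
  have h : vec ((braidAction hσ.isYangBaxter n w.toBraid * torsionPow hσ g).hom ≫ x) =
      fun p => (homBirack hσ X).shift (g p) ((homBirack hσ X).run w (vec x) p) := by
    funext p
    rw [vec_mul, vec_torsionPow, vec_toBraid]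
  constructor
  · intro hx p
    rw [← congrFun h p, hx]
  · intro hx
    exact vec_injective (h.trans (funext hx))

/-- The labels of a stabilized word which are invariant up to powers of the torsion. -/
theorem run_stabilize_iff {S : Type*} (B : Birack S) {n : ℕ} (w : BraidWord (n + 1)) (s : Bool)
    (g : Fin (n + 1) → ℤ) (g' : Fin (n + 2) → ℤ)
    (hg : ∀ p, g' p.castSucc = g p + if p = Fin.last n then -signOf s else 0)
    (hg' : g' (Fin.last (n + 1)) = 0) (x : Fin (n + 2) → S) :
    (∀ p, B.shift (g' p) (B.run (w.stabilize s) x p) = x p) ↔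
      (∀ p, B.shift (g p) (B.run w (fun q => x q.castSucc) p) = x p.castSucc) ∧
      (B.opSign s (B.run w (fun q => x q.castSucc) (Fin.last n), x (Fin.last (n + 1)))).2 =
        x (Fin.last (n + 1)) := by
  have hr : B.run (w.stabilize s) x = B.letter (lastGen n) s (B.run w.addStrand x) :=
    B.run_append _ _ _
  have hop : (B.run w.addStrand x (leftStrand (lastGen n)),
      B.run w.addStrand x (rightStrand (lastGen n))) =
      (B.run w (fun q => x q.castSucc) (Fin.last n), x (Fin.last (n + 1))) :=
    Prod.ext (B.run_addStrand_castSucc w x (Fin.last n)) (B.run_addStrand_last w x)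
  have hlast : B.run (w.stabilize s) x (Fin.last (n + 1)) = (B.opSign s
      (B.run w (fun q => x q.castSucc) (Fin.last n), x (Fin.last (n + 1)))).2 := by
    rw [hr, ← rightStrand_lastGen, Birack.letter_right, hop]
    rfl
  have hmid : B.run (w.stabilize s) x (Fin.last n).castSucc = (B.opSign s
      (B.run w (fun q => x q.castSucc) (Fin.last n), x (Fin.last (n + 1)))).1 := by
    rw [hr, ← leftStrand_lastGen, Birack.letter_left, hop]
  have hne : ∀ p : Fin (n + 1), p ≠ Fin.last n → B.run (w.stabilize s) x p.castSucc =
      B.run w (fun q => x q.castSucc) p := by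
    intro p hp
    rw [hr, Birack.letter_of_ne, B.run_addStrand_castSucc]
    · rwa [leftStrand_lastGen, Ne, Fin.castSucc_inj]
    · exact Fin.castSucc_ne_last p
  have key : (B.opSign s (B.run w (fun q => x q.castSucc) (Fin.last n), x (Fin.last (n + 1)))).2 =
      x (Fin.last (n + 1)) → ∀ p : Fin (n + 1), B.shift (g' p.castSucc)
        (B.run (w.stabilize s) x p.castSucc) = B.shift (g p) (B.run w (fun q => x q.castSucc) p) := by
    intro h p
    rw [hg]
    split_ifs with hp
    · subst hp
      rw [hmid, B.opSign_kink h, ← B.shift_add, neg_add_cancel_right]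
    · rw [hne p hp, add_zero]
  constructor
  · intro h
    have h₀ := h (Fin.last (n + 1))
    rw [hlast, hg', Birack.shift_zero] at h₀
    exact ⟨fun p => (key h₀ p).symm.trans (h p.castSucc), h₀⟩
  · rintro ⟨h₁, h₂⟩ p
    refine Fin.lastCases ?_ (fun p => ?_) p
    · rw [hlast, hg', Birack.shift_zero, h₂]
    · rw [key h₂, h₁]

theorem nonempty_iso_stabilize (hσ : IsReidemeister σ) {n : ℕ} (w : BraidWord (n + 1)) (s : Bool)
    (hw : w.toBraid.ClosesToKnot) : Nonempty (writheAdjustedClosure hσ w.toBraid ≅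
      writheAdjustedClosure hσ (w.stabilize s).toBraid) := by
  have hw' := (closesToKnot_stabilize w s).2 hw
  -- The exponent `-(w ± 1)` is split: `-w` stays on the first strand, while `∓1` is placed on the
  -- strand next to the new one, to cancel the torsion of the kink.
  let g' : Fin (n + 2) → ℤ :=
    Pi.single 0 (-w.toBraid.writhe) + Pi.single (Fin.last n).castSucc (-signOf s)
  have h₁ : Nonempty (coequalizer (𝟙 _) (braidAction hσ.isYangBaxter _ (w.stabilize s).toBraid *
      torsionPow hσ g').hom ≅ writheAdjustedClosure hσ (w.stabilize s).toBraid) := by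
    rw [writheAdjustedClosure_eq hσ _ (a := 0) rfl, writhe_stabilize, neg_add, Pi.single_add]
    exact nonempty_iso_of_isConj (isConj_torsionPow hσ hw' _ _ _ _)
  obtain ⟨e⟩ := h₁
  suffices h : Nonempty (writheAdjustedClosure hσ w.toBraid ≅ coequalizer (𝟙 _)
      (braidAction hσ.isYangBaxter _ (w.stabilize s).toBraid * torsionPow hσ g').hom) from
    h.map (· ≪≫ e)
  rw [writheAdjustedClosure_eq hσ _ (a := 0) rfl]
  have hiff : ∀ {X : C} (y : copower A (n + 2) ⟶ X), (braidAction hσ.isYangBaxter _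
      (w.stabilize s).toBraid * torsionPow hσ g').hom ≫ y = y ↔ _ := fun {X} y =>
    (braidAction_mul_torsionPow_comp_eq_iff hσ _ g' y).trans
      (run_stabilize_iff (homBirack hσ X) w s (Pi.single 0 (-w.toBraid.writhe)) g' (by
        intro p
        have h₀ : p.castSucc = 0 ↔ p = 0 := Fin.castSucc_eq_zero_iff
        simp only [g', Pi.add_apply, Pi.single_apply, Fin.castSucc_inj, h₀]) (by
        simp [g', (Fin.castSucc_ne_last _).symm, Fin.ext_iff]) (vec y))
  refine nonempty_iso_of_rel _ _ (fun x y => vec x = fun q => vec y q.castSucc) ?_ ?_ ?_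
  · intro X Y h x y hxy
    funext p
    have := congrFun hxy p
    simp only [vec] at this ⊢
    rw [← Category.assoc, this, Category.assoc]
  · intro X x hx
    rw [braidAction_mul_torsionPow_comp_eq_iff] at hx
    obtain ⟨b, hb, hb'⟩ := (homBirack hσ X).existsUnique_opSign s
      ((homBirack hσ X).run w (vec x) (Fin.last n))
    have hv : (fun q : Fin (n + 1) => vec (Sigma.desc
        (Fin.snoc (α := fun _ => A ⟶ X) (vec x) b) : copower A (n + 2) ⟶ X) q.castSucc) = vec x := by
      funext q
      rw [vec_desc, Fin.snoc_castSucc]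
    -- The only new label is `b`, the loop of the kink at the stabilizing crossing, which exists
    -- uniquely by `existsUnique_opSign`.
    refine ⟨Sigma.desc (Fin.snoc (α := fun _ => A ⟶ X) (vec x) b), ⟨(hiff _).2 ?_, hv.symm⟩, ?_⟩
    · rw [hv, vec_desc, Fin.snoc_last]
      refine ⟨fun p => ?_, hb⟩
      rw [Fin.snoc_castSucc]
      exact hx p
    · rintro y ⟨hy, hxy⟩
      have h₂ := ((hiff y).1 hy).2
      rw [← hxy] at h₂
      apply vec_injective
      rw [vec_desc]
      funext p
      refine Fin.lastCases ?_ (fun p => ?_) p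
      · rw [Fin.snoc_last, hb' _ h₂]
      · rw [Fin.snoc_castSucc, hxy]
  · intro X y hy
    refine ⟨Sigma.desc fun q => vec y q.castSucc, ⟨?_, vec_desc _⟩, ?_⟩
    · rw [braidAction_mul_torsionPow_comp_eq_iff, vec_desc]
      exact ((hiff y).1 hy).1
    · rintro x ⟨-, hx⟩
      apply vec_injective
      rw [hx, vec_desc]

/-- Markov moves preserve knots and their writhe-adjusted closures. -/
theorem markovMove (hσ : IsReidemeister σ) {x y : Σ n, BraidGroup n} (h : MarkovMove x y) :
    (x.2.ClosesToKnot ↔ y.2.ClosesToKnot) ∧ (x.2.ClosesToKnot →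
      Nonempty (writheAdjustedClosure hσ x.2 ≅ writheAdjustedClosure hσ y.2)) := by
  have stab : ∀ (n : ℕ) (β : BraidGroup (n + 1)) (s : Bool),
      (β.ClosesToKnot ↔
        (BraidGroup.addStrand (n + 1) β * letterBraid (lastGen n) s).ClosesToKnot) ∧
      (β.ClosesToKnot → Nonempty (writheAdjustedClosure hσ β ≅ writheAdjustedClosure hσ
        (BraidGroup.addStrand (n + 1) β * letterBraid (lastGen n) s))) := by
    intro n β s
    obtain ⟨w, rfl⟩ := toBraid_surjective β
    rw [← toBraid_addStrand, ← toBraid_singleton, ← toBraid_append]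
    exact ⟨(closesToKnot_stabilize w s).symm, nonempty_iso_stabilize hσ w s⟩
  cases h with
  | conj n β γ => exact ⟨(BraidGroup.closesToKnot_conj β γ).symm, nonempty_iso_conj hσ β γ⟩
  | stabPos n β => exact stab n β true
  | stabNeg n β => exact stab n β false

theorem markovEquiv (hσ : IsReidemeister σ) {x y : Σ n, BraidGroup n} (h : MarkovEquiv x y) :
    (x.2.ClosesToKnot ↔ y.2.ClosesToKnot) ∧ (x.2.ClosesToKnot →
      Nonempty (writheAdjustedClosure hσ x.2 ≅ writheAdjustedClosure hσ y.2)) := by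
  induction h with
  | rel _ _ h => exact markovMove hσ h
  | refl x => exact ⟨Iff.rfl, fun _ => ⟨Iso.refl _⟩⟩
  | symm _ _ _ ih => exact ⟨ih.1.symm, fun h => (ih.2 (ih.1.2 h)).map Iso.symm⟩
  | trans _ _ _ _ _ ih₁ ih₂ =>
    refine ⟨ih₁.1.trans ih₂.1, fun h => ?_⟩
    obtain ⟨e⟩ := ih₁.2 h
    exact (ih₂.2 (ih₁.1.1 h)).map (e ≪≫ ·)

end Cocartesian

end

theorem mainTheorem4 {C : Type u} [Category.{v} C] [HasFiniteColimits C] {A : C}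
    (σ : A ⨿ A ⟶ A ⨿ A) (hσ : Cocartesian.IsReidemeister σ) :
    (∀ {n m : ℕ} (β : BraidGroup n) (γ : BraidGroup m),
      β.ClosesToKnot → MarkovEquiv ⟨n, β⟩ ⟨m, γ⟩ →
        γ.ClosesToKnot ∧
          Nonempty (Cocartesian.writheAdjustedClosure hσ β ≅
            Cocartesian.writheAdjustedClosure hσ γ)) ∧
    (∀ {n m : ℕ} (x : BraidWord n) (y : BraidWord m),
      x.toBraid.ClosesToKnot → y.toBraid.ClosesToKnot →
        SameKnot x.closureCode y.closureCode →
          Nonempty (Cocartesian.writheAdjustedClosure hσ x.toBraid ≅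
            Cocartesian.writheAdjustedClosure hσ y.toBraid)) :=
  ⟨fun _ _ hβ h => ⟨(Cocartesian.markovEquiv hσ h).1.1 hβ, (Cocartesian.markovEquiv hσ h).2 hβ⟩,
    fun x y => Cocartesian.nonempty_iso_of_sameKnot hσ x y⟩
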